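/- **Setting.** $\mathbb N=\{1,2,\dots\}$, $\mathbb N_0=\mathbb N\cup\{0\}$. Finite continued fractions are the strings $\mathbf c=[0]$, $[0,0]$ and $[0,0,c_1,\dots,c_k]$ with $c_1,\dots,c_{k-1}\in\mathbb N$ and $c_k\in\mathbb N\cup\{-1,0\}$; $[\mathbf c,m]$ denotes $\mathbf c$ with the digit $m$ appended. Writing $c_0=0$, their value is $\varphi([0])=\infty$, $\varphi([0,0])=0$, $\varphi([0,0,-1])=-1$, $\varphi([0,c_0,\dots,c_{k-1},-1])=\varphi([0,c_0,\dots,c_{k-2},c_{k-1}-1])$ for $k\ge 2$, $\varphi([0,c_0,\dots,c_{k-1},0])=\varphi([0,c_0,\dots,c_{k-2}])$ for $k\ge1$, and $\varphi([0,c_0,\dots,c_k])=c_0+\cfrac1{c_1+\cfrac1{\ddots+\frac1{c_k}}}$ if $k\ge 1$ and $c_k\ge1$. For rational $r$ let $\omega_r(n)=\lfloor (n+1)r\rfloor-\lfloor nr\rfloor$ (which equals $\chi_{[1-r,1)}(nr \bmod 1)$ if $r\in[0,1]$) and $A_r(n)=\begin{pmatrix}E-V\omega_r(n)&-1\\1&0\end{pmatrix}$.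 If $\varphi(\mathbf c)=p/q$ in lowest terms ($q\ge1$), put $t_{\mathbf c}(E,V)=\operatorname{tr}\big(A_{p/q}(q-1)\cdots A_{p/q}(0)\big)$; if $\varphi(\mathbf c)=\infty$, put $t_{\mathbf c}=2$. Let $\sigma_{\mathbf c}(V)=\{E\in\mathbb R: |t_{\mathbf c}(E,V)|\le 2\}$. Its *spectral bands* are its connected components. For closed intervals, $[a,b]\subseteq_{\rm str}[c,d]$ means $c<a$ and $b<d$ (and $[a,b]\subseteq_{\rm str}\mathbb R$ always); $[a,b]\prec[c,d]$ means $a<c$ and $b<d$; $[a,b]\prec_{\rm str}[c,d]$ ("strictly left of") means $b<c$. **Types.** A spectral band $I$ of $\sigma_{\mathbf c}(V)$ is of *backward type $A$* (resp. $B$) if $I\subseteq_{\rm str}J$ for some spectral band $J$ of $\sigma_{[\mathbf c,0]}(V)$ (resp. $\sigma_{[\mathbf c,-1]}(V)$), and of *weak* backward type $A$ (resp. $B$) if the same holds with $\subseteq$ in place of $\subseteq_{\rm str}$. For $m\in\mathbb N$ it is of *$m$-forward type $A$* (with $M=m-1$), resp. *$m$-forward type $B$* (with $M=m$), if there are spectral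 bands $I^1,\dots,I^M$ of $\sigma_{[\mathbf c,m]}(V)$ and, for each $n\in\mathbb N$, spectral bands $I_n^1,\dots,I_n^{M+1}$ of $\sigma_{[\mathbf c,m,n]}(V)$ such that, with $I_0^j:=I$: each $I^i\subseteq_{\rm str}I$ and $I^i$ is not of weak backward type $B$; each $I_n^j\subseteq_{\rm str}I_{n-1}^j$ and $I_n^j$ is not of weak backward type $A$ ($n\in\mathbb N$); and $I_n^1\prec I^1\prec I_n^2\prec\dots\prec I^M\prec I_n^{M+1}$ for every $n\in\mathbb N$. The band $I$ is of *type $A$* (resp. *type $B$*) if it is of backward type $A$ (resp. $B$) and of $m$-forward type $A$ (resp. $B$) for all $m\in\mathbb N$. The *level* $L_{\mathbf c,V}$ is the set of all spectral bands of $\sigma_{\mathbf c}(V)$ of type $A$ or $B$ and all spectral bands of $\sigma_{[\mathbf c,1]}(V)$ of type $B$. **Codes.** Let $\alpha\in[0,1]\setminus\mathbb Q$ have the infinite continued fraction expansion $(c_k)_{k\ge0}$ (so $c_0=0$), and let $\mathbf c_k=[0,c_0,c_1,\dots,c_k]$. Let $\Sigma_{\mathbf c_k}$ be the set of words $\gamma=(\gamma(0),\dots,\gamma(k))$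 over the alphabet $\{A^{(i)},G^{(i)}:i\in\mathbb N\}\cup\{B\}$ such that $\gamma(0)\in\{A^{(1)},G^{(2)}\}$ and, for $0\le j<k$: if $\gamma(j)$ is some $A^{(l)}$, then $\gamma(j+1)\in\{A^{(i)}:1\le i\le c_{j+1}-1\}\cup\{G^{(i)}:1\le i\le c_{j+1}\}$; if $\gamma(j)=B$, then $\gamma(j+1)\in\{A^{(i)}:1\le i\le c_{j+1}\}\cup\{G^{(i)}:1\le i\le c_{j+1}+1\}$; if $\gamma(j)$ is some $G^{(l)}$, then $\gamma(j+1)=B$. Order the letters by $G^{(1)}\lessdot A^{(1)}\lessdot G^{(2)}\lessdot A^{(2)}\lessdot\cdots$ ($B$ is comparable to no letter), and write $\gamma\lessdot\eta$ for two codes, possibly of different lengths, if there is an index $j$ in the range of both with $\gamma(i)=\eta(i)$ for all $i<j$ and $\gamma(j)\lessdot\eta(j)$. **Proposition.** Let $\alpha\in[0,1]\setminus\mathbb Q$ with expansion $(c_k)$ and $\mathbf c_k$ as above. For each $V>4$ there exists a unique map $$b_V:\bigsqcup_{k\in\mathbb N_0}\Sigma_{\mathbf c_k}\to\bigcup_{k\in\mathbb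 N_0}L_{\mathbf c_k,V}$$ with the following properties. 1. For each $k\in\mathbb N_0$, $b_V$ maps $\Sigma_{\mathbf c_k}$ bijectively onto $L_{\mathbf c_k,V}$. 2. For each $k\in\mathbb N$, $\gamma\in\Sigma_{\mathbf c_{k-1}}$ and $\eta=(\eta(0),\dots,\eta(k))\in\Sigma_{\mathbf c_k}$: $\ \gamma=(\eta(0),\dots,\eta(k-1))\iff b_V(\eta)\subseteq b_V(\gamma)\iff b_V(\gamma)\cap b_V(\eta)\ne\emptyset$. 3. For all $\gamma,\eta\in\bigsqcup_{k}\Sigma_{\mathbf c_k}$: $\ \gamma\lessdot\eta\iff b_V(\gamma)\prec_{\rm str}b_V(\eta)$. 4. For all $k\in\mathbb N_0$ and $\gamma\in\Sigma_{\mathbf c_k}$: (a) $\gamma(k)=A^{(i)}$ for some $i$ iff $b_V(\gamma)$ is a spectral band of $\sigma_{\mathbf c_k}(V)$ of type $A$; (b) $\gamma(k)=B$ iff $b_V(\gamma)$ is a spectral band of $\sigma_{\mathbf c_k}(V)$ of type $B$; (c) $\gamma(k)=G^{(i)}$ for some $i$ iff $b_V(\gamma)$ is a spectral band of $\sigma_{[\mathbf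 c_k,1]}(V)$ of type $B$ and $b_V(\gamma)\cap\sigma_{\mathbf c_k}(V)=\emptyset$. -/

import Mathlib

open scoped OnePoint

namespace SturmianCoding

noncomputable section

/-! ### Finite continued fractions -/

/-- Continued fraction with innermost entry `x` and remaining digits listed from the inside out:
`cfEval x [a_{j}, …, a₁, a₀] = a₀ + 1 / (a₁ + 1 / (⋯ + 1 / (a_j + 1 / x)))`. -/
def cfEval : ℚ → List ℤ → ℚ
  | x, [] => x
  | x, a :: l => cfEval (a + 1 / x) l

/-- A finite continued fraction `[0, c₀, c₁, …, c_k]` (with `c₀ = 0`, `c₁, …, c_{k-1} ≥ 1` and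
`c_k ≥ -1`) is stored as the list `[c_k, …, c₁, c₀]`, last digit first and without the common first
entry `0`. Hence `[0]` is `[]`, `[0, 0]` is `[0]`, and `[𝐜, m]` is `m :: 𝐜`.
`phi` is the evaluation map into the rationals together with `∞`. -/
def phi : List ℤ → OnePoint ℚ
  | [] => ∞
  | [c₀] => ((c₀ : ℚ) : OnePoint ℚ)
  | c :: c' :: l =>
    if c = 0 then phi l
    else if c = -1 then
      if l = [] then ((-1 : ℚ) : OnePoint ℚ) else phi ((c' - 1) :: l)
    else ((cfEval (c : ℚ) (c' :: l) : ℚ) : OnePoint ℚ)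
termination_by l => l.length

/-- `𝐜_k = [0, c₀, c₁, …, c_k]`. -/
def coK (c : ℕ → ℕ) : ℕ → List ℤ
  | 0 => [(c 0 : ℤ)]
  | k + 1 => (c (k + 1) : ℤ) :: coK c k

/-- `c₀, c₁, c₂, …` are the digits of the infinite continued fraction expansion of `α`. -/
def IsContFracExpansion (α : ℝ) (c : ℕ → ℕ) : Prop :=
  (GenContFract.of α).h = (c 0 : ℝ) ∧
    ∀ k, (GenContFract.of α).partDens.get? k = some (c (k + 1) : ℝ)

/-! ### Mechanical words, transfer matrices, periodic spectra -/

/-- The mechanical word `ω_r` of slope `r`. -/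
def mechWord (r : ℚ) (n : ℤ) : ℤ := ⌊((n : ℚ) + 1) * r⌋ - ⌊(n : ℚ) * r⌋

/-- For slopes in `[0, 1]`, `ω_r(n) = χ_{[1 - r, 1)}(n r mod 1)`. -/
theorem mechWord_eq_indicator (r : ℚ) (h0 : 0 ≤ r) (h1 : r ≤ 1) (n : ℤ) :
    mechWord r n = Set.indicator (Set.Ico (1 - r) 1) (fun _ => (1 : ℤ)) (Int.fract ((n : ℚ) * r)) := by
  unfold mechWord
  have e : ((n : ℚ) + 1) * r = (⌊(n : ℚ) * r⌋ : ℚ) + (Int.fract ((n : ℚ) * r) + r) := by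
    rw [← add_assoc, Int.floor_add_fract]; ring
  have hl := Int.fract_nonneg ((n : ℚ) * r)
  have hu := Int.fract_lt_one ((n : ℚ) * r)
  rw [e, Int.floor_intCast_add]
  by_cases h : 1 - r ≤ Int.fract ((n : ℚ) * r)
  · rw [Set.indicator_of_mem (Set.mem_Ico.2 ⟨h, hu⟩)]
    have : ⌊Int.fract ((n : ℚ) * r) + r⌋ = 1 := by
      rw [Int.floor_eq_iff]; push_cast; constructor <;> linarith
    omega
  · rw [Set.indicator_of_notMem (fun hh => h hh.1)]
    have : ⌊Int.fract ((n : ℚ) * r) + r⌋ = 0 := by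
      rw [Int.floor_eq_iff]; push_cast; constructor <;> linarith
    omega

/-- The one-step transfer matrix `A_r(n)(E, V)`. -/
def stepMatrix (r : ℚ) (E V : ℝ) (n : ℕ) : Matrix (Fin 2) (Fin 2) ℝ :=
  !![E - V * (mechWord r n : ℝ), -1; 1, 0]

/-- `A_r(n - 1) ⋯ A_r(1) A_r(0)`. -/
def stepProd (r : ℚ) (E V : ℝ) : ℕ → Matrix (Fin 2) (Fin 2) ℝ
  | 0 => 1
  | n + 1 => stepMatrix r E V n * stepProd r E V n

/-- The transfer matrix over one period. When the value of the continued fraction is `p / q` in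
lowest terms, this is `A_{p/q}(q - 1) ⋯ A_{p/q}(0)`; when it is `∞`, it is the matrix `M_{[0]}`. -/
def transferMatrix (co : List ℤ) (E V : ℝ) : Matrix (Fin 2) (Fin 2) ℝ :=
  (phi co).elim !![1, -V; 0, 1] (fun r : ℚ => stepProd r E V r.den)

/-- The discriminant `t_𝐜(E, V)`. -/
def discr (co : List ℤ) (E V : ℝ) : ℝ := (transferMatrix co E V).trace

/-- `σ_𝐜(V) = t_𝐜(·, V)⁻¹([-2, 2])`. -/
def spec (co : List ℤ) (V : ℝ) : Set ℝ := (fun E => discr co E V) ⁻¹' Set.Icc (-2) 2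

/-- `I` is a spectral band of `σ_𝐜(V)`: a connected component of it. -/
def IsBand (co : List ℤ) (V : ℝ) (I : Set ℝ) : Prop :=
  ∃ E ∈ spec co V, I = connectedComponentIn (spec co V) E

/-! ### Relations between intervals -/

/-- Strict inclusion of closed intervals: `[a, b]` is strictly included in `[c, d]` if `c < a` and
`b < d`. Also every `[a, b]` is strictly included in `ℝ`, which is a band when the continued
fraction has value `∞`. -/
def StrictIncl (I J : Set ℝ) : Prop := I ⊆ interior J

/-- `[a, b] ≺ [c, d]`: to the left. -/
def LeftOf (I J : Set ℝ) : Prop :=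
  ∃ a b c d : ℝ, a ≤ b ∧ c ≤ d ∧ I = Set.Icc a b ∧ J = Set.Icc c d ∧ a < c ∧ b < d

/-- `[a, b]` is strictly to the left of `[c, d]`. -/
def StrictLeftOf (I J : Set ℝ) : Prop :=
  ∃ a b c d : ℝ, a ≤ b ∧ c ≤ d ∧ I = Set.Icc a b ∧ J = Set.Icc c d ∧ b < c

/-! ### Types of bands -/

def BackwardA (co : List ℤ) (V : ℝ) (I : Set ℝ) : Prop :=
  IsBand co V I ∧ ∃ J, IsBand (0 :: co) V J ∧ StrictIncl I J

def WeakBackwardA (co : List ℤ) (V : ℝ) (I : Set ℝ) : Prop :=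
  IsBand co V I ∧ ∃ J, IsBand (0 :: co) V J ∧ I ⊆ J

def BackwardB (co : List ℤ) (V : ℝ) (I : Set ℝ) : Prop :=
  IsBand co V I ∧ ∃ J, IsBand (-1 :: co) V J ∧ StrictIncl I J

def WeakBackwardB (co : List ℤ) (V : ℝ) (I : Set ℝ) : Prop :=
  IsBand co V I ∧ ∃ J, IsBand (-1 :: co) V J ∧ I ⊆ J

/-- The common part of the two forward types. `P i` is the band `I_{[𝐜,m]}^{i+1}` and `Q n j` is the
band `I_{[𝐜,m,n]}^{j+1}`, with `Q 0 j = I`. -/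
def Forward (co : List ℤ) (V : ℝ) (m M : ℕ) (I : Set ℝ) : Prop :=
  IsBand co V I ∧
  ∃ (P : Fin M → Set ℝ) (Q : ℕ → Fin (M + 1) → Set ℝ),
    (∀ i, IsBand ((m : ℤ) :: co) V (P i) ∧ StrictIncl (P i) I ∧
      ¬ WeakBackwardB ((m : ℤ) :: co) V (P i)) ∧
    (∀ j, Q 0 j = I) ∧
    (∀ n j, IsBand (((n + 1 : ℕ) : ℤ) :: (m : ℤ) :: co) V (Q (n + 1) j) ∧
      StrictIncl (Q (n + 1) j) (Q n j) ∧
      ¬ WeakBackwardA (((n + 1 : ℕ) : ℤ) :: (m : ℤ) :: co) V (Q (n + 1) j)) ∧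
    (∀ n, ∀ i : Fin M,
      LeftOf (Q (n + 1) i.castSucc) (P i) ∧ LeftOf (P i) (Q (n + 1) i.succ))

/-- `m`-forward type `A`, for `m ≥ 1`. -/
def ForwardA (co : List ℤ) (V : ℝ) (m : ℕ) (I : Set ℝ) : Prop := Forward co V m (m - 1) I

/-- `m`-forward type `B`, for `m ≥ 1`. -/
def ForwardB (co : List ℤ) (V : ℝ) (m : ℕ) (I : Set ℝ) : Prop := Forward co V m m I

/-- `I` is a spectral band of `σ_𝐜(V)` of type `A`. -/
def TypeA (co : List ℤ) (V : ℝ) (I : Set ℝ) : Prop :=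
  BackwardA co V I ∧ ∀ m : ℕ, 1 ≤ m → ForwardA co V m I

/-- `I` is a spectral band of `σ_𝐜(V)` of type `B`. -/
def TypeB (co : List ℤ) (V : ℝ) (I : Set ℝ) : Prop :=
  BackwardB co V I ∧ ∀ m : ℕ, 1 ≤ m → ForwardB co V m I

/-- The level `L_{𝐜,V}`. -/
def level (co : List ℤ) (V : ℝ) : Set (Set ℝ) :=
  {I | (TypeA co V I ∨ TypeB co V I) ∨ TypeB (1 :: co) V I}

/-! ### Spectral codes -/

/-- The alphabet `{A⁽ⁱ⁾} ∪ {G⁽ⁱ⁾} ∪ {B}`. Only superscripts `i ≥ 1` occur in codes. -/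
inductive Letter : Type
  | A (i : ℕ)
  | G (i : ℕ)
  | B

/-- The strict order `G⁽¹⁾ ⋖ A⁽¹⁾ ⋖ G⁽²⁾ ⋖ A⁽²⁾ ⋖ ⋯`; the letter `B` is comparable to no letter. -/
def Letter.before : Letter → Letter → Prop
  | .G i, .G j => i < j
  | .G i, .A j => i ≤ j
  | .A i, .A j => i < j
  | .A i, .G j => i < j
  | _, _ => False

/-- The letters that may follow a given letter, when the next digit is `d`. -/
def Letter.next (d : ℕ) : Letter → Set Letter
  | .A _ => {x | ∃ i, 1 ≤ i ∧ ((x = .A i ∧ i + 1 ≤ d) ∨ (x = .G i ∧ i ≤ d))}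
  | .B => {x | ∃ i, 1 ≤ i ∧ ((x = .A i ∧ i ≤ d) ∨ (x = .G i ∧ i ≤ d + 1))}
  | .G _ => {.B}

/-- `Σ_{𝐜_k}`: the spectral codes `(γ(0), …, γ(k))` of length `k + 1`. -/
def codes (c : ℕ → ℕ) (k : ℕ) : Set (Fin (k + 1) → Letter) :=
  {γ | (γ 0 = .A 1 ∨ γ 0 = .G 2) ∧
    ∀ j : Fin k, γ j.succ ∈ Letter.next (c ((j : ℕ) + 1)) (γ j.castSucc)}

/-- The (lexicographic) order `⋖` on finite codes, possibly of different lengths. -/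
def codeBefore {k l : ℕ} (γ : Fin (k + 1) → Letter) (η : Fin (l + 1) → Letter) : Prop :=
  ∃ (j : ℕ) (hk : j < k + 1) (hl : j < l + 1),
    (∀ (i : ℕ) (hi : i < j), γ ⟨i, hi.trans hk⟩ = η ⟨i, hi.trans hl⟩) ∧
      (γ ⟨j, hk⟩).before (η ⟨j, hl⟩)

end

end SturmianCoding

/-! Let `t` be the discriminant of `𝐜` and `t_n` that of `[𝐜, n]`. Mechanical words concatenate
along Farey pairs (`stepProd_mediant`), so the matrix of `[𝐜, n + 1]` is the product, in one order
or the other, of those of `[𝐜, n]` and `𝐜` (`Valid.transferMatrix_succ`). This gives `t_{n+2} = t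
t_{n+1} - t_n` and the invariant `t² + t_n² + t_{n+1}² - t t_n t_{n+1} = 4 + V²`. For `V > 4` the
invariant forbids `t`, `t_n`, `t_{n+1}` from lying in `[-2, 2]` together (`Valid.triple`), while an
escape argument puts `σ_{[𝐜, n+1]}` inside `σ_𝐜 ∪ σ_{[𝐜, n]}` (`Valid.cover`). Hence each band of
`σ_𝐜` lies in exactly one of `σ_{[𝐜, 0]}` and `σ_{[𝐜, -1]}` (`IsBand.bandIn`, `BandIn.not_both`).

Over a band `J`, `t` is strictly monotone, so up to sign `t = 2 cos πs` and the recursion is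
Chebyshev's. Started at `z_0` bounded by 2 and `z_1` larger than 2, it returns to these values up to
sign at `s = j/n`: such points lie in bands of `z_n` and in gaps of `z_{n+1}`. A Sturm separation
argument leaves exactly one band per cell (`Ladder.exists_bands`). So `σ_{[𝐜, m]}` has `m - 1` or
`m` bands over `J`, according to type, interlacing with those of `σ_{[𝐜, m+1]}`. Both forward types
follow, and a type is nothing but an inclusion of spectra (`typeA_iff`, `typeB_iff`).

A band of type `A` or `B` has as children the bands of `σ_{[𝐜, d]}` over it (letters `A`) and those
of `σ_{[𝐜, d+1]}`, which are type `B` bands of `σ_{[𝐜, d, 1]}` (letters `G`); a `G` band has a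
single child `B`, from a nested chain. The coding follows these children. Two codes are either
ordered or one is a prefix of the other, and ordered codes have disjoint bands, which gives the
inclusion and order properties. A second coding differs from this one by an order-preserving
surjection of the continuations of each prefix, hence not at all (`Setting.unique`). -/

namespace SturmianCoding
open Matrix

/-! ### Convergents -/

/-- Lists `[d_k, …, d₁, 0]` with `d₁, …, d_k ≥ 1`. -/
inductive Valid : List ℤ → Prop
  | base : Valid [0]
  | cons {l : List ℤ} (d : ℕ) (hd : 1 ≤ d) (hl : Valid l) : Valid ((d : ℤ) :: l)

/-- Numerator of the convergent. -/
def cnum : List ℤ → ℤ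
  | [] => 1
  | [a] => a
  | a :: b :: l => a * cnum (b :: l) + cnum l

/-- Denominator of the convergent. -/
def cden : List ℤ → ℤ
  | [] => 0
  | [_] => 1
  | a :: b :: l => a * cden (b :: l) + cden l

theorem Valid.ne_nil {l : List ℤ} (h : Valid l) : l ≠ [] := by cases h <;> simp

theorem Valid.head_nonneg {a : ℤ} {l : List ℤ} (h : Valid (a :: l)) : 0 ≤ a := by
  cases h <;> simp

theorem Valid.tail {a b : ℤ} {l : List ℤ} (h : Valid (a :: b :: l)) : Valid (b :: l) := by
  cases h; assumption

theorem cnum_cons {a : ℤ} {l : List ℤ} (h : l ≠ []) :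
    cnum (a :: l) = a * cnum l + cnum l.tail := by
  cases l with
  | nil => exact absurd rfl h
  | cons b l => rfl

theorem cden_cons {a : ℤ} {l : List ℤ} (h : l ≠ []) :
    cden (a :: l) = a * cden l + cden l.tail := by
  cases l with
  | nil => exact absurd rfl h
  | cons b l => rfl

theorem Valid.cden_pos {l : List ℤ} (h : Valid l) : 1 ≤ cden l ∧ 0 ≤ cden l.tail := by
  induction h with
  | base => simp [cden]
  | @cons l d hd hl ih =>
    rw [cden_cons hl.ne_nil]
    have : (1 : ℤ) ≤ d := by exact_mod_cast hd
    refine ⟨by nlinarith [ih.1, ih.2], ?_⟩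
    simp only [List.tail_cons]; linarith [ih.1]

theorem Valid.det {l : List ℤ} (h : Valid l) :
    cnum l.tail * cden l - cden l.tail * cnum l = 1 ∨
      cnum l.tail * cden l - cden l.tail * cnum l = -1 := by
  induction h with
  | base => simp [cden, cnum]
  | @cons l d hd hl ih =>
    rw [cden_cons hl.ne_nil, cnum_cons hl.ne_nil, List.tail_cons]
    rcases ih with ih | ih
    · right; linear_combination -ih
    · left; linear_combination -ih

/-- A Möbius map with consecutive convergents as coefficients. Digits are nonnegative, so `b + 1 /
x` stays positive and the induction never divides by zero. -/
theorem cfEval_eq {b : ℤ} {l : List ℤ} (h : Valid (b :: l)) (x : ℚ) (hx : 0 < x) :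
    cfEval x (b :: l) = (x * cnum (b :: l) + cnum l) / (x * cden (b :: l) + cden l) := by
  induction l generalizing b x with
  | nil => simp [cfEval, cnum, cden]; field_simp
  | cons e l ih =>
    have hb : (0 : ℚ) ≤ b := by exact_mod_cast h.head_nonneg
    rw [cfEval, ih h.tail _ (by positivity), cnum, cden]
    push_cast
    rw [← mul_div_mul_left _ (((b : ℚ) + 1 / x) * cden (e :: l) + cden l) hx.ne']
    congr 1 <;> field_simp <;> ring

theorem Valid.phi_eq {l : List ℤ} (h : Valid l) :
    phi l = (((cnum l : ℚ) / (cden l : ℚ) : ℚ) : OnePoint ℚ) := by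
  cases h with
  | base => simp [phi, cnum, cden]
  | @cons l d hd hl =>
    cases l with
    | nil => exact absurd rfl hl.ne_nil
    | cons b l =>
      have h1 : (d : ℤ) ≠ 0 := by omega
      have h2 : (d : ℤ) ≠ -1 := by omega
      rw [phi, if_neg h1, if_neg h2, cfEval_eq hl _ (by exact_mod_cast hd), cnum, cden]
      push_cast; rfl

theorem phi_zero_cons (d : ℤ) (l : List ℤ) : phi (0 :: d :: l) = phi l := by
  rw [phi, if_pos rfl]

theorem phi_neg_one_cons (d : ℤ) {l : List ℤ} (h : l ≠ []) :
    phi (-1 :: d :: l) = phi ((d - 1) :: l) := by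
  rw [phi, if_neg (by norm_num), if_pos rfl, if_neg h]

theorem phi_one_cons {d : ℕ} {l : List ℤ} (hl : Valid l) (hd : 1 ≤ d) :
    phi (1 :: (d : ℤ) :: l) = phi (((d + 1 : ℕ) : ℤ) :: l) := by
  have h1 : Valid (((1 : ℕ) : ℤ) :: (d : ℤ) :: l) := .cons 1 le_rfl (.cons d hd hl)
  have h2 : Valid (((d + 1 : ℕ) : ℤ) :: l) := .cons _ (by omega) hl
  rw [Nat.cast_one] at h1
  have e1 : cnum (1 :: (d : ℤ) :: l) = cnum (((d + 1 : ℕ) : ℤ) :: l) := by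
    rw [cnum, cnum_cons hl.ne_nil, cnum_cons hl.ne_nil]; push_cast; ring
  have e2 : cden (1 :: (d : ℤ) :: l) = cden (((d + 1 : ℕ) : ℤ) :: l) := by
    rw [cden, cden_cons hl.ne_nil, cden_cons hl.ne_nil]; push_cast; ring
  rw [h1.phi_eq, h2.phi_eq, e1, e2]

/-! ### Concatenation of mechanical words along Farey pairs -/

theorem stepProd_append {r s : ℚ} {m : ℕ} (E V : ℝ) (n : ℕ)
    (h : ∀ k < n, mechWord r ((m + k : ℕ) : ℤ) = mechWord s k) :
    stepProd r E V (m + n) = stepProd s E V n * stepProd r E V m := by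
  induction n with
  | zero => simp [stepProd]
  | succ n ih =>
    rw [← add_assoc, stepProd, ih fun k hk => h k (by omega), stepProd, Matrix.mul_assoc,
      stepMatrix, stepMatrix, h n (by omega)]

theorem stepProd_congr {r s : ℚ} (E V : ℝ) (n : ℕ)
    (h : ∀ k < n, mechWord r k = mechWord s k) : stepProd r E V n = stepProd s E V n := by
  have := stepProd_append (r := r) (s := s) (m := 0) E V n (by simpa using h)
  simpa [stepProd] using this

theorem mechWord_div (p : ℤ) (q : ℕ) (k : ℕ) :
    mechWord ((p : ℚ) / q) k = ((k + 1 : ℕ) : ℤ) * p / q - (k : ℤ) * p / q := by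
  unfold mechWord
  rw [← mul_div_assoc, ← mul_div_assoc]
  have h1 : (((k : ℤ) : ℚ) + 1) * p = (((((k + 1 : ℕ) : ℤ) * p : ℤ)) : ℚ) := by push_cast; ring
  have h2 : ((k : ℤ) : ℚ) * p = (((k : ℤ) * p : ℤ) : ℚ) := by push_cast; ring
  rw [h1, h2, Rat.floor_intCast_div_natCast, Rat.floor_intCast_div_natCast]

theorem ediv_eq_of_bounds {a b k : ℤ} (hb : 0 < b) (h1 : k * b ≤ a) (h2 : a < (k + 1) * b) :
    a / b = k := by
  apply le_antisymm
  · exact Int.lt_add_one_iff.1 ((Int.ediv_lt_iff_lt_mul hb).2 h2)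
  · exact (Int.le_ediv_iff_mul_le hb).2 h1

/-- Replacing `p / q` by the mediant raises `n p / q` by `n / (q (q + q'))`, which is less than `1 /
q`, so no integer is crossed. -/
theorem mediant_ediv_left {p p' q q' n : ℤ} (hq : 0 < q) (hq' : 0 < q') (h : p' * q - p * q' = 1)
    (h0 : 0 ≤ n) (hn : n ≤ q) : n * (p + p') / (q + q') = n * p / q := by
  set k := n * p / q with hk
  have h1 : k * q ≤ n * p := Int.ediv_mul_le _ hq.ne'
  have h2 : n * p + 1 ≤ (k + 1) * q := Int.lt_ediv_add_one_mul_self _ hq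
  have e : n * (p + p') * q = n * p * (q + q') + n := by linear_combination n * h
  apply ediv_eq_of_bounds (by omega)
  · have : k * q * (q + q') ≤ n * p * (q + q') := mul_le_mul_of_nonneg_right h1 (by omega)
    refine le_of_mul_le_mul_right (a := q) ?_ hq
    linarith
  · have : (n * p + 1) * (q + q') ≤ (k + 1) * q * (q + q') :=
      mul_le_mul_of_nonneg_right h2 (by omega)
    refine lt_of_mul_lt_mul_right (a := q) ?_ hq.le
    linarith

theorem mediant_ediv_right {p p' q q' n : ℤ} (hq : 0 < q) (hq' : 0 < q')
    (h : p' * q - p * q' = 1) (h0 : 0 ≤ n) (hn : n ≤ q') :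
    (q + n) * (p + p') / (q + q') = p + n * p' / q' := by
  set k := n * p' / q' with hk
  have h1 : k * q' ≤ n * p' := Int.ediv_mul_le _ hq'.ne'
  have h2 : n * p' + 1 ≤ (k + 1) * q' := Int.lt_ediv_add_one_mul_self _ hq'
  have e : (q + n) * (p + p') * q' = (p * q' + n * p') * (q + q') + q' - n := by
    linear_combination (-n + q') * h
  apply ediv_eq_of_bounds (by omega)
  · have : k * q' * (q + q') ≤ n * p' * (q + q') := mul_le_mul_of_nonneg_right h1 (by omega)
    refine le_of_mul_le_mul_right (a := q') ?_ hq'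
    linarith
  · have : (n * p' + 1) * (q + q') ≤ (k + 1) * q' * (q + q') :=
      mul_le_mul_of_nonneg_right h2 (by omega)
    refine lt_of_mul_lt_mul_right (a := q') ?_ hq'.le
    linarith

/-- The word of the mediant is the word of the smaller fraction followed by that of the larger;
later letters multiply on the left. -/
theorem stepProd_mediant {p p' : ℤ} {q q' : ℕ} (hq : 0 < q) (hq' : 0 < q')
    (h : p' * q - p * q' = 1) (E V : ℝ) :
    stepProd (((p + p' : ℤ) : ℚ) / ((q + q' : ℕ) : ℚ)) E V (q + q') =
      stepProd ((p' : ℚ) / q') E V q' * stepProd ((p : ℚ) / q) E V q := by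
  have hq1 : (0 : ℤ) < q := by exact_mod_cast hq
  have hq1' : (0 : ℤ) < q' := by exact_mod_cast hq'
  rw [stepProd_append (s := (p' : ℚ) / q')]
  · congr 1
    apply stepProd_congr
    intro k hk
    rw [mechWord_div, mechWord_div]
    push_cast
    rw [mediant_ediv_left hq1 hq1' h (by omega) (by omega),
      mediant_ediv_left hq1 hq1' h (by omega) (by omega)]
  · intro k hk
    rw [mechWord_div, mechWord_div]
    push_cast
    rw [add_assoc, mediant_ediv_right hq1 hq1' h (by omega) (by omega),
      mediant_ediv_right hq1 hq1' h (by omega) (by omega)]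
    ring

theorem transferMatrix_of_phi {l : List ℤ} {p : ℤ} {q : ℕ}
    (h : phi l = (((p : ℚ) / q : ℚ) : OnePoint ℚ)) (hq : 0 < q) (hc : IsCoprime p q) (E V : ℝ) :
    transferMatrix l E V = stepProd ((p : ℚ) / q) E V q := by
  have hd : ((p : ℚ) / q).den = q := by
    have := Rat.den_div_eq_of_coprime (a := p) (b := q) (by exact_mod_cast hq)
      (by simpa [Int.isCoprime_iff_gcd_eq_one, Int.gcd] using hc)
    exact_mod_cast this
  rw [transferMatrix, h]
  change stepProd _ E V ((p : ℚ) / q).den = _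
  rw [hd]

theorem Valid.isCoprime {l : List ℤ} (h : Valid l) : IsCoprime (cnum l) (cden l) := by
  rcases h.det with h | h
  · exact ⟨-cden l.tail, cnum l.tail, by linear_combination h⟩
  · exact ⟨cden l.tail, -cnum l.tail, by linear_combination -h⟩

theorem Valid.transferMatrix_eq {l : List ℤ} (h : Valid l) (E V : ℝ) :
    transferMatrix l E V =
      stepProd ((cnum l : ℚ) / ((cden l).toNat : ℚ)) E V (cden l).toNat := by
  have hp := h.cden_pos.1
  have e : (((cden l).toNat : ℕ) : ℤ) = cden l := Int.toNat_of_nonneg (by omega)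
  have e' : (((cden l).toNat : ℕ) : ℚ) = (cden l : ℚ) := by exact_mod_cast e
  apply transferMatrix_of_phi
  · rw [e', h.phi_eq]
  · omega
  · rw [e]; exact h.isCoprime

theorem transferMatrix_congr {l l' : List ℤ} (h : phi l = phi l') (E V : ℝ) :
    transferMatrix l E V = transferMatrix l' E V := by rw [transferMatrix, transferMatrix, h]

/-- Matrices of `[𝐜, m]` and `𝐜` concatenate to that of `[𝐜, m + 1]`. -/
theorem Valid.transferMatrix_succ {l : List ℤ} (h : Valid l) (E V : ℝ) :
    (∀ m : ℕ, transferMatrix (((m + 1 : ℕ) : ℤ) :: l) E V =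
      transferMatrix ((m : ℤ) :: l) E V * transferMatrix l E V) ∨
    (∀ m : ℕ, transferMatrix (((m + 1 : ℕ) : ℤ) :: l) E V =
      transferMatrix l E V * transferMatrix ((m : ℤ) :: l) E V) := by
  -- description of the matrices of `m :: l`
  have key : ∀ m : ℕ, 1 ≤ cden ((m : ℤ) :: l) → transferMatrix ((m : ℤ) :: l) E V =
      stepProd ((cnum ((m : ℤ) :: l) : ℚ) / ((cden ((m : ℤ) :: l)).toNat : ℚ)) E V
        (cden ((m : ℤ) :: l)).toNat := by
    intro m hm
    rcases Nat.eq_zero_or_pos m with rfl | hm0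
    · cases h with
      | base => simp [cden] at hm
      | @cons l d hd hl =>
        rw [Nat.cast_zero, transferMatrix_congr (phi_zero_cons _ _), hl.transferMatrix_eq]
        simp [cnum, cden]
    · exact (Valid.cons m hm0 h).transferMatrix_eq E V
  have hl := h.cden_pos
  have hd : ∀ m : ℕ, cnum ((m : ℤ) :: l) * cden l - cden ((m : ℤ) :: l) * cnum l =
      cnum l.tail * cden l - cden l.tail * cnum l := fun m => by
    rw [cnum_cons h.ne_nil, cden_cons h.ne_nil]; ring
  have hs : ∀ m : ℕ, cnum (((m + 1 : ℕ) : ℤ) :: l) = cnum l + cnum ((m : ℤ) :: l) := fun m => by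
    rw [cnum_cons h.ne_nil, cnum_cons h.ne_nil]; push_cast; ring
  have hs' : ∀ m : ℕ, cden (((m + 1 : ℕ) : ℤ) :: l) = cden l + cden ((m : ℤ) :: l) := fun m => by
    rw [cden_cons h.ne_nil, cden_cons h.ne_nil]; push_cast; ring
  have hge : ∀ m : ℕ, 0 ≤ cden ((m : ℤ) :: l) := fun m => by
    rw [cden_cons h.ne_nil]
    have : (0 : ℤ) ≤ m * cden l := mul_nonneg (by positivity) (by omega)
    linarith [hl.2]
  have hbase : l = [0] → ∀ m : ℕ, transferMatrix (((m + 1 : ℕ) : ℤ) :: l) E V =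
      transferMatrix ((m : ℤ) :: l) E V * transferMatrix l E V ∨ 1 ≤ cden ((m : ℤ) :: l) := by
    rintro rfl m
    rcases Nat.eq_zero_or_pos m with rfl | hm0
    -- Here the value of `[𝐜, m]` is `∞`, so the product is checked against the matrix assigned to
    -- that value by hand.
    · left
      rw [(Valid.cons 1 le_rfl .base).transferMatrix_eq, Valid.base.transferMatrix_eq,
        transferMatrix_congr (l := ((0 : ℕ) : ℤ) :: [0]) (l' := []) (phi_zero_cons _ _)]
      simp [transferMatrix, phi, cnum, cden, stepProd, stepMatrix, mechWord, sub_eq_add_neg]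
    · right
      exact (Valid.cons m hm0 .base).cden_pos.1
  have hpos : ∀ m : ℕ, l ≠ [0] → 1 ≤ cden ((m : ℤ) :: l) := by
    intro m hne
    cases h with
    | base => exact absurd rfl hne
    | @cons l d hd hl' =>
      rw [cden]
      have := hl'.cden_pos.1
      have : (0 : ℤ) ≤ m * cden ((d : ℤ) :: l) := mul_nonneg (by positivity) (by omega)
      omega
  -- The sign decides which of the two Farey neighbours is smaller, hence the order of the factors;
  -- by `hd` it does not depend on `m`.
  rcases h.det with hdet | hdet
  · left
    intro m
    have main : 1 ≤ cden ((m : ℤ) :: l) → transferMatrix (((m + 1 : ℕ) : ℤ) :: l) E V =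
      transferMatrix ((m : ℤ) :: l) E V * transferMatrix l E V := by
      intro hm
      rw [key m hm, key (m + 1) (by rw [hs']; omega), h.transferMatrix_eq, hs, hs',
        Int.toNat_add (by omega) (by omega)]
      apply stepProd_mediant (by omega) (by omega)
      rw [Int.toNat_of_nonneg (by omega), Int.toNat_of_nonneg (by omega)]
      linarith [hd m]
    by_cases hl0 : l = [0]
    · exact (hbase hl0 m).elim id main
    · exact main (hpos m hl0)
  · right
    intro m
    have hl0 : l ≠ [0] := by rintro rfl; simp [cnum, cden] at hdet
    have hm := hpos m hl0
    rw [key m hm, key (m + 1) (by rw [hs']; omega), h.transferMatrix_eq, hs, hs',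
      add_comm (cnum l), add_comm (cden l), Int.toNat_add (by omega) (by omega)]
    apply stepProd_mediant (by omega) (by omega)
    rw [Int.toNat_of_nonneg (by omega), Int.toNat_of_nonneg (by omega)]
    linarith [hd m]

/-! ### Trace recursion and trace invariant -/

theorem det_stepProd (r : ℚ) (E V : ℝ) (n : ℕ) : (stepProd r E V n).det = 1 := by
  induction n with
  | zero => simp [stepProd]
  | succ n ih => rw [stepProd, det_mul, ih, stepMatrix, det_fin_two_of]; norm_num

theorem det_transferMatrix (l : List ℤ) (E V : ℝ) : (transferMatrix l E V).det = 1 := by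
  rw [transferMatrix]
  rcases phi l with _ | r
  · change (!![1, -V; 0, 1] : Matrix (Fin 2) (Fin 2) ℝ).det = 1
    simp [det_fin_two_of]
  · exact det_stepProd _ _ _ _

/-- Cayley–Hamilton, `X² = (tr X) X - 1`, multiplied by `Y`. -/
theorem trace_mul_mul_self {X : Matrix (Fin 2) (Fin 2) ℝ} (hX : X.det = 1)
    (Y : Matrix (Fin 2) (Fin 2) ℝ) :
    (Y * X * X).trace = X.trace * (Y * X).trace - Y.trace := by
  rw [det_fin_two] at hX
  simp only [trace_fin_two, mul_apply, Fin.sum_univ_two]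
  linear_combination (-Y 0 0 - Y 1 1) * hX

theorem discr_congr {l l' : List ℤ} (h : phi l = phi l') (E V : ℝ) :
    discr l E V = discr l' E V := by rw [discr, discr, transferMatrix_congr h]

theorem Valid.discr_succ_succ {l : List ℤ} (h : Valid l) (E V : ℝ) (m : ℕ) :
    discr (((m + 2 : ℕ) : ℤ) :: l) E V =
      discr l E V * discr (((m + 1 : ℕ) : ℤ) :: l) E V - discr ((m : ℤ) :: l) E V := by
  have hdet := det_transferMatrix l E V
  simp only [discr]
  rcases h.transferMatrix_succ E V with hs | hs
  · rw [hs (m + 1), hs m, trace_mul_mul_self hdet]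
  · rw [hs (m + 1), hs m, trace_mul_comm, trace_mul_comm _ (transferMatrix ((m : ℤ) :: l) E V),
      ← trace_mul_mul_self hdet, trace_mul_comm, ← Matrix.mul_assoc, trace_mul_comm,
      ← Matrix.mul_assoc]

theorem discr_nil (E V : ℝ) : discr [] E V = 2 := by
  simp [discr, transferMatrix, phi, trace_fin_two]; norm_num

theorem discr_zero (E V : ℝ) : discr [0] E V = E := by
  simp [discr, Valid.base.transferMatrix_eq, trace_fin_two, cnum, cden, stepProd, stepMatrix,
    mechWord]

theorem discr_one_zero (E V : ℝ) : discr [1, 0] E V = E - V := by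
  have := (Valid.cons 1 le_rfl .base).transferMatrix_eq E V
  rw [Nat.cast_one] at this
  simp [discr, this, trace_fin_two, cnum, cden, stepProd, stepMatrix, mechWord]

theorem discr_neg_one_zero (E V : ℝ) : discr [-1, 0] E V = E + V := by
  have : phi [-1, 0] = (((((-1 : ℤ) : ℚ) / (1 : ℕ) : ℚ)) : OnePoint ℚ) := by
    simp [phi]
  rw [discr, transferMatrix_of_phi this one_pos (by simpa using isCoprime_one_right)]
  have : ⌊(-1 : ℚ)⌋ = -1 := by norm_num
  simp [trace_fin_two, stepProd, stepMatrix, mechWord, this]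

/-- The Fricke–Vogt invariant. -/
theorem Valid.fricke {l : List ℤ} (h : Valid l) (E V : ℝ) (m : ℕ) :
    discr l E V ^ 2 + discr ((m : ℤ) :: l) E V ^ 2 + discr (((m + 1 : ℕ) : ℤ) :: l) E V ^ 2
      - discr l E V * discr ((m : ℤ) :: l) E V * discr (((m + 1 : ℕ) : ℤ) :: l) E V
      = 4 + V ^ 2 := by
  induction h generalizing m with
  | base =>
    induction m with
    | zero =>
      have e : discr (((0 : ℕ) : ℤ) :: [0]) E V = 2 := by
        rw [← discr_nil E V]; exact discr_congr (phi_zero_cons _ _) E V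
      have e1 : discr (((0 + 1 : ℕ) : ℤ) :: [0]) E V = E - V := by
        rw [← discr_one_zero E V]; simp
      rw [e, e1, discr_zero]; ring
    -- The recursion exchanges the two roots of a quadratic equation, which preserves the form.
    | succ m ih => rw [Valid.base.discr_succ_succ]; linear_combination ih
  | @cons l d hd hl ihl =>
    -- At digit `0` the triple is a permutation of one for the shorter list, because `[𝐜, d, 0]` and
    -- `[𝐜, d, 1]` have the values of the tail and of `[𝐜, d + 1]`.
    induction m with
    | zero =>
      have e : discr (((0 : ℕ) : ℤ) :: (d : ℤ) :: l) E V = discr l E V :=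
        discr_congr (phi_zero_cons _ _) E V
      have e1 : discr (((0 + 1 : ℕ) : ℤ) :: (d : ℤ) :: l) E V =
          discr (((d + 1 : ℕ) : ℤ) :: l) E V := by
        rw [← discr_congr (phi_one_cons hl hd) E V]; simp
      rw [e, e1]; linear_combination ihl d
    | succ m ih => rw [(Valid.cons d hd hl).discr_succ_succ]; linear_combination ih

/-! ### Derivative of the discriminant -/

/-- Derivative of the product of transfer matrices in the energy, in terms of the first rows
of the partial products. -/
theorem hasDerivAt_stepProd (r : ℚ) (V E : ℝ) (n : ℕ) :
    let B := fun k => stepProd r E V k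
    let a := ∑ k ∈ Finset.range n, B k 0 0 ^ 2
    let b := ∑ k ∈ Finset.range n, B k 0 0 * B k 0 1
    let c := ∑ k ∈ Finset.range n, B k 0 1 ^ 2
    ∀ i : Fin 2,
      HasDerivAt (fun E => stepProd r E V n i 0) (B n i 0 * b - B n i 1 * a) E ∧
      HasDerivAt (fun E => stepProd r E V n i 1) (B n i 0 * c - B n i 1 * b) E := by
  intro B a b c
  have hrow0 : ∀ n j E, stepProd r E V (n + 1) 0 j =
      (E - V * (mechWord r n : ℝ)) * stepProd r E V n 0 j - stepProd r E V n 1 j := by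
    intro n j E
    simp [stepProd, stepMatrix, mul_apply, Fin.sum_univ_two]; ring
  have hrow1 : ∀ n j E, stepProd r E V (n + 1) 1 j = stepProd r E V n 0 j := by
    intro n j E
    simp [stepProd, stepMatrix, mul_apply, Fin.sum_univ_two]
  induction n with
  | zero =>
    intro i
    simp only [a, b, c, Finset.range_zero, Finset.sum_empty, mul_zero, sub_zero, stepProd]
    exact ⟨hasDerivAt_const _ _, hasDerivAt_const _ _⟩
  | succ n ih =>
    -- In matrix form `B_n' = B_n · [[b, c], [-a, -b]]`. The new terms of the sums contribute `B_n 0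
    -- j` times the determinant, which is what differentiating the newest factor gives.
    have hdet := det_stepProd r E V n
    rw [det_fin_two] at hdet
    have h0 := ih 0
    have h1 := ih 1
    have hl : HasDerivAt (fun E : ℝ => E - V * (mechWord r n : ℝ)) 1 E :=
      (hasDerivAt_id E).sub_const _
    simp only [a, b, c, Finset.sum_range_succ, B]
    intro i
    fin_cases i
    · simp only [Fin.zero_eta, hrow0]
      constructor
      · refine ((hl.mul h0.1).sub h1.1).congr_deriv ?_
        simp only [B]
        linear_combination -stepProd r E V n 0 0 * hdet
      · refine ((hl.mul h0.2).sub h1.2).congr_deriv ?_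
        simp only [B]
        linear_combination -stepProd r E V n 0 1 * hdet
    · simp only [Fin.mk_one, hrow1]
      constructor
      · refine h0.1.congr_deriv ?_
        simp only [B]; ring
      · refine h0.2.congr_deriv ?_
        simp only [B]; ring

/-- If the trace over a period lies in `[-2, 2]`, then its derivative in the energy vanishes only
if the product is `±1`, and otherwise has the sign opposite to that of the upper right entry. -/
theorem hasDerivAt_trace_stepProd (r : ℚ) (V : ℝ) {n : ℕ} (hn : 1 ≤ n) :
    ∃ f' : ℝ → ℝ, (∀ E, HasDerivAt (fun E => (stepProd r E V n).trace) (f' E) E) ∧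
      ∀ E, |(stepProd r E V n).trace| ≤ 2 →
        (stepProd r E V n 0 1 ≠ 0 → stepProd r E V n 0 1 * f' E < 0) ∧
        (f' E = 0 → stepProd r E V n 0 1 = 0 ∧ stepProd r E V n 1 0 = 0 ∧
          stepProd r E V n 0 0 = stepProd r E V n 1 1) := by
  refine ⟨fun E =>
    (stepProd r E V n 0 0 * (∑ k ∈ Finset.range n, stepProd r E V k 0 0 * stepProd r E V k 0 1) -
      stepProd r E V n 0 1 * (∑ k ∈ Finset.range n, stepProd r E V k 0 0 ^ 2)) +
    (stepProd r E V n 1 0 * (∑ k ∈ Finset.range n, stepProd r E V k 0 1 ^ 2) -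
      stepProd r E V n 1 1 * (∑ k ∈ Finset.range n, stepProd r E V k 0 0 * stepProd r E V k 0 1)),
    fun E => ?_, fun E ht => ?_⟩
  · simp only [trace_fin_two]
    exact ((hasDerivAt_stepProd r V E n) 0).1.add ((hasDerivAt_stepProd r V E n) 1).2
  · have hdet := det_stepProd r E V n
    rw [det_fin_two] at hdet
    rw [trace_fin_two] at ht
    have ht2 : (stepProd r E V n 0 0 + stepProd r E V n 1 1) ^ 2 ≤ 4 := by
      have := sq_le_sq' (abs_le.1 ht).1 (abs_le.1 ht).2; linarith
    set x := stepProd r E V n 0 0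
    set y := stepProd r E V n 0 1
    set z := stepProd r E V n 1 0
    set w := stepProd r E V n 1 1
    set a := ∑ k ∈ Finset.range n, stepProd r E V k 0 0 ^ 2 with ha
    set b := ∑ k ∈ Finset.range n, stepProd r E V k 0 0 * stepProd r E V k 0 1 with hb
    set c := ∑ k ∈ Finset.range n, stepProd r E V k 0 1 ^ 2 with hc
    have hc0 : 0 ≤ c := Finset.sum_nonneg fun _ _ => sq_nonneg _
    -- The term `k = 0`, where the partial product is the identity, already equals `y²`.
    have hsq : y ^ 2 ≤ ∑ k ∈ Finset.range n,
        (y * stepProd r E V k 0 0 - (x - w) / 2 * stepProd r E V k 0 1) ^ 2 := by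
      refine le_trans ?_ (Finset.single_le_sum (f := fun k =>
        (y * stepProd r E V k 0 0 - (x - w) / 2 * stepProd r E V k 0 1) ^ 2)
        (fun _ _ => sq_nonneg _) (Finset.mem_range.2 (show 0 < n by omega)))
      simp [stepProd]
    have hexp : ∑ k ∈ Finset.range n,
        (y * stepProd r E V k 0 0 - (x - w) / 2 * stepProd r E V k 0 1) ^ 2 =
        y ^ 2 * a - y * (x - w) * b + ((x - w) / 2) ^ 2 * c := by
      rw [ha, hb, hc, Finset.mul_sum, Finset.mul_sum, Finset.mul_sum, ← Finset.sum_sub_distrib,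
        ← Finset.sum_add_distrib]
      exact Finset.sum_congr rfl fun k _ => by ring
    -- By the determinant, minus `y` times the derivative is the sum of squares above plus `c (1 -
    -- (x + w)² / 4)`, and the latter is nonnegative in the spectrum.
    have hneg : y ^ 2 ≤ -(y * (x * b - y * a + (z * c - w * b))) := by
      rw [hexp] at hsq
      nlinarith [mul_nonneg hc0 (sub_nonneg.2 ht2)]
    have hy : x * b - y * a + (z * c - w * b) = 0 → y = 0 := by
      intro h0
      rw [h0] at hneg
      have : y ^ 2 = 0 := le_antisymm (by linarith) (sq_nonneg _)
      exact pow_eq_zero_iff two_ne_zero |>.1 this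
    refine ⟨fun hy0 => ?_, fun (h0 : x * b - y * a + (z * c - w * b) = 0) => ?_⟩
    · have : 0 < y ^ 2 := by positivity
      linarith
    · have hy0 := hy h0
      have hxw : x = w := by
        have : (x - w) ^ 2 ≤ 0 := by rw [hy0] at hdet; nlinarith
        have : (x - w) ^ 2 = 0 := le_antisymm this (sq_nonneg _)
        linarith [pow_eq_zero_iff two_ne_zero |>.1 this]
      refine ⟨hy0, ?_, hxw⟩
      rw [hy0, hxw] at h0
      have hzc : z * c = 0 := by linarith
      rcases mul_eq_zero.1 hzc with h | h
      · exact h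
      -- For `n ≥ 2` the term `k = 1` makes `c` at least `1`; for `n = 1` the entry `y` is `-1`.
      · exfalso
        rcases Nat.lt_or_ge 1 n with h2 | h2
        · have : (1 : ℝ) ≤ c := by
            refine le_trans ?_ (Finset.single_le_sum (f := fun k => stepProd r E V k 0 1 ^ 2)
              (fun _ _ => sq_nonneg _) (Finset.mem_range.2 h2))
            simp [stepProd, stepMatrix]
          linarith
        · obtain rfl : n = 1 := by omega
          have : y = -1 := by simp [y, stepProd, stepMatrix]
          rw [this] at hy0; norm_num at hy0

/-- If `X, Y ∈ SL(2, ℝ)` are elliptic and `tr Y = 0`, then `tr (Y X)` is negative exactly if `X`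
and `Y` rotate in the same direction. -/
theorem mul_trace_neg {X Y : Matrix (Fin 2) (Fin 2) ℝ} (hX : X.det = 1) (hY : Y.det = 1)
    (htX : |X.trace| ≤ 2) (htY : Y.trace = 0) (hx : X 0 1 ≠ 0) :
    X 0 1 * Y 0 1 * (Y * X).trace < 0 ∧ Y 0 1 ≠ 0 := by
  rw [det_fin_two] at hX hY
  rw [trace_fin_two] at htX htY
  have ht2 : (X 0 0 + X 1 1) ^ 2 ≤ 4 := by
    have := sq_le_sq' (abs_le.1 htX).1 (abs_le.1 htX).2; linarith
  have hw : Y 1 1 = -Y 0 0 := by linarith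
  simp only [trace_fin_two, mul_apply, Fin.sum_univ_two]
  rw [hw] at hY ⊢
  have hY0 : Y 0 1 ≠ 0 := by
    intro h; rw [h] at hY; nlinarith [sq_nonneg (Y 0 0)]
  have hp : 0 < X 0 1 ^ 2 := by positivity
  refine ⟨?_, hY0⟩
  -- Completed square: every term on the right is nonpositive and `-X 0 1 ^ 2` is negative.
  have e : X 0 1 * Y 0 1 * (Y 0 0 * X 0 0 + Y 0 1 * X 1 0 + (Y 1 0 * X 0 1 + -Y 0 0 * X 1 1)) =
      -(X 0 1 * Y 0 0 - (X 0 0 - X 1 1) * Y 0 1 / 2) ^ 2 - X 0 1 ^ 2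
        - Y 0 1 ^ 2 * (4 - (X 0 0 + X 1 1) ^ 2) / 4 := by
    linear_combination (-X 0 1 ^ 2) * hY - Y 0 1 ^ 2 * hX
  rw [e]
  nlinarith [sq_nonneg (X 0 1 * Y 0 0 - (X 0 0 - X 1 1) * Y 0 1 / 2),
    mul_nonneg (sq_nonneg (Y 0 1)) (sub_nonneg.2 ht2)]

theorem Valid.differentiable_discr {l : List ℤ} (h : Valid l) (V : ℝ) :
    Differentiable ℝ (fun E => discr l E V) := by
  have hp := h.cden_pos.1
  obtain ⟨f', hf, -⟩ := hasDerivAt_trace_stepProd ((cnum l : ℚ) / ((cden l).toNat : ℚ)) V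
    (n := (cden l).toNat) (by omega)
  simp only [discr, h.transferMatrix_eq]
  exact fun E => (hf E).differentiableAt

theorem Valid.deriv_discr {l : List ℤ} (h : Valid l) {E V : ℝ} (ht : |discr l E V| ≤ 2) :
    (transferMatrix l E V 0 1 ≠ 0 →
      transferMatrix l E V 0 1 * deriv (fun E => discr l E V) E < 0) ∧
    (deriv (fun E => discr l E V) E = 0 → transferMatrix l E V 0 1 = 0 ∧
      transferMatrix l E V 1 0 = 0 ∧ transferMatrix l E V 0 0 = transferMatrix l E V 1 1) := by
  have hp := h.cden_pos.1
  obtain ⟨f', hf, hf'⟩ := hasDerivAt_trace_stepProd ((cnum l : ℚ) / ((cden l).toNat : ℚ)) V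
    (n := (cden l).toNat) (by omega)
  simp only [discr, h.transferMatrix_eq] at ht ⊢
  rw [(hf E).deriv]
  exact hf' E ht

/-- At a critical point in the spectrum the transfer matrix is `±1`. Then the traces of `[𝐜, 0]` and
`[𝐜, 1]` agree up to that sign, and the Fricke–Vogt identity collapses to `V² = 0`. -/
theorem Valid.deriv_discr_ne_zero {l : List ℤ} (h : Valid l) {E V : ℝ} (hV : V ≠ 0)
    (ht : |discr l E V| ≤ 2) : deriv (fun E => discr l E V) E ≠ 0 := by
  intro h0
  obtain ⟨h1, h2, h3⟩ := (h.deriv_discr ht).2 h0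
  have hdet := det_transferMatrix l E V
  rw [det_fin_two, h1, ← h3] at hdet
  have hf := h.fricke E V 0
  have e : discr (((0 + 1 : ℕ) : ℤ) :: l) E V =
      transferMatrix l E V 0 0 * discr (((0 : ℕ) : ℤ) :: l) E V := by
    rcases h.transferMatrix_succ E V with hs | hs
    all_goals
      rw [discr, hs 0, discr]
      simp only [trace_fin_two, mul_apply, Fin.sum_univ_two, h1, h2, ← h3]
      ring
  have e2 : discr l E V = 2 * transferMatrix l E V 0 0 := by
    rw [discr, trace_fin_two, ← h3]; ring
  rw [e, e2] at hf
  have : V ^ 2 = 0 := by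
    linear_combination -hf + (4 - discr (((0 : ℕ) : ℤ) :: l) E V ^ 2) * hdet
  exact hV (pow_eq_zero_iff two_ne_zero |>.1 this)

/-- At a zero of `t_{[𝐜, m]}` in the interior of a band of `σ_𝐜`, the derivative is controlled by
`t_{[𝐜, m + 1]}`. -/
theorem Valid.deriv_discr_cons {l : List ℤ} (h : Valid l) {m : ℕ} (hm : 1 ≤ m) {E V : ℝ}
    (hx : |discr l E V| < 2) (hy : discr ((m : ℤ) :: l) E V = 0) :
    deriv (fun E => discr ((m : ℤ) :: l) E V) E * deriv (fun E => discr l E V) E *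
      discr (((m + 1 : ℕ) : ℤ) :: l) E V < 0 := by
  have hX := det_transferMatrix l E V
  have hY := det_transferMatrix ((m : ℤ) :: l) E V
  have hx0 : transferMatrix l E V 0 1 ≠ 0 := by
    intro h0
    rw [det_fin_two, h0] at hX
    have : (discr l E V) ^ 2 < 4 := by
      have := sq_lt_sq' (abs_lt.1 hx).1 (abs_lt.1 hx).2; linarith
    rw [discr, trace_fin_two] at this
    nlinarith [sq_nonneg (transferMatrix l E V 0 0 - transferMatrix l E V 1 1)]
  obtain ⟨hneg, hy0⟩ := mul_trace_neg hX hY hx.le hy hx0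
  have hx' := (h.deriv_discr hx.le).1 hx0
  have hy' := ((Valid.cons m hm h).deriv_discr (E := E) (V := V) (by rw [hy]; norm_num)).1 hy0
  have e : discr (((m + 1 : ℕ) : ℤ) :: l) E V =
      (transferMatrix ((m : ℤ) :: l) E V * transferMatrix l E V).trace := by
    rw [discr]
    rcases h.transferMatrix_succ E V with hs | hs
    · rw [hs]
    · rw [hs, trace_mul_comm]
  rw [e]
  have hp := mul_pos_of_neg_of_neg hx' hy'
  by_contra hcon
  rw [not_lt] at hcon
  -- Up to a square of off-diagonal entries, this product is the claimed one; its two factors have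
  -- opposite signs by `hp` and `hneg`.
  have h3 : 0 ≤ (transferMatrix l E V 0 1 * deriv (fun E => discr l E V) E *
      (transferMatrix ((m : ℤ) :: l) E V 0 1 * deriv (fun E => discr ((m : ℤ) :: l) E V) E)) *
      (transferMatrix l E V 0 1 * transferMatrix ((m : ℤ) :: l) E V 0 1 *
        (transferMatrix ((m : ℤ) :: l) E V * transferMatrix l E V).trace) := by
    have : 0 ≤ (transferMatrix l E V 0 1 * transferMatrix ((m : ℤ) :: l) E V 0 1) ^ 2 *
      (deriv (fun E => discr ((m : ℤ) :: l) E V) E * deriv (fun E => discr l E V) E *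
        (transferMatrix ((m : ℤ) :: l) E V * transferMatrix l E V).trace) :=
      mul_nonneg (sq_nonneg _) hcon
    linarith
  exact absurd h3 (not_le.2 (mul_neg_of_pos_of_neg hp hneg))

open Set Filter Topology

/-! ### Components of `f⁻¹([-2, 2])` -/

theorem mem_preimage_two {f : ℝ → ℝ} {e : ℝ} : e ∈ f ⁻¹' Icc (-2) 2 ↔ |f e| ≤ 2 := by
  rw [mem_preimage, mem_Icc, abs_le]

/-- The component of `f⁻¹([-2, 2])` containing `e`. -/
abbrev comp (f : ℝ → ℝ) (e : ℝ) : Set ℝ := connectedComponentIn (f ⁻¹' Icc (-2) 2) e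

/-- A discriminant-like function: it is strictly monotone wherever its values are in `[-2, 2]`,
which is a bounded set. -/
structure Nice (f : ℝ → ℝ) : Prop where
  diff : Differentiable ℝ f
  deriv_ne : ∀ e, |f e| ≤ 2 → deriv f e ≠ 0
  bdd : Bornology.IsBounded (f ⁻¹' Icc (-2) 2)

theorem mem_comp {f : ℝ → ℝ} {e : ℝ} (he : |f e| ≤ 2) : e ∈ comp f e :=
  mem_connectedComponentIn (mem_preimage_two.2 he)

theorem abs_le_of_mem_comp {f : ℝ → ℝ} {e y : ℝ} (hy : y ∈ comp f e) : |f y| ≤ 2 :=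
  mem_preimage_two.1 (connectedComponentIn_subset _ _ hy)

theorem comp_ordConnected (f : ℝ → ℝ) (e : ℝ) : (comp f e).OrdConnected :=
  isPreconnected_connectedComponentIn.ordConnected

theorem comp_eq {f : ℝ → ℝ} {e y : ℝ} (hy : y ∈ comp f e) : comp f e = comp f y :=
  connectedComponentIn_eq hy

/-- A component is an interval, so it cannot cross a point where `|f|` exceeds `2`. -/
theorem comp_subset_Ioo {f : ℝ → ℝ} {p q e : ℝ} (hp : 2 < |f p|) (hq : 2 < |f q|)
    (he : |f e| ≤ 2) (hpe : p < e) (heq : e < q) : comp f e ⊆ Ioo p q := by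
  intro y hy
  constructor
  · by_contra h
    exact absurd (abs_le_of_mem_comp ((comp_ordConnected f e).out hy (mem_comp he)
      ⟨not_lt.1 h, hpe.le⟩)) (not_le.2 hp)
  · by_contra h
    exact absurd (abs_le_of_mem_comp ((comp_ordConnected f e).out (mem_comp he) hy
      ⟨heq.le, not_lt.1 h⟩)) (not_le.2 hq)

theorem eventually_lt_left {f : ℝ → ℝ} {f' a : ℝ} (h : HasDerivAt f f' a) (hf : 0 < f') :
    ∀ᶠ y in 𝓝[<] a, f y < f a := by
  have h1 := (hasDerivAt_iff_tendsto_slope.1 h).eventually (lt_mem_nhds hf)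
  have h2 : ∀ᶠ y in 𝓝[<] a, 0 < slope f a y :=
    h1.filter_mono (nhdsWithin_mono _ fun y hy => ne_of_lt hy)
  filter_upwards [h2, self_mem_nhdsWithin] with y hy hya
  rw [slope_def_field, div_pos_iff] at hy
  have hya' : y < a := hya
  rcases hy with hy | hy <;> linarith [hy.1, hy.2]

theorem eventually_lt_right {f : ℝ → ℝ} {f' a : ℝ} (h : HasDerivAt f f' a) (hf : 0 < f') :
    ∀ᶠ y in 𝓝[>] a, f a < f y := by
  have h1 := (hasDerivAt_iff_tendsto_slope.1 h).eventually (lt_mem_nhds hf)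
  have h2 : ∀ᶠ y in 𝓝[>] a, 0 < slope f a y :=
    h1.filter_mono (nhdsWithin_mono _ fun y hy => ne_of_gt hy)
  filter_upwards [h2, self_mem_nhdsWithin] with y hy hya
  rw [slope_def_field, div_pos_iff] at hy
  have hya' : a < y := hya
  rcases hy with hy | hy <;> linarith [hy.1, hy.2]

theorem Icc_subset_comp {f : ℝ → ℝ} {e a b y : ℝ} (h : Icc a b ⊆ f ⁻¹' Icc (-2) 2)
    (hy : y ∈ Icc a b) (hye : y ∈ comp f e) : Icc a b ⊆ comp f e := by
  rw [comp_eq hye]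
  exact isPreconnected_Icc.subset_connectedComponentIn hy h

/-- Just left of `a` the function is smaller than `f a`, hence below `2`. If `f a` exceeded `-2`,
continuity would keep it above `-2` as well and the component would extend further. -/
theorem left_end {f : ℝ → ℝ} {f' e a : ℝ} (hf : HasDerivAt f f' a) (ha : a ∈ comp f e)
    (hmin : ∀ y ∈ comp f e, a ≤ y) (h0 : 0 < f') : f a = -2 := by
  by_contra hne
  have h2 := abs_le.1 (abs_le_of_mem_comp ha)
  have h3 : -2 < f a := lt_of_le_of_ne h2.1 (Ne.symm hne)
  have hc : ∀ᶠ y in 𝓝[<] a, -2 < f y :=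
    (hf.continuousAt.eventually (lt_mem_nhds h3)).filter_mono nhdsWithin_le_nhds
  obtain ⟨l, hl, hsub⟩ := mem_nhdsLT_iff_exists_Ioo_subset.1
    ((eventually_lt_left hf h0).and hc)
  have hl : l < a := hl
  have : Icc ((l + a) / 2) a ⊆ f ⁻¹' Icc (-2) 2 := by
    intro y hy
    rcases hy.2.eq_or_lt with rfl | hlt
    · exact h2
    · have := hsub (show y ∈ Ioo l a from ⟨by linarith [hy.1], hlt⟩)
      exact ⟨this.2.le, by linarith [this.1]⟩
  have := hmin _ (Icc_subset_comp this ⟨by linarith, le_rfl⟩ ha ⟨le_rfl, by linarith⟩)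
  linarith

theorem right_end {f : ℝ → ℝ} {f' e a : ℝ} (hf : HasDerivAt f f' a) (ha : a ∈ comp f e)
    (hmax : ∀ y ∈ comp f e, y ≤ a) (h0 : 0 < f') : f a = 2 := by
  by_contra hne
  have h2 := abs_le.1 (abs_le_of_mem_comp ha)
  have h3 : f a < 2 := lt_of_le_of_ne h2.2 hne
  have hc : ∀ᶠ y in 𝓝[>] a, f y < 2 :=
    (hf.continuousAt.eventually (gt_mem_nhds h3)).filter_mono nhdsWithin_le_nhds
  obtain ⟨l, hl, hsub⟩ := mem_nhdsGT_iff_exists_Ioo_subset.1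
    ((eventually_lt_right hf h0).and hc)
  have hl : a < l := hl
  have : Icc a ((l + a) / 2) ⊆ f ⁻¹' Icc (-2) 2 := by
    intro y hy
    rcases hy.1.eq_or_lt with rfl | hlt
    · exact h2
    · have := hsub (show y ∈ Ioo a l from ⟨hlt, by linarith [hy.2]⟩)
      exact ⟨by linarith [this.1], this.2.le⟩
  have := hmax _ (Icc_subset_comp this ⟨le_rfl, by linarith⟩ ha ⟨by linarith, le_rfl⟩)
  linarith

theorem comp_neg (f : ℝ → ℝ) (e : ℝ) : comp (fun x => -f x) e = comp f e := by
  have : (fun x => -f x) ⁻¹' Icc (-2) 2 = f ⁻¹' Icc (-2 : ℝ) 2 := by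
    ext y; simp only [mem_preimage_two, abs_neg]
  rw [comp, this]

/-- A component is a nondegenerate compact interval, mapped monotonically onto `[-2, 2]`. -/
theorem Nice.band {f : ℝ → ℝ} (hf : Nice f) {e : ℝ} (he : |f e| ≤ 2) :
    ∃ a b, a < b ∧ comp f e = Icc a b ∧
      ((StrictMonoOn f (Icc a b) ∧ f a = -2 ∧ f b = 2 ∧ ∀ y ∈ Icc a b, 0 < deriv f y) ∨
        (StrictAntiOn f (Icc a b) ∧ f a = 2 ∧ f b = -2 ∧ ∀ y ∈ Icc a b, deriv f y < 0)) := by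
  have hclosed : IsClosed (comp f e) := by
    rw [← closure_subset_iff_isClosed]
    apply isPreconnected_connectedComponentIn.closure.subset_connectedComponentIn
      (subset_closure (mem_comp he))
    exact closure_minimal (connectedComponentIn_subset _ _)
      (isClosed_Icc.preimage hf.diff.continuous)
  have hcpt : IsCompact (comp f e) :=
    Metric.isCompact_of_isClosed_isBounded hclosed (hf.bdd.subset (connectedComponentIn_subset _ _))
  have hI := eq_Icc_of_connected_compact
    ⟨⟨e, mem_comp he⟩, isPreconnected_connectedComponentIn⟩ hcpt
  set a := sInf (comp f e)
  set b := sSup (comp f e)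
  have hab : a ≤ b := by
    have := mem_comp he; rw [hI] at this; exact this.1.trans this.2
  have hae : a ∈ comp f e := by rw [hI]; exact ⟨le_rfl, hab⟩
  have hbe : b ∈ comp f e := by rw [hI]; exact ⟨hab, le_rfl⟩
  have hmin : ∀ y ∈ comp f e, a ≤ y := fun y hy => by rw [hI] at hy; exact hy.1
  have hmax : ∀ y ∈ comp f e, y ≤ b := fun y hy => by rw [hI] at hy; exact hy.2
  have hd : ∀ y, HasDerivAt f (deriv f y) y := fun y => (hf.diff y).hasDerivAt
  have hsub : ∀ y ∈ Icc a b, |f y| ≤ 2 := fun y hy => abs_le_of_mem_comp (hI ▸ hy)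
  refine ⟨a, b, ?_⟩
  -- Darboux: a nowhere vanishing derivative has constant sign, without any continuity of the
  -- derivative. The decreasing case applies the endpoint lemmas to `-f`.
  rcases hasDerivWithinAt_forall_lt_or_forall_gt_of_forall_ne (convex_Icc a b)
    (fun y _ => (hd y).hasDerivWithinAt) (fun y hy => hf.deriv_ne y (hsub y hy)) with h | h
  · have e1 : f a = 2 := by
      have := left_end (hd a).neg (e := e) (by rwa [show -f = fun x => -f x from rfl, comp_neg])
        (by rw [show -f = fun x => -f x from rfl, comp_neg]; exact hmin)
        (neg_pos.2 (h a ⟨le_rfl, hab⟩))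
      simp only [Pi.neg_apply] at this; linarith
    have e2 : f b = -2 := by
      have := right_end (hd b).neg (e := e) (by rwa [show -f = fun x => -f x from rfl, comp_neg])
        (by rw [show -f = fun x => -f x from rfl, comp_neg]; exact hmax)
        (neg_pos.2 (h b ⟨hab, le_rfl⟩))
      simp only [Pi.neg_apply] at this; linarith
    refine ⟨lt_of_le_of_ne hab fun h => by rw [h] at e1; linarith, hI, .inr ⟨?_, e1, e2, h⟩⟩
    exact strictAntiOn_of_deriv_neg (convex_Icc a b) hf.diff.continuous.continuousOn
      fun y hy => h y (interior_subset hy)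
  · have e1 : f a = -2 := left_end (hd a) hae hmin (h a ⟨le_rfl, hab⟩)
    have e2 : f b = 2 := right_end (hd b) hbe hmax (h b ⟨hab, le_rfl⟩)
    refine ⟨lt_of_le_of_ne hab fun h => by rw [h] at e1; linarith, hI, .inl ⟨?_, e1, e2, h⟩⟩
    exact strictMonoOn_of_deriv_pos (convex_Icc a b) hf.diff.continuous.continuousOn
      fun y hy => h y (interior_subset hy)

theorem Nice.exists_zero {f : ℝ → ℝ} (hf : Nice f) {e : ℝ} (he : |f e| ≤ 2) :
    ∃ y ∈ comp f e, f y = 0 := by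
  obtain ⟨a, b, hab, hI, h⟩ := hf.band he
  rw [hI]
  rcases h with ⟨-, ha, hb, -⟩ | ⟨-, ha, hb, -⟩
  · exact intermediate_value_Icc hab.le hf.diff.continuous.continuousOn
      (show (0 : ℝ) ∈ Icc (f a) (f b) by rw [ha, hb]; constructor <;> norm_num)
  · exact intermediate_value_Icc' hab.le hf.diff.continuous.continuousOn
      (show (0 : ℝ) ∈ Icc (f b) (f a) by rw [ha, hb]; constructor <;> norm_num)

theorem strictLeftOf_of_disjoint {f g : ℝ → ℝ} (hf : Nice f) (hg : Nice g) {e e' : ℝ}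
    (he : |f e| ≤ 2) (he' : |g e'| ≤ 2) (hlt : e < e') (hd : Disjoint (comp f e) (comp g e')) :
    StrictLeftOf (comp f e) (comp g e') := by
  obtain ⟨a, b, hab, hI, -⟩ := hf.band he
  obtain ⟨a', b', hab', hI', -⟩ := hg.band he'
  have h1 := mem_comp he
  have h2 := mem_comp he'
  rw [hI] at h1 hd
  rw [hI'] at h2 hd
  refine ⟨a, b, a', b', hab.le, hab'.le, hI, hI', ?_⟩
  by_contra hcon
  rw [not_lt] at hcon
  rcases le_total a' e with h | h
  · exact disjoint_left.1 hd h1 ⟨h, hlt.le.trans h2.2⟩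
  · exact disjoint_left.1 hd ⟨h1.1.trans h, hcon⟩ ⟨le_rfl, hab'.le⟩

/-- After `e` the function can never rise above zero, since it would have to cross with negative
slope; but negative slope at `e'` makes it positive just before `e'`. -/
theorem not_two_zeros_of_deriv_neg {f : ℝ → ℝ} (hf : Differentiable ℝ f) {e e' : ℝ} (hlt : e < e')
    (he : f e = 0) (he' : f e' = 0) (h : ∀ y ∈ Icc e e', f y = 0 → deriv f y < 0) : False := by
  have hle := image_le_of_deriv_right_lt_deriv_boundary (f := f) (f' := deriv f) (a := e) (b := e')
    (B := fun _ => 0) (B' := fun _ => 0) hf.continuous.continuousOn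
    (fun y _ => (hf y).hasDerivAt.hasDerivWithinAt) he.le (fun y => hasDerivAt_const y _)
    (fun y hy h0 => h y ⟨hy.1, hy.2.le⟩ h0)
  have hev := eventually_lt_left (hf e').hasDerivAt.neg
    (neg_pos.2 (h e' ⟨hlt.le, le_rfl⟩ he'))
  have hev2 : ∀ᶠ y in 𝓝[<] e', e < y := (lt_mem_nhds hlt).filter_mono nhdsWithin_le_nhds
  obtain ⟨y, ⟨hy1, hy2⟩, hy3⟩ := ((hev.and hev2).and self_mem_nhdsWithin).exists
  have hy3 : y < e' := hy3
  have := hle (show y ∈ Icc e e' from ⟨hy2.le, hy3.le⟩)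
  simp only [Pi.neg_apply] at hy1
  linarith

/-! ### Chebyshev ladders -/

/-- A sequence `z_{n+2} = x z_{n+1} - z_n` over an interval on which `x` decreases from `2` to `-2`,
as it arises for the discriminants `t_{[𝐜, n]}` over a band of `σ_𝐜`. -/
structure Ladder (x : ℝ → ℝ) (z : ℕ → ℝ → ℝ) (a b : ℝ) : Prop where
  lt : a < b
  cont : ContinuousOn x (Icc a b)
  anti : StrictAntiOn x (Icc a b)
  left : x a = 2
  right : x b = -2
  recur : ∀ n e, z (n + 2) e = x e * z (n + 1) e - z n e
  zero : ∀ e ∈ Icc a b, |z 0 e| ≤ 2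
  one : ∀ e ∈ Icc a b, 2 < |z 1 e|
  triple : ∀ n, ∀ e ∈ Icc a b, |z n e| ≤ 2 → 2 < |z (n + 1) e|
  zcont : ∀ n, Continuous (z n)
  nice : ∀ n, 2 ≤ n → Nice (z n)
  dsign : ∀ n, 2 ≤ n → ∀ e ∈ Ioo a b, z n e = 0 → 0 < deriv (z n) e * z (n + 1) e

namespace Ladder

variable {x : ℝ → ℝ} {z : ℕ → ℝ → ℝ} {a b : ℝ}

/-- Parametrizes the base interval by rotation number: rational parameters are the places where the
recursion closes up. -/
theorem exists_points (h : Ladder x z a b) :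
    ∃ p : ℝ → ℝ, StrictMonoOn p (Icc 0 1) ∧ (∀ s ∈ Icc (0 : ℝ) 1, p s ∈ Icc a b) ∧
      p 0 = a ∧ p 1 = b ∧ ∀ s ∈ Icc (0 : ℝ) 1, x (p s) = 2 * Real.cos (Real.pi * s) := by
  have hex : ∀ s : ℝ, ∃ y ∈ Icc a b, x y = 2 * Real.cos (Real.pi * s) := by
    intro s
    apply intermediate_value_Icc' h.lt.le h.cont
    rw [h.left, h.right]
    constructor <;> linarith [Real.neg_one_le_cos (Real.pi * s), Real.cos_le_one (Real.pi * s)]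
  choose p hp hxp using hex
  refine ⟨p, ?_, fun s _ => hp s, ?_, ?_, fun s _ => hxp s⟩
  · intro s hs t ht hst
    rw [← h.anti.lt_iff_gt (hp t) (hp s), hxp, hxp]
    have := Real.strictAntiOn_cos (a := Real.pi * s) (b := Real.pi * t)
      ⟨mul_nonneg Real.pi_pos.le hs.1, mul_le_of_le_one_right Real.pi_pos.le hs.2⟩
      ⟨mul_nonneg Real.pi_pos.le ht.1, mul_le_of_le_one_right Real.pi_pos.le ht.2⟩
      (mul_lt_mul_of_pos_left hst Real.pi_pos)
    linarith
  · apply h.anti.injOn (hp 0) ⟨le_rfl, h.lt.le⟩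
    rw [hxp, h.left]; simp
  · apply h.anti.injOn (hp 1) ⟨h.lt.le, le_rfl⟩
    rw [hxp, h.right]; simp

/-- With `|x| = 2` the recursion gives `|z_{n+2}| ≥ 2|z_{n+1}| - |z_n|`, so strict growth persists.
-/
theorem two_lt_of_end (h : Ladder x z a b) {e : ℝ} (he : e ∈ Icc a b) (hx : |x e| = 2) (n : ℕ) :
    |z n e| < |z (n + 1) e| ∧ 2 < |z (n + 1) e| := by
  induction n with
  | zero => exact ⟨(h.zero e he).trans_lt (h.one e he), h.one e he⟩
  | succ n ih =>
    have : |z (n + 1) e| < |z (n + 1 + 1) e| := by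
      rw [h.recur]
      have := abs_sub_abs_le_abs_sub (x e * z (n + 1) e) (z n e)
      rw [abs_mul, hx] at this
      linarith [ih.1]
    exact ⟨this, ih.2.trans this⟩

theorem sin_mul (h : Ladder x z a b) {e θ : ℝ} (hx : x e = 2 * Real.cos θ) (n : ℕ) :
    Real.sin θ * z (n + 1) e =
      Real.sin ((n + 1) * θ) * z 1 e - Real.sin (n * θ) * z 0 e := by
  have key : ∀ n : ℕ, Real.sin ((n + 2 : ℝ) * θ) =
      2 * Real.cos θ * Real.sin ((n + 1) * θ) - Real.sin (n * θ) := by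
    intro n
    have e1 : (n + 2 : ℝ) * θ = (n + 1) * θ + θ := by ring
    have e2 : (n : ℝ) * θ = (n + 1) * θ - θ := by ring
    rw [e1, e2, Real.sin_add, Real.sin_sub]; ring
  induction n using Nat.twoStepInduction with
  | zero => simp
  | one =>
    have := key 0
    simp only [Nat.cast_zero, zero_add, zero_mul, Real.sin_zero, one_mul, sub_zero] at this
    rw [h.recur, hx]
    norm_num
    rw [this]; ring
  | more n ih1 ih2 =>
    have k1 := key (n + 1)
    have k0 := key n
    rw [h.recur, hx]
    push_cast at *
    rw [show (n : ℝ) + 1 + 2 = n + 2 + 1 by ring, show (n : ℝ) + 1 + 1 = n + 2 by ring] at *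
    linear_combination 2 * Real.cos θ * ih2 - ih1 - z 1 e * k1 + z 0 e * k0

/-- At angle `θ = πj/n` the term `sin (nθ)` vanishes in the Chebyshev formula `sin_mul`, so `n`
steps return the initial pair up to sign. -/
theorem at_interior (h : Ladder x z a b) {e : ℝ} {n j : ℕ} (hj : 0 < j) (hjn : j < n)
    (hx : x e = 2 * Real.cos (Real.pi * (j / n))) :
    |z n e| = |z 0 e| ∧ |z (n + 1) e| = |z 1 e| := by
  have hn : (0 : ℝ) < n := by exact_mod_cast (by omega : 0 < n)
  have hj' : (0 : ℝ) < j := by exact_mod_cast hj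
  have hlt : (j : ℝ) / n < 1 := by rw [div_lt_one hn]; exact_mod_cast hjn
  set θ := Real.pi * (j / n) with hθ
  have hnθ : (n : ℝ) * θ = j * Real.pi := by rw [hθ]; field_simp
  have hs : 0 < Real.sin θ := Real.sin_pos_of_pos_of_lt_pi
    (mul_pos Real.pi_pos (div_pos hj' hn)) (mul_lt_of_lt_one_right Real.pi_pos hlt)
  have hc : |Real.cos (j * Real.pi)| = 1 := Real.abs_cos_int_mul_pi j
  have cancel : ∀ u v : ℝ, |Real.sin θ * u| = |Real.sin θ| * |v| → |u| = |v| := by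
    intro u v huv
    rw [abs_mul] at huv
    exact mul_left_cancel₀ (abs_pos.2 hs.ne').ne' huv
  constructor
  · apply cancel
    obtain ⟨m, rfl⟩ : ∃ m, n = m + 1 := ⟨n - 1, by omega⟩
    have e1 : (m : ℝ) * θ = j * Real.pi - θ := by rw [← hnθ]; push_cast; ring
    rw [h.sin_mul hx]
    push_cast at hnθ
    rw [hnθ, Real.sin_nat_mul_pi, e1, Real.sin_sub, Real.sin_nat_mul_pi, zero_mul, zero_mul,
      zero_sub, zero_sub, neg_mul, neg_neg, abs_mul, abs_mul, hc, one_mul]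
  · apply cancel
    have e1 : (n + 1 : ℝ) * θ = j * Real.pi + θ := by rw [← hnθ]; ring
    rw [h.sin_mul hx, e1, hnθ, Real.sin_nat_mul_pi, Real.sin_add, Real.sin_nat_mul_pi, zero_mul,
      zero_mul, zero_add, sub_zero, abs_mul, abs_mul, hc, one_mul]

/-- Sturm separation. At a zero of `z_{n+1}` the recursion gives `z_{n+2} = -z_n`, so `dsign` ties
the sign of the derivative to that of `z_n`. If `z_n` kept its sign, `z_{n+1}` would cross zero
twice in the same direction. -/
theorem exists_zero_between (h : Ladder x z a b) {n : ℕ} (hn : 1 ≤ n) {e e' : ℝ}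
    (he : e ∈ Ioo a b) (he' : e' ∈ Ioo a b) (hlt : e < e') (h0 : z (n + 1) e = 0)
    (h0' : z (n + 1) e' = 0) : ∃ g ∈ Ioo e e', z n g = 0 := by
  by_contra! hcon
  have hsub : ∀ y ∈ Icc e e', y ∈ Ioo a b := fun y hy =>
    ⟨he.1.trans_le hy.1, hy.2.trans_lt he'.2⟩
  have hexcl : ∀ y ∈ Ioo a b, z (n + 1) y = 0 → z n y ≠ 0 := fun y hy h1 h2 => by
    have := h.triple n y ⟨hy.1.le, hy.2.le⟩ (by rw [h2]; norm_num)
    rw [h1] at this; norm_num at this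
  have hne : ∀ y ∈ Icc e e', z n y ≠ 0 := by
    intro y hy
    rcases hy.1.eq_or_lt with rfl | h1
    · exact hexcl _ he h0
    rcases hy.2.eq_or_lt with rfl | h2
    · exact hexcl _ he' h0'
    exact hcon y ⟨h1, h2⟩
  have hsign : (∀ y ∈ Icc e e', 0 < z n y) ∨ (∀ y ∈ Icc e e', z n y < 0) := by
    have hpre := isPreconnected_Icc.image (z n) (h.zcont n).continuousOn (s := Icc e e')
    by_contra! hc
    obtain ⟨⟨u, hu, hu0⟩, ⟨v, hv, hv0⟩⟩ := hc
    obtain ⟨y, hy, hy0⟩ := hpre.ordConnected.out (mem_image_of_mem _ hu) (mem_image_of_mem _ hv)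
      ⟨hu0, hv0⟩
    exact hne y hy hy0
  have hdiff := (h.nice (n + 1) (by omega)).diff
  have hd : ∀ y ∈ Icc e e', z (n + 1) y = 0 → deriv (z (n + 1)) y * z n y < 0 := by
    intro y hy hy0
    have := h.dsign (n + 1) (by omega) y (hsub y hy) hy0
    rw [h.recur, hy0] at this
    linarith
  rcases hsign with hs | hs
  · refine not_two_zeros_of_deriv_neg hdiff hlt h0 h0' fun y hy hy0 => ?_
    have := hd y hy hy0
    by_contra hge
    exact absurd (mul_nonneg (not_lt.1 hge) (hs y hy).le) (not_le.2 this)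
  · refine not_two_zeros_of_deriv_neg (f := fun y => -z (n + 1) y) hdiff.neg hlt (by simp [h0])
      (by simp [h0']) fun y hy hy0 => ?_
    have := hd y hy (by simpa using hy0)
    rw [deriv.fun_neg]
    by_contra hge
    have : 0 ≤ deriv (z (n + 1)) y * z n y :=
      mul_nonneg_of_nonpos_of_nonpos (by linarith) (hs y hy).le
    linarith

end Ladder

theorem exists_between_succ {f : ℕ → ℝ} {e : ℝ} {n : ℕ} (h0 : f 0 < e) (hn : e < f n)
    (hne : ∀ j ≤ n, f j ≠ e) : ∃ j < n, f j < e ∧ e < f (j + 1) := by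
  induction n with
  | zero => exact absurd hn (not_lt.2 h0.le)
  | succ n ih =>
    rcases lt_or_gt_of_ne (hne n (by omega)) with h | h
    · exact ⟨n, by omega, h, hn⟩
    · obtain ⟨j, hj, h'⟩ := ih h fun j hj => hne j (by omega)
      exact ⟨j, by omega, h'⟩

/-- The outcome of the analysis of a ladder: `β n 1, …, β n (n - 1)` are the components of
`z_n⁻¹([-2, 2])` over `[a, b]`, from left to right, and they interlace for consecutive `n`. -/
structure LadderBands (z : ℕ → ℝ → ℝ) (a b : ℝ) (β : ℕ → ℕ → Set ℝ) : Prop where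
  band : ∀ n i, 2 ≤ n → 0 < i → i < n → (∃ e, |z n e| ≤ 2 ∧ β n i = comp (z n) e) ∧ β n i ⊆ Ioo a b
  exhaust : ∀ n, 2 ≤ n → ∀ e ∈ Icc a b, |z n e| ≤ 2 → ∃ i, 0 < i ∧ i < n ∧ comp (z n) e = β n i
  lt : ∀ n i j, 2 ≤ n → 0 < i → i < j → j < n → StrictLeftOf (β n i) (β n j)
  lt_left : ∀ n i j, 2 ≤ n → 0 < i → i ≤ j → j < n → StrictLeftOf (β (n + 1) i) (β n j)
  lt_right : ∀ n i j, 2 ≤ n → 0 < i → i < j → j ≤ n → StrictLeftOf (β n i) (β (n + 1) j)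

theorem div_lt_div_nat {i j m n : ℕ} (hm : 0 < m) (hn : 0 < n) (h : i * n < j * m) :
    (i : ℝ) / m < (j : ℝ) / n := by
  rw [div_lt_div_iff₀ (by exact_mod_cast hm) (by exact_mod_cast hn)]
  exact_mod_cast h

theorem div_mem_unit {i n : ℕ} (h : i ≤ n) : (i : ℝ) / n ∈ Icc (0 : ℝ) 1 :=
  ⟨by positivity, div_le_one_of_le₀ (by exact_mod_cast h) (by positivity)⟩

/-- The points `p (i / n)` cut `[a, b]` into `n` cells that bands of `z_{n+1}` cannot leave, and `p
((i + 1) / (n + 1))` marks one band in each cell. Interlacing then comes from comparing fractions,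
together with disjointness of bands for consecutive indices. -/
theorem Ladder.exists_bands {x : ℝ → ℝ} {z : ℕ → ℝ → ℝ} {a b : ℝ} (h : Ladder x z a b) :
    ∃ β, LadderBands z a b β := by
  obtain ⟨p, hmono, hpI, hp0, hp1, hxp⟩ := h.exists_points
  have hlt : ∀ {i j m n : ℕ}, 0 < m → 0 < n → i ≤ m → j ≤ n → i * n < j * m →
      p ((i : ℝ) / m) < p ((j : ℝ) / n) := fun hm hn him hjn hij =>
    hmono (div_mem_unit him) (div_mem_unit hjn) (div_lt_div_nat hm hn hij)
  have hmid : ∀ n i, 0 < i → i < n → |z n (p ((i : ℝ) / n))| ≤ 2 := fun n i hi hin => by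
    rw [(h.at_interior hi hin (hxp _ (div_mem_unit hin.le))).1]
    exact h.zero _ (hpI _ (div_mem_unit hin.le))
  have hsep : ∀ n i, 1 ≤ n → i ≤ n → 2 < |z (n + 1) (p ((i : ℝ) / n))| := by
    intro n i hn hin
    have hn0 : (n : ℝ) ≠ 0 := by positivity
    rcases Nat.eq_zero_or_pos i with rfl | hi
    · simp only [Nat.cast_zero, zero_div, hp0]
      exact (h.two_lt_of_end ⟨le_rfl, h.lt.le⟩ (by rw [h.left]; norm_num) n).2
    rcases hin.eq_or_lt with rfl | hlt
    · rw [div_self hn0, hp1]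
      exact (h.two_lt_of_end ⟨h.lt.le, le_rfl⟩ (by rw [h.right]; norm_num) i).2
    · rw [(h.at_interior hi hlt (hxp _ (div_mem_unit hin))).2]
      exact h.one _ (hpI _ (div_mem_unit hin))
  have hends : ∀ n, 2 ≤ n → 2 < |z n a| ∧ 2 < |z n b| := by
    intro n hn
    obtain ⟨m, rfl⟩ : ∃ m, n = m + 1 := ⟨n - 1, by omega⟩
    exact ⟨(h.two_lt_of_end ⟨le_rfl, h.lt.le⟩ (by rw [h.left]; norm_num) m).2,
      (h.two_lt_of_end ⟨h.lt.le, le_rfl⟩ (by rw [h.right]; norm_num) m).2⟩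
  have hIoo : ∀ n, 2 ≤ n → ∀ e ∈ Icc a b, |z n e| ≤ 2 → e ∈ Ioo a b := by
    intro n hn e he hz
    refine ⟨lt_of_le_of_ne he.1 ?_, lt_of_le_of_ne he.2 ?_⟩
    · rintro rfl; exact absurd hz (not_le.2 (hends n hn).1)
    · rintro rfl; exact absurd hz (not_le.2 (hends n hn).2)
  have hsubI : ∀ n, 2 ≤ n → ∀ e ∈ Icc a b, |z n e| ≤ 2 → comp (z n) e ⊆ Ioo a b :=
    fun n hn e he hz => comp_subset_Ioo (hends n hn).1 (hends n hn).2 hz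
      (hIoo n hn e he hz).1 (hIoo n hn e he hz).2
  -- the component at the `i`-th point lies between consecutive separators
  have hcell : ∀ n i, 1 ≤ n → i < n →
      comp (z (n + 1)) (p (((i + 1 : ℕ) : ℝ) / (n + 1 : ℕ))) ⊆
        Ioo (p ((i : ℝ) / n)) (p (((i + 1 : ℕ) : ℝ) / n)) := by
    intro n i hn hi
    refine comp_subset_Ioo (hsep n i hn hi.le) (hsep n (i + 1) hn hi)
      (hmid _ _ (by omega) (by omega)) (hlt (by omega) (by omega) hi.le (by omega) ?_)
      (hlt (by omega) (by omega) (by omega) hi ?_)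
    · nlinarith
    · nlinarith
  have hdisj : ∀ n, ∀ e e', e ∈ Icc a b → 2 ≤ n → |z n e| ≤ 2 →
      Disjoint (comp (z n) e) (comp (z (n + 1)) e') := by
    intro n e e' he hn hz
    rw [disjoint_left]
    intro y hy hy'
    exact absurd (abs_le_of_mem_comp hy') (not_le.2 (h.triple n y
      (Ioo_subset_Icc_self (hsubI n hn e he hz hy)) (abs_le_of_mem_comp hy)))
  -- No unmarked bands exist: every band contains a zero, and by induction every zero belongs to a
  -- marked band.
  have hzero : ∀ n, 1 ≤ n → ∀ e ∈ Icc a b, z n e = 0 →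
      ∃ i, 0 < i ∧ i < n ∧ e ∈ comp (z n) (p ((i : ℝ) / n)) := by
    intro n hn
    induction n, hn using Nat.le_induction with
    | base =>
      intro e he h0
      have := h.one e he
      rw [h0] at this; norm_num at this
    | succ n hn ih =>
      intro e he h0
      have hn0 : (n : ℝ) ≠ 0 := by positivity
      have heI := hIoo (n + 1) (by omega) e he (by rw [h0]; norm_num)
      obtain ⟨i, hi, hi1, hi2⟩ := exists_between_succ (f := fun i : ℕ => p ((i : ℝ) / n)) (e := e)
        (n := n) (by simp only [Nat.cast_zero, zero_div, hp0]; exact heI.1)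
        (by simp only [div_self hn0, hp1]; exact heI.2) (by
          intro j hj hje
          have := hsep n j hn hj
          rw [show p ((j : ℝ) / n) = e from hje, h0] at this
          norm_num at this)
      have hq := hmid (n + 1) (i + 1) (by omega) (by omega)
      obtain ⟨e', he', h0'⟩ := (h.nice (n + 1) (by omega)).exists_zero hq
      have hcell' := hcell n i hn hi he'
      refine ⟨i + 1, by omega, by omega, ?_⟩
      by_cases heq : e = e'
      · rw [heq]; exact he'
      exfalso
      have heI' : e' ∈ Ioo a b := hsubI (n + 1) (by omega) _
        (hpI _ (div_mem_unit (by omega))) hq he'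
      -- two zeros `u < v` in the same cell are separated by a zero of `z n`
      have main : ∀ u v, u < v → z (n + 1) u = 0 → z (n + 1) v = 0 →
          p ((i : ℝ) / n) < u → v < p (((i + 1 : ℕ) : ℝ) / n) → u ∈ Ioo a b → v ∈ Ioo a b →
          False := by
        intro u v huv hu hv hu1 hv1 huI hvI
        obtain ⟨g, hg, hg0⟩ := h.exists_zero_between hn huI hvI huv hu hv
        have hgI : g ∈ Icc a b := ⟨(huI.1.trans hg.1).le, (hg.2.trans hvI.2).le⟩
        obtain ⟨k, hk0, hk, hgk⟩ := ih g hgI hg0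
        have hk2 : 2 ≤ n := by omega
        have hmem := mem_comp (hmid n k hk0 hk)
        have hoc := comp_ordConnected (z n) (p ((k : ℝ) / n))
        have hbad : ∀ w ∈ comp (z n) (p ((k : ℝ) / n)), w ∈ Ioo a b → z (n + 1) w ≠ 0 := by
          intro w hw hwI hw0
          have := h.triple n w (Ioo_subset_Icc_self hwI) (abs_le_of_mem_comp hw)
          rw [hw0] at this; norm_num at this
        -- The band of `z_n` through the zero `g` also contains `p (k / n)`, which is outside the
        -- open cell. Being an interval, it swallows `u` or `v`, where `z_{n+1}` vanishes.
        rcases Nat.lt_or_ge i k with hik | hik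
        · have : p (((i + 1 : ℕ) : ℝ) / n) ≤ p ((k : ℝ) / n) := by
            apply hmono.monotoneOn (div_mem_unit (by omega)) (div_mem_unit hk.le)
            have : ((i + 1 : ℕ) : ℝ) ≤ k := by exact_mod_cast hik
            gcongr
          exact hbad v (hoc.out hgk hmem ⟨hg.2.le, hv1.le.trans this⟩) hvI hv
        · have : p ((k : ℝ) / n) ≤ p ((i : ℝ) / n) := by
            apply hmono.monotoneOn (div_mem_unit hk.le) (div_mem_unit (by omega))
            gcongr
          exact hbad u (hoc.out hmem hgk ⟨this.trans hu1.le, hg.1.le⟩) huI hu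
      rcases lt_or_gt_of_ne heq with hlt' | hlt'
      · exact main e e' hlt' h0 h0' hi1 hcell'.2 heI heI'
      · exact main e' e hlt' h0' h0 hcell'.1 hi2 heI' heI
  have hpmem : ∀ {n i : ℕ}, i < n → p ((i : ℝ) / n) ∈ Icc a b :=
    fun hi => hpI _ (div_mem_unit hi.le)
  refine ⟨fun n i => comp (z n) (p ((i : ℝ) / n)), ⟨?_, ?_, ?_, ?_, ?_⟩⟩
  · intro n i hn hi hin
    exact ⟨⟨_, hmid n i hi hin, rfl⟩, hsubI n hn _ (hpmem hin) (hmid n i hi hin)⟩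
  · intro n hn e he hz
    obtain ⟨y, hy, hy0⟩ := (h.nice n hn).exists_zero hz
    obtain ⟨i, hi, hin, hyi⟩ := hzero n (by omega) y
      (Ioo_subset_Icc_self (hsubI n hn e he hz hy)) hy0
    exact ⟨i, hi, hin, (comp_eq hy).trans (comp_eq hyi).symm⟩
  · intro n i j hn hi hij hjn
    obtain ⟨m, rfl⟩ : ∃ m, n = m + 1 := ⟨n - 1, by omega⟩
    apply strictLeftOf_of_disjoint (h.nice _ hn) (h.nice _ hn) (hmid _ i hi (by omega))
      (hmid _ j (by omega) hjn) (hlt (by omega) (by omega) (by omega) (by omega) (by gcongr))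
    rw [disjoint_left]
    intro y hy hy'
    obtain ⟨i, rfl⟩ : ∃ k, i = k + 1 := ⟨i - 1, by omega⟩
    obtain ⟨j, rfl⟩ : ∃ k, j = k + 1 := ⟨j - 1, by omega⟩
    have h1 := hcell m i (by omega) (by omega) hy
    have h2 := hcell m j (by omega) (by omega) hy'
    have : p (((i + 1 : ℕ) : ℝ) / m) ≤ p ((j : ℝ) / m) := by
      apply hmono.monotoneOn (div_mem_unit (by omega)) (div_mem_unit (by omega))
      have : ((i + 1 : ℕ) : ℝ) ≤ j := by exact_mod_cast (by omega)
      gcongr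
    exact absurd (h1.2.trans_le this) (not_lt.2 h2.1.le)
  · intro n i j hn hi hij hjn
    apply strictLeftOf_of_disjoint (h.nice _ (by omega)) (h.nice _ hn)
      (hmid _ i hi (by omega)) (hmid _ j (by omega) hjn)
      (hlt (by omega) (by omega) (by omega) (by omega) (by nlinarith))
    exact (hdisj n _ _ (hpmem hjn) hn (hmid _ j (by omega) hjn)).symm
  · intro n i j hn hi hij hjn
    apply strictLeftOf_of_disjoint (h.nice _ hn) (h.nice _ (by omega))
      (hmid _ i hi (by omega)) (hmid _ j (by omega) (by omega))
      (hlt (by omega) (by omega) (by omega) (by omega) (by nlinarith))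
    exact hdisj n _ _ (hpmem (by omega)) hn (hmid _ i (by omega) (by omega))

/-! ### Spectra of neighbouring continued fractions -/

theorem mem_spec {l : List ℤ} {V E : ℝ} : E ∈ spec l V ↔ |discr l E V| ≤ 2 :=
  mem_preimage_two (f := fun E => discr l E V)

theorem spec_congr {l l' : List ℤ} (h : phi l = phi l') (V : ℝ) : spec l V = spec l' V := by
  simp only [spec, discr_congr h]

theorem isBand_congr {l l' : List ℤ} (h : phi l = phi l') {V : ℝ} {I : Set ℝ} :
    IsBand l V I ↔ IsBand l' V I := by rw [IsBand, IsBand, spec_congr h]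

theorem spec_nil (V : ℝ) : spec [] V = univ := by
  ext E; rw [mem_spec, discr_nil]; norm_num

theorem discr_zero_cons (d : ℤ) (l : List ℤ) (E V : ℝ) :
    discr (0 :: d :: l) E V = discr l E V := discr_congr (phi_zero_cons _ _) E V

theorem discr_nat_zero_cons (d : ℤ) (l : List ℤ) (E V : ℝ) :
    discr (((0 : ℕ) : ℤ) :: d :: l) E V = discr l E V := discr_congr (phi_zero_cons _ _) E V

/-- The trace recursion extends one step back to the digit `-1`, where type `B` bands start their
ladder. -/
theorem Valid.discr_one_eq {l : List ℤ} (h : Valid l) (E V : ℝ) :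
    discr (1 :: l) E V = discr l E V * discr (0 :: l) E V - discr (-1 :: l) E V := by
  cases h with
  | base =>
    rw [discr_one_zero, discr_neg_one_zero, discr_zero, discr_zero_cons, discr_nil]; ring
  | @cons l d hd hl =>
    obtain ⟨k, rfl⟩ : ∃ k, d = k + 1 := ⟨d - 1, by omega⟩
    rw [discr_congr (phi_one_cons hl hd), discr_zero_cons,
      discr_congr (phi_neg_one_cons _ hl.ne_nil), hl.discr_succ_succ]
    push_cast
    rw [add_sub_cancel_right]; ring

theorem Valid.fricke_neg_one {l : List ℤ} (h : Valid l) (E V : ℝ) :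
    discr l E V ^ 2 + discr (-1 :: l) E V ^ 2 + discr (0 :: l) E V ^ 2
      - discr l E V * discr (-1 :: l) E V * discr (0 :: l) E V = 4 + V ^ 2 := by
  have h1 := h.fricke E V 0
  have h2 := h.discr_one_eq E V
  rw [Nat.cast_zero, zero_add, Nat.cast_one] at h1
  rw [h2] at h1
  linear_combination h1

/-- Three traces in `[-2, 2]` give a left side of at most `4 + 4 + 4 + 8 = 20`, whereas `4 + V² >
20`. -/
theorem fricke_bound {x y z V : ℝ} (hV : 4 < V)
    (h : x ^ 2 + y ^ 2 + z ^ 2 - x * y * z = 4 + V ^ 2) (hx : |x| ≤ 2) (hy : |y| ≤ 2) :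
    2 < |z| := by
  by_contra hz
  rw [not_lt] at hz
  have s : ∀ u : ℝ, |u| ≤ 2 → u ^ 2 ≤ 4 := fun u hu => by
    have := sq_le_sq' (abs_le.1 hu).1 (abs_le.1 hu).2; linarith
  have h8 : |x * y * z| ≤ 2 * 2 * 2 := by
    rw [abs_mul, abs_mul]; gcongr
  nlinarith [s x hx, s y hy, s z hz, (abs_le.1 h8).1]

theorem Valid.triple {l : List ℤ} (h : Valid l) {V : ℝ} (hV : 4 < V) {E : ℝ} (m : ℕ)
    (h1 : |discr l E V| ≤ 2) (h2 : |discr ((m : ℤ) :: l) E V| ≤ 2) :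
    2 < |discr (((m + 1 : ℕ) : ℤ) :: l) E V| :=
  fricke_bound hV (h.fricke E V m) h1 h2

theorem Valid.triple_neg_one {l : List ℤ} (h : Valid l) {V : ℝ} (hV : 4 < V) {E : ℝ}
    (h1 : |discr l E V| ≤ 2) (h2 : |discr (-1 :: l) E V| ≤ 2) :
    2 < |discr (0 :: l) E V| :=
  fricke_bound hV (h.fricke_neg_one E V) h1 h2

theorem escape {x y z : ℝ} (hx : 2 < |x|) (hy : 2 < |y|) (hz : |z| ≤ max |x| |y|) :
    max |x| |y| < |x * y - z| := by
  have h1 := abs_sub_abs_le_abs_sub (x * y) z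
  rw [abs_mul] at h1
  rcases max_cases |x| |y| with ⟨h, -⟩ | ⟨h, -⟩ <;> rw [h] at hz ⊢ <;> nlinarith

/-- Traces that have escaped from `[-2, 2]` grow when the continued fraction expansion is
undone. -/
theorem Valid.not_escaped {l : List ℤ} (h : Valid l) (E V : ℝ) (m : ℕ)
    (hx : 2 < |discr l E V|) (hy : 2 < |discr ((m : ℤ) :: l) E V|) :
    max |discr l E V| |discr ((m : ℤ) :: l) E V| < |discr (((m + 1 : ℕ) : ℤ) :: l) E V| := by
  induction h generalizing m with
  | base =>
    induction m with
    | zero =>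
      rw [discr_nat_zero_cons, discr_nil] at hy; norm_num at hy
    | succ m ih =>
      -- If the next trace did not grow, `escape` would push the previous trace above the maximum,
      -- while the induction hypothesis puts it below the current one.
      by_contra hcon
      have hesc := escape hx hy (not_lt.1 hcon)
      rw [Valid.base.discr_succ_succ, sub_sub_cancel] at hesc
      have := ih (hx.trans ((le_max_left _ _).trans_lt hesc))
      exact absurd (((le_max_right _ _).trans_lt hesc).trans ((le_max_right _ _).trans_lt this))
        (lt_irrefl _)
  | @cons l d hd hl ihl =>
    have hv := Valid.cons d hd hl
    induction m with
    | zero =>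
      -- At digit `0` one step back leads to the shorter list with last digit `k`, so the outer
      -- induction hypothesis takes over.
      by_contra hcon
      have hesc := escape hx hy (not_lt.1 hcon)
      obtain ⟨k, rfl⟩ : ∃ k, d = k + 1 := ⟨d - 1, by omega⟩
      rw [zero_add, Nat.cast_one, discr_nat_zero_cons, discr_congr (phi_one_cons hl hd),
        hl.discr_succ_succ, mul_comm (discr l E V), sub_sub_cancel] at hesc
      rw [discr_nat_zero_cons] at hy
      have := ihl k hy (hx.trans ((le_max_left _ _).trans_lt hesc))
      have h2 := (le_max_left _ _).trans_lt hesc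
      exact absurd (((le_max_right _ _).trans_lt this).trans h2) (lt_irrefl _)
    | succ m ih =>
      by_contra hcon
      have hesc := escape hx hy (not_lt.1 hcon)
      rw [hv.discr_succ_succ, sub_sub_cancel] at hesc
      have := ih (hx.trans ((le_max_left _ _).trans_lt hesc))
      exact absurd (((le_max_right _ _).trans_lt hesc).trans ((le_max_right _ _).trans_lt this))
        (lt_irrefl _)

theorem Valid.cover {l : List ℤ} (h : Valid l) {E V : ℝ} (m : ℕ)
    (hz : |discr (((m + 1 : ℕ) : ℤ) :: l) E V| ≤ 2) :
    |discr l E V| ≤ 2 ∨ |discr ((m : ℤ) :: l) E V| ≤ 2 := by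
  by_contra! hcon
  have := h.not_escaped E V m hcon.1 hcon.2
  linarith [(le_max_left _ _).trans_lt this, hcon.1]

theorem Valid.cover_neg_one {l : List ℤ} (h : Valid l) {E V : ℝ} (hx : |discr l E V| ≤ 2) :
    |discr (0 :: l) E V| ≤ 2 ∨ |discr (-1 :: l) E V| ≤ 2 := by
  cases h with
  | base => left; rw [discr_zero_cons, discr_nil]; norm_num
  | @cons l d hd hl =>
    obtain ⟨k, rfl⟩ : ∃ k, d = k + 1 := ⟨d - 1, by omega⟩
    rw [discr_zero_cons, discr_congr (phi_neg_one_cons _ hl.ne_nil)]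
    push_cast
    rw [add_sub_cancel_right]
    exact hl.cover k hx

/-- Bounds propagate along the covering. The tail is carried along because it is the neighbour at
digit `0`; the tail of `[0]` is excluded, its spectrum being all of `ℝ`. -/
theorem Valid.mem_Icc_of_abs_le {l : List ℤ} (h : Valid l) {V : ℝ} (hV : 4 < V) :
    (∀ E, |discr l E V| ≤ 2 → E ∈ Icc (-2) (V + 2)) ∧
      (l ≠ [0] → ∀ E, |discr l.tail E V| ≤ 2 → E ∈ Icc (-2) (V + 2)) := by
  induction h with
  | base =>
    refine ⟨fun E hE => ?_, fun h => absurd rfl h⟩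
    rw [discr_zero, abs_le] at hE
    constructor <;> linarith [hE.1, hE.2]
  | @cons l d hd hl ih =>
    refine ⟨?_, fun _ => ih.1⟩
    induction d, hd using Nat.le_induction with
    | base =>
      intro E hE
      by_cases hl0 : l = [0]
      · rw [hl0, Nat.cast_one, discr_one_zero, abs_le] at hE
        constructor <;> linarith [hE.1, hE.2]
      · rcases hl.cover 0 hE with h | h
        · exact ih.1 E h
        · obtain ⟨a, l', rfl⟩ := List.exists_cons_of_ne_nil hl.ne_nil
          rw [discr_nat_zero_cons] at h
          exact ih.2 hl0 E h
    | succ d hd ihd =>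
      intro E hE
      rcases hl.cover d hE with h | h
      · exact ih.1 E h
      · exact ihd E h

theorem Valid.nice {l : List ℤ} (h : Valid l) {V : ℝ} (hV : 4 < V) :
    Nice (fun E => discr l E V) where
  diff := h.differentiable_discr V
  deriv_ne _ he := h.deriv_discr_ne_zero (by linarith) he
  bdd := (Metric.isBounded_Icc (-2) (V + 2)).subset fun E hE =>
    (h.mem_Icc_of_abs_le hV).1 E (mem_preimage_two.1 hE)

theorem isBand_iff {l : List ℤ} {V : ℝ} {I : Set ℝ} :
    IsBand l V I ↔ ∃ E, |discr l E V| ≤ 2 ∧ I = comp (fun E => discr l E V) E := by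
  simp only [IsBand, mem_spec]; rfl

theorem IsBand.nonempty {l : List ℤ} {V : ℝ} {I : Set ℝ} (h : IsBand l V I) : I.Nonempty := by
  obtain ⟨E, hE, rfl⟩ := h
  exact ⟨E, mem_connectedComponentIn hE⟩

theorem IsBand.subset {l : List ℤ} {V : ℝ} {I : Set ℝ} (h : IsBand l V I) : I ⊆ spec l V := by
  obtain ⟨E, hE, rfl⟩ := h
  exact connectedComponentIn_subset _ _

theorem IsBand.isPreconnected {l : List ℤ} {V : ℝ} {I : Set ℝ} (h : IsBand l V I) :
    IsPreconnected I := by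
  obtain ⟨E, hE, rfl⟩ := h
  exact isPreconnected_connectedComponentIn

theorem IsBand.eq_of_inter {l : List ℤ} {V : ℝ} {I J : Set ℝ} (hI : IsBand l V I)
    (hJ : IsBand l V J) (h : (I ∩ J).Nonempty) : I = J := by
  obtain ⟨E, hE, rfl⟩ := hI
  obtain ⟨E', hE', rfl⟩ := hJ
  obtain ⟨y, hy, hy'⟩ := h
  rw [connectedComponentIn_eq hy, connectedComponentIn_eq hy']

theorem exists_isBand_superset {l : List ℤ} {V : ℝ} {I : Set ℝ} (hI : IsPreconnected I)
    (hne : I.Nonempty) (h : I ⊆ spec l V) : ∃ J, IsBand l V J ∧ I ⊆ J := by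
  obtain ⟨E, hE⟩ := hne
  exact ⟨_, ⟨E, h hE, rfl⟩, hI.subset_connectedComponentIn hE h⟩

/-! ### Ladders over spectral bands -/

/-- The discriminants `t_{[𝐜, n - e]}`. -/
def zseq (l : List ℤ) (V : ℝ) (e : ℕ) (n : ℕ) (E : ℝ) : ℝ := discr (((n : ℤ) - e) :: l) E V

theorem zseq_of_le (l : List ℤ) (V : ℝ) {e n : ℕ} (h : e ≤ n) :
    zseq l V e n = fun E => discr (((n - e : ℕ) : ℤ) :: l) E V := by
  funext E; rw [zseq, Nat.cast_sub h]

theorem LadderBands.congr {z w : ℕ → ℝ → ℝ} {a b : ℝ} {β : ℕ → ℕ → Set ℝ}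
    (h : LadderBands z a b β) (hzw : ∀ n e, |z n e| = |w n e|) : LadderBands w a b β := by
  have hc : ∀ n e, comp (w n) e = comp (z n) e := fun n e => by
    have : w n ⁻¹' Icc (-2) 2 = z n ⁻¹' Icc (-2) 2 := by
      ext y; rw [mem_preimage_two, mem_preimage_two, hzw]
    rw [comp, this]
  refine ⟨?_, ?_, h.lt, h.lt_left, h.lt_right⟩
  · simpa only [hc, hzw] using h.band
  · simpa only [hc, hzw] using h.exhaust

/-- The shift `e` starts the ladder at the digit `0` or `-1` whose spectrum contains `J`, so that
`z_0` is bounded there and `z_1` is not. -/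
theorem Valid.exists_ladderBands {l : List ℤ} (h : Valid l) {V : ℝ} (hV : 4 < V) {J : Set ℝ}
    (hJ : IsBand l V J) {e : ℕ} (he : e ≤ 1) (hJe : J ⊆ spec ((-(e : ℤ)) :: l) V) :
    ∃ a b β, J = Icc a b ∧ LadderBands (zseq l V e) a b β ∧
      ∀ E ∈ J, 2 < |zseq l V e 1 E| := by
  obtain ⟨E, hE, hJE⟩ := isBand_iff.1 hJ
  obtain ⟨a, b, hab, hI, hmono⟩ := (h.nice hV).band hE
  rw [← hJE] at hI
  have hx : ∀ y ∈ J, |discr l y V| ≤ 2 := fun y hy => mem_spec.1 (hJ.subset hy)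
  have hrec : ∀ n y, zseq l V e (n + 2) y = discr l y V * zseq l V e (n + 1) y - zseq l V e n y := by
    intro n y
    by_cases hen : e ≤ n
    · rw [zseq_of_le _ _ hen, zseq_of_le _ _ (by omega), zseq_of_le _ _ (by omega),
        show n + 2 - e = n - e + 2 by omega, show n + 1 - e = n - e + 1 by omega]
      exact h.discr_succ_succ y V _
    · obtain rfl : e = 1 := by omega
      obtain rfl : n = 0 := by omega
      simp only [zseq]
      norm_num
      exact h.discr_one_eq y V
  have h0 : ∀ y ∈ J, |zseq l V e 0 y| ≤ 2 := by
    intro y hy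
    have := mem_spec.1 (hJe hy)
    simpa [zseq] using this
  have htri : ∀ n, ∀ y ∈ J, |zseq l V e n y| ≤ 2 → 2 < |zseq l V e (n + 1) y| := by
    intro n y hy hz
    by_cases hen : e ≤ n
    · rw [zseq_of_le _ _ hen] at hz
      rw [zseq_of_le _ _ (by omega), show n + 1 - e = n - e + 1 by omega]
      exact h.triple hV _ (hx y hy) hz
    · obtain rfl : e = 1 := by omega
      obtain rfl : n = 0 := by omega
      simp only [zseq] at hz ⊢
      norm_num at hz ⊢
      exact h.triple_neg_one hV (hx y hy) hz
  have hnice : ∀ n, 2 ≤ n → Nice (zseq l V e n) := by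
    intro n hn
    rw [zseq_of_le _ _ (by omega)]
    exact (Valid.cons _ (by omega) h).nice hV
  have hxd := h.differentiable_discr V
  -- The first two terms may have digit `-1` or `0`; their continuity is obtained by running the
  -- recursion backwards.
  have hcont : ∀ n, Continuous (zseq l V e n) := by
    have h2 := (hnice 2 le_rfl).diff.continuous
    have h3 := (hnice 3 (by norm_num)).diff.continuous
    have e1 : zseq l V e 1 = fun y => discr l y V * zseq l V e 2 y - zseq l V e 3 y := by
      funext y; rw [hrec 1]; ring
    have h1 : Continuous (zseq l V e 1) := by
      rw [e1]; exact (hxd.continuous.mul h2).sub h3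
    have e0 : zseq l V e 0 = fun y => discr l y V * zseq l V e 1 y - zseq l V e 2 y := by
      funext y; rw [hrec 0]; ring
    intro n
    match n with
    | 0 => rw [e0]; exact (hxd.continuous.mul h1).sub h2
    | 1 => exact h1
    | n + 2 => exact (hnice _ (by omega)).diff.continuous
  have hds : ∀ n, 2 ≤ n → ∀ y ∈ Ioo a b, |discr l y V| < 2 → zseq l V e n y = 0 →
      deriv (zseq l V e n) y * deriv (fun E => discr l E V) y * zseq l V e (n + 1) y < 0 := by
    intro n hn y hy hlt hz
    rw [zseq_of_le _ _ (by omega)] at hz ⊢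
    rw [zseq_of_le _ _ (by omega), show n + 1 - e = n - e + 1 by omega]
    exact h.deriv_discr_cons (by omega) hlt hz
  have h1 : ∀ y ∈ J, 2 < |zseq l V e 1 y| := fun y hy => htri 0 y hy (h0 y hy)
  subst hI
  have ha : a ∈ Icc a b := ⟨le_rfl, hab.le⟩
  have hb : b ∈ Icc a b := ⟨hab.le, le_rfl⟩
  rcases hmono with ⟨hm, hfa, hfb, hd⟩ | ⟨hm, hfa, hfb, hd⟩
  -- An increasing discriminant is made decreasing by `x ↦ -x`, `z_n ↦ (-1)ⁿ z_n`, which respects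
  -- the recursion and leaves all bands unchanged.
  · have hlad : Ladder (fun y => -discr l y V) (fun n y => (-1) ^ n * zseq l V e n y) a b := by
      refine ⟨hab, hxd.neg.continuous.continuousOn, hm.neg, by linarith, by linarith, ?_, ?_, ?_,
        ?_, fun n => continuous_const.mul (hcont n), ?_, ?_⟩
      · intro n y; simp only [hrec]; ring
      · simpa using h0
      · simpa using h1
      · simpa [abs_mul] using htri
      · intro n hn
        rcases neg_one_pow_eq_or ℝ n with hp | hp
        · simp only [hp, one_mul]; exact hnice n hn
        · simp only [hp, neg_mul, one_mul]
          refine ⟨(hnice n hn).diff.neg, fun y hy => ?_, ?_⟩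
          · rw [deriv.fun_neg, neg_ne_zero]
            rw [abs_neg] at hy
            exact (hnice n hn).deriv_ne y hy
          · refine (hnice n hn).bdd.subset fun y hy => ?_
            rw [mem_preimage_two, abs_neg] at hy
            exact mem_preimage_two.2 hy
      · intro n hn y hy hz
        have hyI := Ioo_subset_Icc_self hy
        have hz' : zseq l V e n y = 0 := by
          rcases neg_one_pow_eq_or ℝ n with hp | hp <;> simpa [hp] using hz
        have hlt : |discr l y V| < 2 := by
          rw [abs_lt]
          exact ⟨by linarith [hm ha hyI hy.1], by linarith [hm hyI hb hy.2]⟩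
        have := hds n hn y hy hlt hz'
        have hdy := hd y hyI
        rw [deriv_const_mul _ (hnice n hn).diff.differentiableAt]
        have e2 : (-1 : ℝ) ^ n * (-1) ^ (n + 1) = -1 := by
          rw [pow_succ, ← mul_assoc, ← mul_pow]; norm_num
        have e3 : (-1 : ℝ) ^ n * deriv (zseq l V e n) y * ((-1) ^ (n + 1) * zseq l V e (n + 1) y) =
            -(deriv (zseq l V e n) y * zseq l V e (n + 1) y) := by
          linear_combination (deriv (zseq l V e n) y * zseq l V e (n + 1) y) * e2
        rw [e3]
        by_contra hcon
        have : 0 ≤ deriv (fun E => discr l E V) y *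
            (deriv (zseq l V e n) y * zseq l V e (n + 1) y) :=
          mul_nonneg hdy.le (by linarith)
        linarith
    obtain ⟨β, hβ⟩ := hlad.exists_bands
    exact ⟨a, b, β, rfl, hβ.congr fun n y => by simp [abs_mul], h1⟩
  · have hlad : Ladder (fun y => discr l y V) (zseq l V e) a b := by
      refine ⟨hab, hxd.continuous.continuousOn, hm, hfa, hfb, hrec, h0, h1, htri, hcont, hnice, ?_⟩
      intro n hn y hy hz
      have hyI := Ioo_subset_Icc_self hy
      have hlt : |discr l y V| < 2 := by
        rw [abs_lt]
        exact ⟨by linarith [hm hyI hb hy.2], by linarith [hm ha hyI hy.1]⟩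
      have := hds n hn y hy hlt hz
      have hdy := hd y hyI
      by_contra hcon
      have : 0 ≤ deriv (fun E => discr l E V) y *
          (deriv (zseq l V e n) y * zseq l V e (n + 1) y) :=
        mul_nonneg_of_nonpos_of_nonpos hdy.le (by linarith)
      linarith
    obtain ⟨β, hβ⟩ := hlad.exists_bands
    exact ⟨a, b, β, rfl, hβ, h1⟩

/-! ### Bands over a band -/

/-- `β m 1, …, β m (m + e - 1)` are the bands of `σ_{[𝐜, m]}` over the band `J` of `σ_𝐜`, from left
to right. -/
structure BandLadder (V : ℝ) (l : List ℤ) (e : ℕ) (J : Set ℝ) (β : ℕ → ℕ → Set ℝ) : Prop where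
  band : ∀ m i : ℕ, 1 ≤ m → 0 < i → i < m + e →
    IsBand ((m : ℤ) :: l) V (β m i) ∧ StrictIncl (β m i) J
  exhaust : ∀ m : ℕ, 1 ≤ m → ∀ K, IsBand ((m : ℤ) :: l) V K → (K ∩ J).Nonempty →
    ∃ i : ℕ, 0 < i ∧ i < m + e ∧ K = β m i
  lt : ∀ m i j, 0 < i → i < j → j < m + e → StrictLeftOf (β m i) (β m j)
  lt_left : ∀ m i j, 0 < i → i ≤ j → j < m + e → StrictLeftOf (β (m + 1) i) (β m j)
  lt_right : ∀ m i j, 0 < i → i < j → j ≤ m + e → StrictLeftOf (β m i) (β (m + 1) j)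

/-- Bands of `σ_𝐜` contained in `σ_{[𝐜, 0]}` (`e = 0`) or `σ_{[𝐜, -1]}` (`e = 1`). -/
def BandIn (V : ℝ) (l : List ℤ) (e : ℕ) (J : Set ℝ) : Prop :=
  IsBand l V J ∧ J ⊆ spec ((-(e : ℤ)) :: l) V

section
variable {V : ℝ}

theorem BandIn.exists_bandLadder (hV : 4 < V) {l : List ℤ} (hl : Valid l) {e : ℕ} (he : e ≤ 1)
    {J : Set ℝ} (hJ : BandIn V l e J) : ∃ β, BandLadder V l e J β := by
  obtain ⟨a, b, β, rfl, hβ, h1⟩ := hl.exists_ladderBands hV hJ.1 he hJ.2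
  have hz : ∀ m, zseq l V e (m + e) = fun E => discr ((m : ℤ) :: l) E V := fun m => by
    rw [zseq_of_le _ _ (by omega), Nat.add_sub_cancel]
  refine ⟨fun m i => β (m + e) i, ⟨?_, ?_, ?_, ?_, ?_⟩⟩
  · intro m i hm hi him
    obtain ⟨⟨E, hE, hEβ⟩, hsub⟩ := hβ.band (m + e) i (by omega) hi him
    rw [hz] at hE hEβ
    refine ⟨isBand_iff.2 ⟨E, hE, hEβ⟩, ?_⟩
    rw [StrictIncl, interior_Icc]
    exact hsub
  · intro m hm K hK ⟨E, hEK, hEJ⟩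
    have hE := mem_spec.1 (hK.subset hEK)
    obtain ⟨E', hE', rfl⟩ := isBand_iff.1 hK
    rw [comp_eq hEK]
    have hzE : |zseq l V e (m + e) E| ≤ 2 := by rw [hz]; exact hE
    -- For `m = 1`, `e = 0` there is nothing to list, since `z_1` exceeds `2` in modulus on all of
    -- `J`.
    rcases Nat.lt_or_ge (m + e) 2 with h2 | h2
    · have hme : m + e = 1 := by omega
      rw [hme] at hzE
      exact absurd hzE (not_le.2 (h1 E hEJ))
    · obtain ⟨i, hi, him, h⟩ := hβ.exhaust (m + e) h2 E hEJ hzE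
      rw [hz] at h
      exact ⟨i, hi, him, h⟩
  · intro m i j hi hij hj
    exact hβ.lt _ i j (by omega) hi hij hj
  · intro m i j hi hij hj
    have := hβ.lt_left (m + e) i j
    rw [show m + 1 + e = m + e + 1 by omega]
    rcases Nat.lt_or_ge (m + e) 2 with h2 | h2
    · omega
    · exact this h2 hi hij hj
  · intro m i j hi hij hj
    rw [show m + 1 + e = m + e + 1 by omega]
    exact hβ.lt_right (m + e) i j (by omega) hi hij hj

theorem BandIn.not_both (hV : 4 < V) {l : List ℤ} (hl : Valid l) {I J : Set ℝ}
    (h0 : BandIn V l 0 I) (h1 : BandIn V l 1 J) (h : (I ∩ J).Nonempty) : False := by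
  obtain ⟨E, hEI, hEJ⟩ := h
  have e0 := mem_spec.1 (h0.1.subset hEI)
  have e1 := mem_spec.1 (h1.2 hEJ)
  have e2 := mem_spec.1 (h0.2 hEI)
  simp only [Nat.cast_zero, neg_zero, Nat.cast_one] at e1 e2
  exact absurd e2 (not_le.2 (hl.triple_neg_one hV e0 e1))

theorem bandIn_zero_iff {l : List ℤ} {J : Set ℝ} :
    BandIn V l 0 J ↔ IsBand l V J ∧ J ⊆ spec (0 :: l) V := by simp [BandIn]

theorem bandIn_one_iff {l : List ℤ} {J : Set ℝ} :
    BandIn V l 1 J ↔ IsBand l V J ∧ J ⊆ spec (-1 :: l) V := by simp [BandIn]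

theorem bandIn_zero_cons {d : ℤ} {l : List ℤ} {J : Set ℝ} :
    BandIn V (d :: l) 0 J ↔ IsBand (d :: l) V J ∧ J ⊆ spec l V := by
  rw [bandIn_zero_iff, spec_congr (phi_zero_cons _ _)]

theorem bandIn_one_succ_cons {d : ℕ} {l : List ℤ} (hl : l ≠ []) {J : Set ℝ} :
    BandIn V (((d + 1 : ℕ) : ℤ) :: l) 1 J ↔
      IsBand (((d + 1 : ℕ) : ℤ) :: l) V J ∧ J ⊆ spec ((d : ℤ) :: l) V := by
  rw [bandIn_one_iff, spec_congr (phi_neg_one_cons _ hl)]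
  push_cast
  rw [add_sub_cancel_right]

/-- Type `B` bands of `[𝐜, m, 1]` are the bands of `[𝐜, m + 1]` lying over `σ_𝐜`. -/
theorem bandIn_one_one_cons {m : ℕ} {l : List ℤ} (hl : Valid l) (hm : 1 ≤ m) {J : Set ℝ} :
    BandIn V (1 :: (m : ℤ) :: l) 1 J ↔
      IsBand (((m + 1 : ℕ) : ℤ) :: l) V J ∧ J ⊆ spec l V := by
  rw [bandIn_one_iff, isBand_congr (phi_one_cons hl hm),
    spec_congr (phi_neg_one_cons 1 (List.cons_ne_nil _ _)), sub_self,
    spec_congr (phi_zero_cons _ _)]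

/-- `J` is connected and covered by two closed spectra which, by the invariant, do not meet on `J`;
so one of them contains it. -/
theorem IsBand.bandIn (hV : 4 < V) {l : List ℤ} (hl : Valid l) {J : Set ℝ}
    (hJ : IsBand l V J) : BandIn V l 0 J ∨ BandIn V l 1 J := by
  have hcov : J ⊆ spec (0 :: l) V ∪ spec (-1 :: l) V := by
    intro E hE
    rcases hl.cover_neg_one (mem_spec.1 (hJ.subset hE)) with h | h
    · exact .inl (mem_spec.2 h)
    · exact .inr (mem_spec.2 h)
  have hdisj : J ∩ (spec (0 :: l) V ∩ spec (-1 :: l) V) = ∅ := by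
    ext E
    simp only [mem_inter_iff, mem_empty_iff_false, iff_false, not_and]
    intro hE h0 h1
    exact absurd (mem_spec.1 h0) (not_le.2 (hl.triple_neg_one hV
      (mem_spec.1 (hJ.subset hE)) (mem_spec.1 h1)))
  have hd := (hl.differentiable_discr V).continuous
  have hd1 : Continuous (fun E => discr (1 :: l) E V) := by
    have := ((Valid.cons 1 le_rfl hl).differentiable_discr V).continuous
    simpa using this
  have hd2 : Continuous (fun E => discr (2 :: l) E V) := by
    have := ((Valid.cons 2 (by norm_num) hl).differentiable_discr V).continuous
    simpa using this
  have e0 : (fun E => discr (0 :: l) E V) =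
      fun E => discr l E V * discr (1 :: l) E V - discr (2 :: l) E V := by
    funext E
    have := hl.discr_succ_succ E V 0
    simp only [Nat.cast_zero, zero_add, Nat.cast_one, Nat.cast_ofNat] at this
    rw [this]; ring
  have hd0 : Continuous (fun E => discr (0 :: l) E V) := by
    rw [e0]; exact (hd.mul hd1).sub hd2
  have e3 : (fun E => discr (-1 :: l) E V) =
      fun E => discr l E V * discr (0 :: l) E V - discr (1 :: l) E V := by
    funext E; rw [hl.discr_one_eq]; ring
  have hd3 : Continuous (fun E => discr (-1 :: l) E V) := by
    rw [e3]; exact (hd.mul hd0).sub hd1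
  rcases isPreconnected_iff_subset_of_disjoint_closed.1 hJ.isPreconnected _ _
    (isClosed_Icc.preimage hd0) (isClosed_Icc.preimage hd3) hcov hdisj with h | h
  · exact .inl (bandIn_zero_iff.2 ⟨hJ, h⟩)
  · exact .inr (bandIn_one_iff.2 ⟨hJ, h⟩)

/-- The ladder over `J` lists every band meeting `J`, and listed bands lie in its interior. Mere
intersection thus upgrades to strict inclusion. -/
theorem strictIncl_of_isBand_cons (hV : 4 < V) {l : List ℤ} (hl : Valid l) {m : ℕ} (hm : 1 ≤ m)
    {J K : Set ℝ} (hJ : IsBand l V J) (hK : IsBand ((m : ℤ) :: l) V K)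
    (h : (K ∩ J).Nonempty) : StrictIncl K J := by
  have key : ∀ e ≤ 1, BandIn V l e J → StrictIncl K J := by
    intro e he hJe
    obtain ⟨β, hβ⟩ := hJe.exists_bandLadder hV hl he
    obtain ⟨i, hi, him, rfl⟩ := hβ.exhaust m hm K hK h
    exact (hβ.band m i hm hi him).2
  rcases hJ.bandIn hV hl with h | h
  · exact key 0 zero_le_one h
  · exact key 1 le_rfl h

/-- A type `B` band of `σ_{[𝐜, m]}` contains exactly one band of `σ_{[𝐜, m + 1]}`, which is of
type `B` again. -/
theorem BandIn.exists_succ (hV : 4 < V) {l : List ℤ} (hl : Valid l) {m : ℕ} (hm : 1 ≤ m)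
    {K : Set ℝ} (hK : BandIn V ((m : ℤ) :: l) 1 K) :
    ∃ K', BandIn V (((m + 1 : ℕ) : ℤ) :: l) 1 K' ∧ StrictIncl K' K ∧
      ∀ K'', IsBand (((m + 1 : ℕ) : ℤ) :: l) V K'' → (K'' ∩ K).Nonempty → K'' = K' := by
  have hv := Valid.cons m hm hl
  obtain ⟨β, hβ⟩ := hK.exists_bandLadder hV hv le_rfl
  have h1 := hβ.band 1 1 le_rfl one_pos (by norm_num)
  rw [Nat.cast_one, isBand_congr (phi_one_cons hl hm)] at h1
  refine ⟨β 1 1, (bandIn_one_succ_cons hl.ne_nil).2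
    ⟨h1.1, h1.2.trans (interior_subset.trans hK.1.subset)⟩, h1.2, fun K'' hK'' hne => ?_⟩
  obtain ⟨i, hi, hi2, rfl⟩ := hβ.exhaust 1 le_rfl K''
    (by rw [Nat.cast_one, isBand_congr (phi_one_cons hl hm)]; exact hK'') hne
  rw [show i = 1 by omega]

/-- The band containing a type `B` band of `σ_{[𝐜, m + 1]}` is itself of type `B`. -/
theorem BandIn.exists_pred (hV : 4 < V) {l : List ℤ} (hl : Valid l) {m : ℕ} (hm : 1 ≤ m)
    {K : Set ℝ} (hK : BandIn V (((m + 1 : ℕ) : ℤ) :: l) 1 K) :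
    ∃ K', BandIn V ((m : ℤ) :: l) 1 K' ∧ K ⊆ K' := by
  have h := (bandIn_one_succ_cons hl.ne_nil).1 hK
  obtain ⟨K', hK', hsub⟩ := exists_isBand_superset hK.1.isPreconnected hK.1.nonempty h.2
  -- Otherwise `K` would lie in the spectra of `𝐜`, `[𝐜, m]` and `[𝐜, m + 1]` at once.
  refine ⟨K', (hK'.bandIn hV (Valid.cons m hm hl)).resolve_left fun h0 => ?_, hsub⟩
  obtain ⟨E, hE⟩ := hK.1.nonempty
  exact absurd (mem_spec.1 (hK.1.subset hE)) (not_le.2 (hl.triple hV m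
    (mem_spec.1 ((bandIn_zero_cons.1 h0).2 (hsub hE))) (mem_spec.1 (h.2 hE))))

/-- The nested sequence of type `B` bands of `σ_{[𝐜, n + 1]}` inside a type `B` band of
`σ_{[𝐜, 1]}`. -/
structure BandChain (V : ℝ) (l : List ℤ) (K : Set ℝ) (Q : ℕ → Set ℝ) : Prop where
  zero : Q 0 = K
  band : ∀ n, BandIn V (((n + 1 : ℕ) : ℤ) :: l) 1 (Q n)
  incl : ∀ n, StrictIncl (Q (n + 1)) (Q n)
  unique : ∀ n K', BandIn V (((n + 1 : ℕ) : ℤ) :: l) 1 K' → (K' ∩ K).Nonempty → K' = Q n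

theorem BandIn.exists_bandChain (hV : 4 < V) {l : List ℤ} (hl : Valid l) {K : Set ℝ}
    (hK : BandIn V (1 :: l) 1 K) : ∃ Q, BandChain V l K Q := by
  have hstep : ∀ (n : ℕ) (K : {K // BandIn V (((n + 1 : ℕ) : ℤ) :: l) 1 K}),
      ∃ K' : {K // BandIn V (((n + 1 + 1 : ℕ) : ℤ) :: l) 1 K}, StrictIncl K'.1 K.1 ∧
        ∀ K'', IsBand (((n + 1 + 1 : ℕ) : ℤ) :: l) V K'' → (K'' ∩ K.1).Nonempty → K'' = K'.1 := by
    intro n K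
    obtain ⟨K', h1, h2, h3⟩ := K.2.exists_succ hV hl (by omega)
    exact ⟨⟨K', h1⟩, h2, h3⟩
  choose f hf using hstep
  let Q : (n : ℕ) → {K // BandIn V (((n + 1 : ℕ) : ℤ) :: l) 1 K} :=
    fun n => Nat.rec ⟨K, by simpa using hK⟩ f n
  refine ⟨fun n => (Q n).1, rfl, fun n => (Q n).2, fun n => (hf n (Q n)).1, fun n => ?_⟩
  induction n with
  | zero =>
    intro K' hK' hne
    exact hK'.1.eq_of_inter (show IsBand (((0 + 1 : ℕ) : ℤ) :: l) V K by simpa using hK.1) hne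
  | succ n ih =>
    intro K' hK' ⟨E, hE, hEK⟩
    -- The predecessor of `K'` also meets `K`, so it is `Q n` by induction, and `Q n` has only one
    -- successor.
    obtain ⟨K'', hK'', hsub⟩ := hK'.exists_pred hV hl (by omega)
    have := ih K'' hK'' ⟨E, hsub hE, hEK⟩
    exact (hf n (Q n)).2 K' hK'.1 ⟨E, hE, this ▸ hsub hE⟩

theorem BandChain.antitone {l : List ℤ} {K : Set ℝ} {Q : ℕ → Set ℝ} (h : BandChain V l K Q)
    (n : ℕ) : Q n ⊆ K := by
  induction n with
  | zero => exact h.zero.subset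
  | succ n ih => exact ((h.incl n).trans interior_subset).trans ih

theorem BandIn.exists_root (hV : 4 < V) {l : List ℤ} (hl : Valid l) {m : ℕ} (hm : 1 ≤ m)
    {K : Set ℝ} (hK : BandIn V ((m : ℤ) :: l) 1 K) : ∃ K', BandIn V (1 :: l) 1 K' ∧ K ⊆ K' := by
  induction m, hm using Nat.le_induction generalizing K with
  | base => exact ⟨K, by simpa using hK, Subset.rfl⟩
  | succ m hm ih =>
    obtain ⟨K', hK', hsub⟩ := hK.exists_pred hV hl hm
    obtain ⟨K'', hK'', hsub'⟩ := ih hK'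
    exact ⟨K'', hK'', hsub.trans hsub'⟩

/-! ### Types of bands -/

theorem isBand_zero_cons_univ (d : ℤ) : IsBand (0 :: [d]) V univ := by
  rw [isBand_congr (phi_zero_cons d []), IsBand, spec_nil]
  exact ⟨0, mem_univ _, by rw [connectedComponentIn_univ, PreconnectedSpace.connectedComponent_eq_univ]⟩

theorem strictIncl_univ (I : Set ℝ) : StrictIncl I univ := by
  rw [StrictIncl, interior_univ]; exact subset_univ _

theorem BandIn.backwardA (hV : 4 < V) {l : List ℤ} (hl : Valid l) {K : Set ℝ}
    (hK : BandIn V l 0 K) : BackwardA l V K := by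
  refine ⟨hK.1, ?_⟩
  cases hl with
  | base => exact ⟨univ, isBand_zero_cons_univ 0, strictIncl_univ _⟩
  | @cons l d hd hl =>
    obtain ⟨J, hJ, hsub⟩ := exists_isBand_superset hK.1.isPreconnected hK.1.nonempty
      (bandIn_zero_cons.1 hK).2
    refine ⟨J, (isBand_congr (phi_zero_cons _ _)).2 hJ,
      strictIncl_of_isBand_cons hV hl hd hJ hK.1 ?_⟩
    obtain ⟨E, hE⟩ := hK.1.nonempty
    exact ⟨E, hE, hsub hE⟩

theorem BandIn.backwardB (hV : 4 < V) {l : List ℤ} (hl : Valid l) {K : Set ℝ}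
    (hK : BandIn V l 1 K) : BackwardB l V K := by
  refine ⟨hK.1, ?_⟩
  obtain ⟨E, hE⟩ := hK.1.nonempty
  cases hl with
  | base =>
    -- Impossible: `|E| ≤ 2` and `|E + V| ≤ 2` force `V ≤ 4`.
    have h0 := mem_spec.1 (hK.1.subset hE)
    have h1 := mem_spec.1 ((bandIn_one_iff.1 hK).2 hE)
    rw [discr_zero, abs_le] at h0
    rw [discr_neg_one_zero, abs_le] at h1
    linarith [h0.1, h1.2]
  | @cons l d hd hl =>
    obtain ⟨k, rfl⟩ : ∃ k, d = k + 1 := ⟨d - 1, by omega⟩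
    have hphi : phi (-1 :: ((k + 1 : ℕ) : ℤ) :: l) = phi ((k : ℤ) :: l) := by
      rw [phi_neg_one_cons _ hl.ne_nil]; push_cast; rw [add_sub_cancel_right]
    -- A last digit `1` drops to `0`, so the enclosing band belongs to the convergent two places
    -- shorter, or is all of `ℝ` when its value is `∞`.
    rcases Nat.eq_zero_or_pos k with rfl | hk
    · have hK2 := ((bandIn_one_succ_cons hl.ne_nil).1 hK).2
      cases hl with
      | base =>
        exact ⟨univ, (isBand_congr hphi).2 (isBand_zero_cons_univ 0), strictIncl_univ _⟩
      | @cons l f hf hl =>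
        rw [Nat.cast_zero, spec_congr (phi_zero_cons _ _)] at hK2
        have hK1 := hK.1
        rw [zero_add, Nat.cast_one, isBand_congr (phi_one_cons hl hf)] at hK1
        obtain ⟨J, hJ, hsub⟩ := exists_isBand_superset hK.1.isPreconnected hK.1.nonempty hK2
        exact ⟨J, (isBand_congr (hphi.trans (phi_zero_cons _ _))).2 hJ,
          strictIncl_of_isBand_cons hV hl (by omega) hJ hK1 ⟨E, hE, hsub hE⟩⟩
    · obtain ⟨J, hJ, hsub⟩ := hK.exists_pred hV hl hk
      obtain ⟨K', -, hK', huniq⟩ := hJ.exists_succ hV hl hk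
      rw [huniq K hK.1 ⟨E, hE, hsub hE⟩]
      exact ⟨J, (isBand_congr hphi).2 hJ.1, hK'⟩

theorem WeakBackwardA.bandIn {l : List ℤ} {K : Set ℝ} (h : WeakBackwardA l V K) :
    BandIn V l 0 K := by
  obtain ⟨h1, J, hJ, hsub⟩ := h
  exact bandIn_zero_iff.2 ⟨h1, hsub.trans hJ.subset⟩

theorem WeakBackwardB.bandIn {l : List ℤ} {K : Set ℝ} (h : WeakBackwardB l V K) :
    BandIn V l 1 K := by
  obtain ⟨h1, J, hJ, hsub⟩ := h
  exact bandIn_one_iff.2 ⟨h1, hsub.trans hJ.subset⟩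

theorem StrictLeftOf.leftOf {I J : Set ℝ} (h : StrictLeftOf I J) : LeftOf I J := by
  obtain ⟨a, b, c, d, hab, hcd, hI, hJ, hbc⟩ := h
  exact ⟨a, b, c, d, hab, hcd, hI, hJ, by linarith, by linarith⟩

/-- The bands for `[𝐜, m]` are the rungs `β m`. Since `[𝐜, m, 1]` and `[𝐜, m + 1]` have the same
value, the rungs `β (m + 1)` start the chains for `[𝐜, m, n]`, and nesting preserves the interlacing
of `β m` with `β (m + 1)`. -/
theorem BandIn.forward (hV : 4 < V) {l : List ℤ} (hl : Valid l) {e : ℕ} (he : e ≤ 1) {J : Set ℝ}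
    (hJ : BandIn V l e J) {m : ℕ} (hm : 1 ≤ m) : Forward l V m (m - 1 + e) J := by
  obtain ⟨β, hβ⟩ := hJ.exists_bandLadder hV hl he
  have hv := Valid.cons m hm hl
  refine ⟨hJ.1, ?_⟩
  have hQ1 : ∀ j : Fin (m - 1 + e + 1), BandIn V (1 :: (m : ℤ) :: l) 1 (β (m + 1) (j + 1)) ∧
      StrictIncl (β (m + 1) (j + 1)) J := by
    intro j
    have := j.2
    obtain ⟨h1, h2⟩ := hβ.band (m + 1) (j + 1) (by omega) (by omega) (by omega)
    exact ⟨(bandIn_one_one_cons hl hm).2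
      ⟨h1, h2.trans (interior_subset.trans hJ.1.subset)⟩, h2⟩
  choose Q hQ using fun j => (hQ1 j).1.exists_bandChain hV hv
  refine ⟨fun i => β m (i + 1), fun n j => n.casesOn J (fun n => Q j n), ?_, fun _ => rfl, ?_, ?_⟩
  · intro i
    have := i.2
    obtain ⟨h1, h2⟩ := hβ.band m (i + 1) hm (by omega) (by omega)
    refine ⟨h1, h2, fun hB => ?_⟩
    have hA : BandIn V ((m : ℤ) :: l) 0 (β m (i + 1)) :=
      bandIn_zero_cons.2 ⟨h1, h2.trans (interior_subset.trans hJ.1.subset)⟩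
    exact hA.not_both hV hv hB.bandIn (by rw [inter_self]; exact h1.nonempty)
  · intro n j
    have hb := (hQ j).band n
    refine ⟨hb.1, ?_, fun hA => ?_⟩
    · cases n with
      | zero => exact (show StrictIncl (Q j 0) J by rw [(hQ j).zero]; exact (hQ1 j).2)
      | succ n => exact (hQ j).incl n
    · exact hA.bandIn.not_both hV (Valid.cons (n + 1) (by omega) hv) hb
        (by rw [inter_self]; exact hb.1.nonempty)
  · intro n i
    have hi := i.2
    have hsub : ∀ j, ∃ a b c d, a ≤ b ∧ β (m + 1) ((j : Fin (m - 1 + e + 1)) + 1) = Icc a b ∧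
        c ≤ d ∧ Q j n = Icc c d ∧ a ≤ c ∧ d ≤ b := by
      intro j
      have hband : ∀ {l' : List ℤ} {I : Set ℝ}, Valid l' → IsBand l' V I →
          ∃ a b, a ≤ b ∧ I = Icc a b := by
        intro l' I hl' hI
        obtain ⟨E, hE, rfl⟩ := isBand_iff.1 hI
        obtain ⟨a, b, hab, h, -⟩ := (hl'.nice hV).band hE
        exact ⟨a, b, hab.le, h⟩
      obtain ⟨a, b, hab, h1⟩ := hband (l' := ((1 : ℕ) : ℤ) :: (m : ℤ) :: l)
        (Valid.cons 1 le_rfl hv) (by rw [Nat.cast_one]; exact (hQ1 j).1.1)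
      obtain ⟨c, d, hcd, h2⟩ := hband (Valid.cons (n + 1) (by omega) hv) ((hQ j).band n).1
      have := (hQ j).antitone n
      rw [h1, h2, Icc_subset_Icc_iff hcd] at this
      exact ⟨a, b, c, d, hab, h1, hcd, h2, this⟩
    constructor
    · obtain ⟨a, b, c, d, hab, h1, hcd, h2, hac, hdb⟩ := hsub i.castSucc
      obtain ⟨a', b', c', d', hab', hcd', h1', h2', hlt⟩ :=
        hβ.lt_left m (i + 1) (i + 1) (by omega) le_rfl (by omega)
      refine StrictLeftOf.leftOf ⟨c, d, c', d', hcd, hcd', h2, h2', ?_⟩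
      simp only [Fin.val_castSucc] at h1
      rw [h1, Icc_eq_Icc_iff hab] at h1'
      linarith [h1'.2]
    · obtain ⟨a, b, c, d, hab, h1, hcd, h2, hac, hdb⟩ := hsub i.succ
      obtain ⟨a', b', c', d', hab', hcd', h1', h2', hlt⟩ :=
        hβ.lt_right m (i + 1) (i + 1 + 1) (by omega) (by omega) (by omega)
      refine StrictLeftOf.leftOf ⟨a', b', c, d, hab', hcd, h1', h2, ?_⟩
      simp only [Fin.val_succ] at h1
      rw [h1, Icc_eq_Icc_iff hab] at h2'
      linarith [h2'.1]

/-- For `V > 4` strictness and all forward conditions come for free, so only an inclusion of spectra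
remains of the definition. -/
theorem typeA_iff (hV : 4 < V) {l : List ℤ} (hl : Valid l) {J : Set ℝ} :
    TypeA l V J ↔ BandIn V l 0 J := by
  refine ⟨fun h => ?_, fun h => ⟨h.backwardA hV hl, fun m hm => h.forward hV hl zero_le_one hm⟩⟩
  obtain ⟨⟨h1, J', hJ', hsub⟩, -⟩ := h
  exact WeakBackwardA.bandIn ⟨h1, J', hJ', hsub.trans interior_subset⟩

theorem typeB_iff (hV : 4 < V) {l : List ℤ} (hl : Valid l) {J : Set ℝ} :
    TypeB l V J ↔ BandIn V l 1 J := by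
  refine ⟨fun h => ?_, fun h => ⟨h.backwardB hV hl, fun m hm => ?_⟩⟩
  · obtain ⟨⟨h1, J', hJ', hsub⟩, -⟩ := h
    exact WeakBackwardB.bandIn ⟨h1, J', hJ', hsub.trans interior_subset⟩
  · have := h.forward hV hl le_rfl hm
    rwa [Nat.sub_add_cancel hm] at this

end

/-! ### Children of a band -/

/-- The bands over `J`, as enumerated by `BandLadder`. -/
noncomputable def bandsOver (V : ℝ) (l : List ℤ) (e : ℕ) (J : Set ℝ) : ℕ → ℕ → Set ℝ :=
  Classical.epsilon (BandLadder V l e J)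

/-- The nested type `B` bands inside `K`, as in `BandChain`. -/
noncomputable def chainOf (V : ℝ) (l : List ℤ) (K : Set ℝ) : ℕ → Set ℝ :=
  Classical.epsilon (BandChain V l K)

/-- The band coded by the letter `x` inside a band of the previous level with letter `ℓ`. -/
noncomputable def child (V : ℝ) (l : List ℤ) (d : ℕ) (I : Set ℝ) : Letter → Letter → Set ℝ
  | .A _, .A i => bandsOver V l 0 I d i
  -- A `G` band belongs to `[𝐜, d, 1]`, whose value is that of `[𝐜, d + 1]`.
  | .A _, .G i => bandsOver V l 0 I (d + 1) i
  | .B, .A i => bandsOver V l 1 I d i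
  | .B, .G i => bandsOver V l 1 I (d + 1) i
  -- The chain starts with digit `1` at index `0`.
  | .G _, .B => chainOf V l I (d - 1)
  | _, _ => ∅

/-- The kind of band that a letter stands for. -/
def HasLetter (V : ℝ) (l : List ℤ) (I : Set ℝ) : Letter → Prop
  | .A _ => BandIn V l 0 I
  | .G _ => BandIn V (1 :: l) 1 I
  | .B => BandIn V l 1 I

theorem BandIn.bandsOver (hV : 4 < V) {l : List ℤ} (hl : Valid l) {e : ℕ} (he : e ≤ 1) {J : Set ℝ}
    (hJ : BandIn V l e J) : BandLadder V l e J (bandsOver V l e J) :=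
  Classical.epsilon_spec (hJ.exists_bandLadder hV hl he)

theorem BandIn.chainOf (hV : 4 < V) {l : List ℤ} (hl : Valid l) {K : Set ℝ}
    (hK : BandIn V (1 :: l) 1 K) : BandChain V l K (chainOf V l K) :=
  Classical.epsilon_spec (hK.exists_bandChain hV hl)

/-- Position of a letter in the order of the alphabet. -/
def Letter.idx : Letter → ℕ
  | .B => 0
  | .G i => 2 * i + 1
  | .A i => 2 * i + 2

theorem Letter.idx_injective : Function.Injective Letter.idx := by
  intro x y h
  cases x <;> cases y <;> simp only [Letter.idx] at h <;> first | rfl | omega | (congr 1; omega)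

/-- `B` never competes with another letter for the same position, so among admissible successors the
order is total. -/
theorem Letter.before_iff_idx {d : ℕ} {ℓ x y : Letter} (hx : x ∈ Letter.next d ℓ)
    (hy : y ∈ Letter.next d ℓ) : x.before y ↔ x.idx < y.idx := by
  cases ℓ with
  | G j =>
    obtain rfl : x = .B := hx
    obtain rfl : y = .B := hy
    simp [Letter.before]
  | A j =>
    obtain ⟨i, -, ⟨rfl, -⟩ | ⟨rfl, -⟩⟩ := hx <;> obtain ⟨i', -, ⟨rfl, -⟩ | ⟨rfl, -⟩⟩ := hy <;>
      simp only [Letter.before, Letter.idx] <;> omega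
  | B =>
    obtain ⟨i, -, ⟨rfl, -⟩ | ⟨rfl, -⟩⟩ := hx <;> obtain ⟨i', -, ⟨rfl, -⟩ | ⟨rfl, -⟩⟩ := hy <;>
      simp only [Letter.before, Letter.idx] <;> omega

theorem Letter.not_before_self (x : Letter) : ¬ x.before x := by
  cases x <;> simp [Letter.before]

section
variable {V : ℝ} {l : List ℤ} {d : ℕ} {I K : Set ℝ}

theorem HasLetter.isBand {x : Letter} (h : HasLetter V l I x) :
    IsBand l V I ∨ IsBand (1 :: l) V I := by
  cases x
  · exact .inl h.1
  · exact .inr h.1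
  · exact .inl h.1

theorem HasLetter.nonempty {x : Letter} (h : HasLetter V l I x) : I.Nonempty :=
  h.isBand.elim IsBand.nonempty IsBand.nonempty

theorem HasLetter.isPreconnected {x : Letter} (h : HasLetter V l I x) : IsPreconnected I :=
  h.isBand.elim IsBand.isPreconnected IsBand.isPreconnected

theorem HasLetter.exists_Icc (hV : 4 < V) (hl : Valid l) {x : Letter} (h : HasLetter V l I x) :
    ∃ a b, a ≤ b ∧ I = Icc a b := by
  have key : ∀ {l' : List ℤ}, Valid l' → IsBand l' V I → ∃ a b, a ≤ b ∧ I = Icc a b := by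
    intro l' hl' hI
    obtain ⟨E, hE, rfl⟩ := isBand_iff.1 hI
    obtain ⟨a, b, hab, h, -⟩ := (hl'.nice hV).band hE
    exact ⟨a, b, hab.le, h⟩
  rcases h.isBand with h | h
  · exact key hl h
  · exact key (Valid.cons 1 le_rfl hl) (by simpa using h)

theorem bandIn_one_one_subset (hl : Valid l) (h : BandIn V (1 :: l) 1 I) :
    I ⊆ spec (0 :: l) V := by
  have h2 := (bandIn_one_iff.1 h).2
  rwa [spec_congr (phi_neg_one_cons 1 hl.ne_nil), sub_self] at h2

/-- A `G` band lies in the spectra of `[𝐜, 0]` and `[𝐜, 1]`, which leaves no room for `σ_𝐜` by the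
invariant. -/
theorem HasLetter.inter_spec_eq_empty (hV : 4 < V) (hl : Valid l) {i : ℕ}
    (h : HasLetter V l I (.G i)) : I ∩ spec l V = ∅ := by
  ext E
  simp only [mem_inter_iff, mem_empty_iff_false, iff_false, not_and]
  intro hE hEl
  have h0 := mem_spec.1 (bandIn_one_one_subset hl h hE)
  have h1 := mem_spec.1 (h.1.subset hE)
  have := hl.triple hV 0 (mem_spec.1 hEl) (by simpa using h0)
  rw [zero_add, Nat.cast_one] at this
  exact absurd h1 (not_le.2 this)

theorem bandLadder_child {e : ℕ} (hl : Valid l) (hd : 1 ≤ d) {β : ℕ → ℕ → Set ℝ}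
    (hβ : BandLadder V l e I β) (hI : IsBand l V I) :
    (∀ i, 0 < i → i < d + e → BandIn V ((d : ℤ) :: l) 0 (β d i) ∧ β d i ⊆ I) ∧
      ∀ i, 0 < i → i < d + 1 + e → BandIn V (1 :: (d : ℤ) :: l) 1 (β (d + 1) i) ∧
        β (d + 1) i ⊆ I := by
  refine ⟨fun i hi hid => ?_, fun i hi hid => ?_⟩
  · obtain ⟨h1, h2⟩ := hβ.band d i hd hi hid
    have h3 := h2.trans interior_subset
    exact ⟨bandIn_zero_cons.2 ⟨h1, h3.trans hI.subset⟩, h3⟩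
  · obtain ⟨h1, h2⟩ := hβ.band (d + 1) i (by omega) hi hid
    have h3 := h2.trans interior_subset
    exact ⟨(bandIn_one_one_cons hl hd).2 ⟨h1, h3.trans hI.subset⟩, h3⟩

theorem hasLetter_child (hV : 4 < V) (hl : Valid l) (hd : 1 ≤ d) {ℓ x : Letter}
    (hI : HasLetter V l I ℓ) (hx : x ∈ Letter.next d ℓ) :
    HasLetter V ((d : ℤ) :: l) (child V l d I ℓ x) x ∧ child V l d I ℓ x ⊆ I := by
  cases ℓ with
  | A j =>
    have hβ := bandLadder_child hl hd (BandIn.bandsOver hV hl zero_le_one hI) hI.1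
    obtain ⟨i, hi, ⟨rfl, hid⟩ | ⟨rfl, hid⟩⟩ := hx
    · exact hβ.1 i hi (by omega)
    · exact hβ.2 i hi (by omega)
  | B =>
    have hβ := bandLadder_child hl hd (BandIn.bandsOver hV hl le_rfl hI) hI.1
    obtain ⟨i, hi, ⟨rfl, hid⟩ | ⟨rfl, hid⟩⟩ := hx
    · exact hβ.1 i hi (by omega)
    · exact hβ.2 i hi (by omega)
  | G j =>
    obtain rfl : x = .B := hx
    have hQ := BandIn.chainOf hV hl hI
    have h1 := hQ.band (d - 1)
    rw [Nat.sub_add_cancel hd] at h1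
    exact ⟨h1, hQ.antitone _⟩

theorem child_lt (hV : 4 < V) (hl : Valid l) {ℓ x y : Letter}
    (hI : HasLetter V l I ℓ) (hx : x ∈ Letter.next d ℓ) (hy : y ∈ Letter.next d ℓ)
    (hxy : x.before y) : StrictLeftOf (child V l d I ℓ x) (child V l d I ℓ y) := by
  cases ℓ with
  | A j =>
    have hβ := BandIn.bandsOver hV hl zero_le_one hI
    obtain ⟨i, hi, ⟨rfl, hid⟩ | ⟨rfl, hid⟩⟩ := hx <;>
      obtain ⟨i', hi', ⟨rfl, hid'⟩ | ⟨rfl, hid'⟩⟩ := hy <;> simp only [Letter.before] at hxy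
    · exact hβ.lt _ _ _ hi hxy (by omega)
    · exact hβ.lt_right _ _ _ hi hxy (by omega)
    · exact hβ.lt_left _ _ _ hi hxy (by omega)
    · exact hβ.lt _ _ _ hi hxy (by omega)
  | B =>
    have hβ := BandIn.bandsOver hV hl le_rfl hI
    obtain ⟨i, hi, ⟨rfl, hid⟩ | ⟨rfl, hid⟩⟩ := hx <;>
      obtain ⟨i', hi', ⟨rfl, hid'⟩ | ⟨rfl, hid'⟩⟩ := hy <;> simp only [Letter.before] at hxy
    · exact hβ.lt _ _ _ hi hxy (by omega)
    · exact hβ.lt_right _ _ _ hi hxy (by omega)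
    · exact hβ.lt_left _ _ _ hi hxy (by omega)
    · exact hβ.lt _ _ _ hi hxy (by omega)
  | G j =>
    obtain rfl : x = .B := hx
    exact hxy.elim

/-- Membership in `σ_𝐜` separates the cases: next-level bands of kind `A` or `G` lie in `σ_𝐜` and
those of kind `B` avoid it, while parents `A`, `B` lie in `σ_𝐜` and `G` avoids it. -/
theorem child_exhaust (hV : 4 < V) (hl : Valid l) (hd : 1 ≤ d) {ℓ y : Letter}
    (hI : HasLetter V l I ℓ) (hK : HasLetter V ((d : ℤ) :: l) K y) (hne : (K ∩ I).Nonempty) :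
    ∃ x ∈ Letter.next d ℓ, child V l d I ℓ x = K := by
  obtain ⟨k, rfl⟩ : ∃ k, d = k + 1 := ⟨d - 1, by omega⟩
  -- a type `B` band of the next level does not meet `σ_𝐜`
  have hB : HasLetter V (((k + 1 : ℕ) : ℤ) :: l) K .B → ¬ I ⊆ spec l V := by
    intro h hsub
    obtain ⟨E, hEK, hEI⟩ := hne
    have h2 := (bandIn_one_succ_cons hl.ne_nil).1 h
    exact absurd (mem_spec.1 (h2.1.subset hEK)) (not_le.2 (hl.triple hV k
      (mem_spec.1 (hsub hEI)) (mem_spec.1 (h2.2 hEK))))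
  cases ℓ with
  | A j =>
    have hβ := BandIn.bandsOver hV hl zero_le_one hI
    cases y with
    | A i =>
      obtain ⟨i, hi, hid, rfl⟩ := hβ.exhaust _ hd K hK.1 hne
      exact ⟨.A i, ⟨i, hi, .inl ⟨rfl, by omega⟩⟩, rfl⟩
    | G i =>
      obtain ⟨i, hi, hid, rfl⟩ := hβ.exhaust _ (by omega) K
        ((bandIn_one_one_cons hl hd).1 hK).1 hne
      exact ⟨.G i, ⟨i, hi, .inr ⟨rfl, by omega⟩⟩, rfl⟩
    | B => exact absurd hI.1.subset (hB hK)
  | B =>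
    have hβ := BandIn.bandsOver hV hl le_rfl hI
    cases y with
    | A i =>
      obtain ⟨i, hi, hid, rfl⟩ := hβ.exhaust _ hd K hK.1 hne
      exact ⟨.A i, ⟨i, hi, .inl ⟨rfl, by omega⟩⟩, rfl⟩
    | G i =>
      obtain ⟨i, hi, hid, rfl⟩ := hβ.exhaust _ (by omega) K
        ((bandIn_one_one_cons hl hd).1 hK).1 hne
      exact ⟨.G i, ⟨i, hi, .inr ⟨rfl, by omega⟩⟩, rfl⟩
    | B => exact absurd hI.1.subset (hB hK)
  | G j =>
    have hempty := hI.inter_spec_eq_empty hV hl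
    obtain ⟨E, hEK, hEI⟩ := hne
    have hEl : E ∉ spec l V := fun h => by
      have : E ∈ I ∩ spec l V := ⟨hEI, h⟩
      rw [hempty] at this; exact this
    cases y with
    | A i => exact absurd ((bandIn_zero_cons.1 hK).2 hEK) hEl
    | G i => exact absurd (((bandIn_one_one_cons hl hd).1 hK).2 hEK) hEl
    | B =>
      exact ⟨.B, rfl, ((BandIn.chainOf hV hl hI).unique k K hK ⟨E, hEK, hEI⟩).symm⟩

theorem exists_parent (hV : 4 < V) (hl : Valid l) (hd : 1 ≤ d) {y : Letter}
    (hK : HasLetter V ((d : ℤ) :: l) K y) : ∃ ℓ P, HasLetter V l P ℓ ∧ (K ∩ P).Nonempty := by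
  have key : K ⊆ spec l V → ∃ ℓ P, HasLetter V l P ℓ ∧ (K ∩ P).Nonempty := by
    intro hsub
    obtain ⟨P, hP, hKP⟩ := exists_isBand_superset hK.isPreconnected hK.nonempty hsub
    obtain ⟨E, hE⟩ := hK.nonempty
    rcases hP.bandIn hV hl with h | h
    · exact ⟨.A 0, P, h, E, hE, hKP hE⟩
    · exact ⟨.B, P, h, E, hE, hKP hE⟩
  cases y with
  | A i => exact key (bandIn_zero_cons.1 hK).2
  | G i => exact key ((bandIn_one_one_cons hl hd).1 hK).2
  | B =>
    obtain ⟨P, hP, hKP⟩ := BandIn.exists_root hV hl hd hK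
    obtain ⟨E, hE⟩ := hK.nonempty
    exact ⟨.G 0, P, hP, E, hE, hKP hE⟩

theorem HasLetter.typeA_iff (hV : 4 < V) (hl : Valid l) {x : Letter} (h : HasLetter V l I x) :
    (∃ i, x = .A i) ↔ TypeA l V I := by
  rw [SturmianCoding.typeA_iff hV hl]
  refine ⟨?_, fun hI => ?_⟩
  · rintro ⟨i, rfl⟩; exact h
  · cases x with
    | A i => exact ⟨i, rfl⟩
    | B => exact (hI.not_both hV hl h (by rw [inter_self]; exact hI.1.nonempty)).elim
    | G i =>
      obtain ⟨E, hE⟩ := hI.1.nonempty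
      exact absurd (h.inter_spec_eq_empty hV hl) (Nonempty.ne_empty ⟨E, hE, hI.1.subset hE⟩)

theorem HasLetter.typeB_iff (hV : 4 < V) (hl : Valid l) {x : Letter} (h : HasLetter V l I x) :
    x = .B ↔ TypeB l V I := by
  rw [SturmianCoding.typeB_iff hV hl]
  refine ⟨?_, fun hI => ?_⟩
  · rintro rfl; exact h
  · cases x with
    | A i => exact (h.not_both hV hl hI (by rw [inter_self]; exact hI.1.nonempty)).elim
    | B => rfl
    | G i =>
      obtain ⟨E, hE⟩ := hI.1.nonempty
      exact absurd (h.inter_spec_eq_empty hV hl) (Nonempty.ne_empty ⟨E, hE, hI.1.subset hE⟩)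

theorem HasLetter.typeG_iff (hV : 4 < V) (hl : Valid l) {x : Letter} (h : HasLetter V l I x) :
    (∃ i, x = .G i) ↔ TypeB (1 :: l) V I ∧ I ∩ spec l V = ∅ := by
  have hv : Valid (1 :: l) := by simpa using Valid.cons 1 le_rfl hl
  rw [SturmianCoding.typeB_iff hV hv]
  refine ⟨?_, fun hI => ?_⟩
  · rintro ⟨i, rfl⟩; exact ⟨h, h.inter_spec_eq_empty hV hl⟩
  · obtain ⟨E, hE⟩ := h.nonempty
    cases x with
    | A i => exact absurd hI.2 (Nonempty.ne_empty ⟨E, hE, h.1.subset hE⟩)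
    | B => exact absurd hI.2 (Nonempty.ne_empty ⟨E, hE, h.1.subset hE⟩)
    | G i => exact ⟨i, rfl⟩

theorem mem_level_iff (hV : 4 < V) (hl : Valid l) :
    I ∈ level l V ↔ ∃ x, HasLetter V l I x := by
  have hv : Valid (1 :: l) := by simpa using Valid.cons 1 le_rfl hl
  rw [level, mem_ofPred_eq, typeA_iff hV hl, typeB_iff hV hl, typeB_iff hV hv]
  constructor
  · rintro ((h | h) | h)
    · exact ⟨.A 0, h⟩
    · exact ⟨.B, h⟩
    · exact ⟨.G 0, h⟩
  · rintro ⟨x, h⟩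
    cases x
    · exact .inl (.inl h)
    · exact .inr h
    · exact .inl (.inr h)

end

/-! ### Codes -/

/-- The band coded by a word. -/
noncomputable def bandOf (V : ℝ) (c : ℕ → ℕ) : (k : ℕ) → (Fin (k + 1) → Letter) → Set ℝ
  | 0, γ =>
    match γ 0 with
    | .A _ => Icc (-2) 2
    | _ => Icc (V - 2) (V + 2)
  | k + 1, γ =>
    child V (coK c k) (c (k + 1)) (bandOf V c k fun i => γ i.castSucc)
      (γ (Fin.last k).castSucc) (γ (Fin.last (k + 1)))

/-- Prefixes of words. -/
def trunc {j k : ℕ} (h : j ≤ k) (γ : Fin (k + 1) → Letter) : Fin (j + 1) → Letter :=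
  fun i => γ (Fin.castLE (by omega) i)

theorem trunc_mem {c : ℕ → ℕ} {j k : ℕ} (h : j ≤ k) {γ : Fin (k + 1) → Letter}
    (hγ : γ ∈ codes c k) : trunc h γ ∈ codes c j :=
  ⟨hγ.1, fun i => hγ.2 (Fin.castLE h i)⟩

theorem exists_first_diff {k l : ℕ} (γ : Fin (k + 1) → Letter) (η : Fin (l + 1) → Letter) :
    (∃ (j : ℕ) (hk : j < k + 1) (hl : j < l + 1),
      (∀ (i : ℕ) (hi : i < j), γ ⟨i, hi.trans hk⟩ = η ⟨i, hi.trans hl⟩) ∧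
        γ ⟨j, hk⟩ ≠ η ⟨j, hl⟩) ∨
      (∃ h : k ≤ l, γ = trunc h η) ∨ ∃ h : l ≤ k, η = trunc h γ := by
  classical
  by_cases hex : ∃ (j : ℕ) (hk : j < k + 1) (hl : j < l + 1), γ ⟨j, hk⟩ ≠ η ⟨j, hl⟩
  · left
    obtain ⟨hk, hl, hne⟩ := Nat.find_spec hex
    refine ⟨Nat.find hex, hk, hl, fun i hi => ?_, hne⟩
    by_contra hcon
    exact Nat.find_min hex hi ⟨_, _, hcon⟩
  · right
    push Not at hex
    rcases le_total k l with h | h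
    · exact .inl ⟨h, funext fun i => hex i i.2 (i.2.trans_le (by omega))⟩
    · exact .inr ⟨h, funext fun i => (hex i (i.2.trans_le (by omega)) i.2).symm⟩

/-- Hypotheses on the coupling constant and the digits. -/
structure Setting (V : ℝ) (c : ℕ → ℕ) : Prop where
  four_lt : 4 < V
  zero : c 0 = 0
  one_le : ∀ k, 1 ≤ c (k + 1)

theorem setting_of_isContFracExpansion {α : ℝ} (hα01 : α ∈ Icc (0 : ℝ) 1) (hα : Irrational α)
    {c : ℕ → ℕ} (hc : IsContFracExpansion α c) {V : ℝ} (hV : 4 < V) : Setting V c := by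
  refine ⟨hV, ?_, fun k => ?_⟩
  · have h := hc.1
    rw [GenContFract.of_h_eq_floor] at h
    have h1 : α < 1 := lt_of_le_of_ne hα01.2 fun h => hα ⟨1, by simp [h]⟩
    have h2 : ⌊α⌋ = 0 := Int.floor_eq_zero_iff.2 ⟨hα01.1, h1⟩
    rw [h2] at h
    exact_mod_cast h.symm
  · have h := hc.2 k
    obtain ⟨p, hp, hpb⟩ := GenContFract.exists_s_b_of_partDen h
    have := GenContFract.of_one_le_get?_partDen h
    exact_mod_cast this

section
variable {V : ℝ} {c : ℕ → ℕ}

theorem Setting.valid (h : Setting V c) (k : ℕ) : Valid (coK c k) := by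
  induction k with
  | zero => rw [coK, h.zero]; exact .base
  | succ k ih => exact .cons _ (h.one_le k) ih

/-! ### The initial level and inheritance of letters -/

theorem spec_zero (V : ℝ) : spec [0] V = Icc (-2) 2 := by
  ext E; rw [mem_spec, discr_zero, abs_le, mem_Icc]

theorem spec_one_zero (V : ℝ) : spec [1, 0] V = Icc (V - 2) (V + 2) := by
  ext E; rw [mem_spec, discr_one_zero, abs_le, mem_Icc]
  constructor <;> rintro ⟨h1, h2⟩ <;> constructor <;> linarith

theorem isBand_of_spec_eq_Icc {l : List ℤ} {a b : ℝ} (hab : a ≤ b) (h : spec l V = Icc a b)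
    {I : Set ℝ} : IsBand l V I ↔ I = Icc a b := by
  have key : ∀ E ∈ Icc a b, connectedComponentIn (Icc a b) E = Icc a b := fun E hE =>
    isPreconnected_Icc.connectedComponentIn hE
  rw [IsBand, h]
  constructor
  · rintro ⟨E, hE, rfl⟩; exact key E hE
  · rintro rfl; exact ⟨a, ⟨le_rfl, hab⟩, (key a ⟨le_rfl, hab⟩).symm⟩

theorem bandIn_zero_zero_iff {I : Set ℝ} : BandIn V [0] 0 I ↔ I = Icc (-2) 2 := by
  rw [bandIn_zero_cons, isBand_of_spec_eq_Icc (by norm_num) (spec_zero V), spec_nil]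
  simp

theorem bandIn_one_one_zero_iff {I : Set ℝ} :
    BandIn V [1, 0] 1 I ↔ I = Icc (V - 2) (V + 2) := by
  rw [bandIn_one_iff, isBand_of_spec_eq_Icc (by linarith) (spec_one_zero V),
    spec_congr (phi_neg_one_cons 1 (List.cons_ne_nil _ _)), sub_self,
    spec_congr (phi_zero_cons _ _), spec_nil]
  simp

theorem Setting.hasLetter (h : Setting V c) {k : ℕ} {γ : Fin (k + 1) → Letter}
    (hγ : γ ∈ codes c k) : HasLetter V (coK c k) (bandOf V c k γ) (γ (Fin.last k)) := by
  induction k with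
  | zero =>
    have hl : coK c 0 = [0] := by rw [coK, h.zero]; rfl
    rw [hl, bandOf, show Fin.last 0 = 0 from rfl]
    rcases hγ.1 with h0 | h0 <;> rw [h0]
    · exact bandIn_zero_zero_iff.2 rfl
    · exact bandIn_one_one_zero_iff.2 rfl
  | succ k ih =>
    exact (hasLetter_child h.four_lt (h.valid k) (h.one_le k)
      (ih (trunc_mem (Nat.le_succ k) hγ)) (hγ.2 (Fin.last k))).1

theorem Setting.bandOf_subset_init (h : Setting V c) {k : ℕ} {γ : Fin (k + 2) → Letter}
    (hγ : γ ∈ codes c (k + 1)) :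
    bandOf V c (k + 1) γ ⊆ bandOf V c k fun i => γ i.castSucc :=
  (hasLetter_child h.four_lt (h.valid k) (h.one_le k)
    (h.hasLetter (trunc_mem (Nat.le_succ k) hγ)) (hγ.2 (Fin.last k))).2

theorem Setting.bandOf_subset_trunc (h : Setting V c) {j k : ℕ} (hjk : j ≤ k)
    {γ : Fin (k + 1) → Letter} (hγ : γ ∈ codes c k) :
    bandOf V c k γ ⊆ bandOf V c j (trunc hjk γ) := by
  induction k, hjk using Nat.le_induction with
  | base => exact Subset.rfl
  | succ k hjk ih =>
    exact (h.bandOf_subset_init hγ).trans (ih (trunc_mem (Nat.le_succ k) hγ))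

/-! ### Order of codes and order of bands -/

theorem StrictLeftOf.mono {I J : Set ℝ} (h : StrictLeftOf I J) {a b a' b' : ℝ} (hab : a ≤ b)
    (hab' : a' ≤ b') (hI : Icc a b ⊆ I) (hJ : Icc a' b' ⊆ J) :
    StrictLeftOf (Icc a b) (Icc a' b') := by
  obtain ⟨p, q, r, s, hpq, hrs, rfl, rfl, hqr⟩ := h
  rw [Icc_subset_Icc_iff hab] at hI
  rw [Icc_subset_Icc_iff hab'] at hJ
  exact ⟨a, b, a', b', hab, hab', rfl, rfl, by linarith [hI.2, hJ.1]⟩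

theorem StrictLeftOf.disjoint {I J : Set ℝ} (h : StrictLeftOf I J) : Disjoint I J := by
  obtain ⟨p, q, r, s, hpq, hrs, rfl, rfl, hqr⟩ := h
  rw [disjoint_left]
  intro x hx hx'
  linarith [hx.2, hx'.1]

theorem StrictLeftOf.asymm {I J : Set ℝ} (h : StrictLeftOf I J) : ¬ StrictLeftOf J I := by
  obtain ⟨p, q, r, s, hpq, hrs, rfl, rfl, hqr⟩ := h
  rintro ⟨p', q', r', s', hpq', hrs', h1, h2, hlt⟩
  rw [Icc_eq_Icc_iff hrs] at h1
  rw [Icc_eq_Icc_iff hpq] at h2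
  linarith [h1.1, h1.2, h2.1, h2.2]

theorem codes_letter_cases {k j : ℕ} {γ η : Fin (k + 1) → Letter} (hγ : γ ∈ codes c k)
    (hη : η ∈ codes c k) (hj : j < k + 1)
    (heq : ∀ (i : ℕ) (hi : i < j), γ ⟨i, hi.trans hj⟩ = η ⟨i, hi.trans hj⟩) :
    (∃ ℓ d, γ ⟨j, hj⟩ ∈ Letter.next d ℓ ∧ η ⟨j, hj⟩ ∈ Letter.next d ℓ) := by
  cases j with
  | zero =>
    -- A fictitious preceding `A` with digit `2` admits both initial letters `A⁽¹⁾` and `G⁽²⁾`.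
    refine ⟨.A 0, 2, ?_, ?_⟩
    · rcases hγ.1 with h | h
      · exact ⟨1, le_rfl, .inl ⟨h, by norm_num⟩⟩
      · exact ⟨2, by norm_num, .inr ⟨h, by norm_num⟩⟩
    · rcases hη.1 with h | h
      · exact ⟨1, le_rfl, .inl ⟨h, by norm_num⟩⟩
      · exact ⟨2, by norm_num, .inr ⟨h, by norm_num⟩⟩
  | succ j =>
    have h1 := hγ.2 ⟨j, by omega⟩
    have h2 := hη.2 ⟨j, by omega⟩
    have := heq j (by omega)
    refine ⟨_, _, h1, ?_⟩
    change η _ ∈ Letter.next _ (γ ⟨j, by omega⟩)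
    rw [this]
    exact h2

/-- At the first difference both letters may follow the same letter, so they are comparable. -/
theorem codeBefore_trichotomy {k l : ℕ} {γ : Fin (k + 1) → Letter} {η : Fin (l + 1) → Letter}
    (hγ : γ ∈ codes c k) (hη : η ∈ codes c l) :
    codeBefore γ η ∨ codeBefore η γ ∨ (∃ h : k ≤ l, γ = trunc h η) ∨
      ∃ h : l ≤ k, η = trunc h γ := by
  rcases exists_first_diff γ η with ⟨j, hk, hl, heq, hne⟩ | h
  · obtain ⟨ℓ, d, h1, h2⟩ := codes_letter_cases (trunc_mem (Nat.lt_succ_iff.1 hk) hγ)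
      (trunc_mem (Nat.lt_succ_iff.1 hl) hη) (Nat.lt_succ_self j) heq
    change γ ⟨j, hk⟩ ∈ _ at h1
    change η ⟨j, hl⟩ ∈ _ at h2
    rcases lt_or_gt_of_ne (Letter.idx_injective.ne hne) with h | h
    · exact .inl ⟨j, hk, hl, heq, (Letter.before_iff_idx h1 h2).2 h⟩
    · exact .inr (.inl ⟨j, hl, hk, fun i hi => (heq i hi).symm,
        (Letter.before_iff_idx h2 h1).2 h⟩)
  · exact .inr (.inr h)

/-- The order is decided among children of a common parent, or at the initial level, and passes to
longer codes by inclusion. -/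
theorem Setting.strictLeftOf_of_codeBefore (h : Setting V c) {k l : ℕ}
    {γ : Fin (k + 1) → Letter} {η : Fin (l + 1) → Letter} (hγ : γ ∈ codes c k)
    (hη : η ∈ codes c l) (hlt : codeBefore γ η) :
    StrictLeftOf (bandOf V c k γ) (bandOf V c l η) := by
  obtain ⟨j, hk, hl, heq, hj⟩ := hlt
  have hjk := Nat.lt_succ_iff.1 hk
  have hjl := Nat.lt_succ_iff.1 hl
  have hγj := trunc_mem hjk hγ
  have hηj := trunc_mem hjl hη
  have main : StrictLeftOf (bandOf V c j (trunc hjk γ)) (bandOf V c j (trunc hjl η)) := by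
    cases j with
    | zero =>
      have e1 : γ ⟨0, hk⟩ = γ 0 := rfl
      have e2 : η ⟨0, hl⟩ = η 0 := rfl
      rw [e1, e2] at hj
      have f1 : trunc hjk γ 0 = γ 0 := rfl
      have f2 : trunc hjl η 0 = η 0 := rfl
      rw [bandOf, bandOf, f1, f2]
      rcases hγ.1 with h1 | h1 <;> rcases hη.1 with h2 | h2 <;> rw [h1, h2] at hj ⊢
      · exact absurd hj (Letter.not_before_self _)
      -- The gap between the two initial bands is `2 < V - 2`.
      · have := h.four_lt
        exact ⟨_, _, _, _, by norm_num, by linarith, rfl, rfl, by linarith⟩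
      · simp [Letter.before] at hj
      · exact absurd hj (Letter.not_before_self _)
    | succ j =>
      have e : (fun i : Fin (j + 1) => trunc hjk γ i.castSucc) =
          fun i : Fin (j + 1) => trunc hjl η i.castSucc := by
        funext i; exact heq i i.2
      have e2 : trunc hjk γ (Fin.last j).castSucc = trunc hjl η (Fin.last j).castSucc :=
        congr_fun e (Fin.last j)
      have h1 := hγj.2 (Fin.last j)
      have h2 := hηj.2 (Fin.last j)
      rw [← e2] at h2
      rw [bandOf, bandOf, ← e, ← e2]
      exact child_lt h.four_lt (h.valid j) (h.hasLetter (trunc_mem (Nat.le_succ j) hγj)) h1 h2 hj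
  obtain ⟨a, b, hab, h1⟩ := (h.hasLetter hγ).exists_Icc h.four_lt (h.valid k)
  obtain ⟨a', b', hab', h2⟩ := (h.hasLetter hη).exists_Icc h.four_lt (h.valid l)
  have s1 := h.bandOf_subset_trunc hjk hγ
  have s2 := h.bandOf_subset_trunc hjl hη
  rw [h1] at s1 ⊢
  rw [h2] at s2 ⊢
  exact main.mono hab hab' s1 s2

theorem Setting.codeBefore_iff (h : Setting V c) {k l : ℕ}
    {γ : Fin (k + 1) → Letter} {η : Fin (l + 1) → Letter} (hγ : γ ∈ codes c k)
    (hη : η ∈ codes c l) :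
    codeBefore γ η ↔ StrictLeftOf (bandOf V c k γ) (bandOf V c l η) := by
  refine ⟨h.strictLeftOf_of_codeBefore hγ hη, fun hlt => ?_⟩
  have hd := hlt.disjoint
  rcases codeBefore_trichotomy hγ hη with h1 | h1 | ⟨hkl, rfl⟩ | ⟨hlk, rfl⟩
  · exact h1
  · exact absurd (h.strictLeftOf_of_codeBefore hη hγ h1) hlt.asymm
  · obtain ⟨E, hE⟩ := (h.hasLetter hη).nonempty
    exact absurd hE (disjoint_left.1 hd (h.bandOf_subset_trunc hkl hη hE))
  · obtain ⟨E, hE⟩ := (h.hasLetter hγ).nonempty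
    exact absurd (h.bandOf_subset_trunc hlk hγ hE) (disjoint_left.1 hd hE)

theorem Setting.eq_trunc_of_inter (h : Setting V c) {k l : ℕ} (hkl : k ≤ l)
    {γ : Fin (k + 1) → Letter} {η : Fin (l + 1) → Letter} (hγ : γ ∈ codes c k)
    (hη : η ∈ codes c l) (hne : (bandOf V c k γ ∩ bandOf V c l η).Nonempty) :
    γ = trunc hkl η := by
  obtain ⟨E, hE, hE'⟩ := hne
  rcases codeBefore_trichotomy hγ hη with h1 | h1 | ⟨hkl, h1⟩ | ⟨hlk, h1⟩
  · exact absurd hE' (disjoint_left.1 (h.strictLeftOf_of_codeBefore hγ hη h1).disjoint hE)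
  · exact absurd hE (disjoint_left.1 (h.strictLeftOf_of_codeBefore hη hγ h1).disjoint hE')
  · exact h1
  · obtain rfl : k = l := le_antisymm hkl hlk
    exact h1.symm

theorem Setting.exists_code (h : Setting V c) {k : ℕ} {K : Set ℝ} {y : Letter}
    (hK : HasLetter V (coK c k) K y) : ∃ γ ∈ codes c k, bandOf V c k γ = K := by
  induction k generalizing K y with
  | zero =>
    have hl : coK c 0 = [0] := by rw [coK, h.zero]; rfl
    rw [hl] at hK
    have hA : BandIn V [0] 0 K → ∃ γ ∈ codes c 0, bandOf V c 0 γ = K := fun hK =>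
      ⟨fun _ => .A 1, ⟨.inl rfl, fun j => j.elim0⟩, (bandIn_zero_zero_iff.1 hK).symm⟩
    cases y with
    | A i => exact hA hK
    | G i =>
      exact ⟨fun _ => .G 2, ⟨.inr rfl, fun j => j.elim0⟩, (bandIn_one_one_zero_iff.1 hK).symm⟩
    -- No band of kind `B` exists here, but this need not be used: `σ_{[0, 0]}` has only one band.
    | B =>
      exact hA (bandIn_zero_zero_iff.2
        ((isBand_of_spec_eq_Icc (by norm_num) (spec_zero V)).1 hK.1))
  | succ k ih =>
    obtain ⟨ℓ, P, hP, hne⟩ := exists_parent h.four_lt (h.valid k) (h.one_le k) hK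
    obtain ⟨γ, hγ, rfl⟩ := ih hP
    obtain ⟨x, hx, hxK⟩ := child_exhaust h.four_lt (h.valid k) (h.one_le k)
      (h.hasLetter hγ) hK hne
    have e : (fun i : Fin (k + 1) => (Fin.snoc γ x : Fin (k + 2) → Letter) i.castSucc) = γ := by
      funext i; exact Fin.snoc_castSucc (α := fun _ => Letter) x γ i
    have e' : (Fin.snoc γ x : Fin (k + 2) → Letter) (Fin.last (k + 1)) = x :=
      Fin.snoc_last (α := fun _ => Letter) x γ
    refine ⟨(Fin.snoc γ x : Fin (k + 2) → Letter), ⟨?_, fun j => ?_⟩, ?_⟩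
    · rw [show (0 : Fin (k + 2)) = (0 : Fin (k + 1)).castSucc from rfl, congr_fun e 0]
      exact hγ.1
    · rw [congr_fun e j]
      refine Fin.lastCases ?_ (fun j => ?_) j
      · rw [Fin.succ_last, e']; exact hx
      · rw [Fin.succ_castSucc, congr_fun e j.succ]
        exact hγ.2 j
    · rw [bandOf, e, e', congr_fun e (Fin.last k)]
      exact hxK

/-- A strictly monotone surjection of a well-ordered set onto itself is the identity. -/
theorem eq_self_of_strictMono_surjective {X : Type*} (r : X → ℕ) (hr : Function.Injective r)
    (f : X → X) (hf : ∀ x y, r x < r y → r (f x) < r (f y)) (hs : Function.Surjective f) (x : X) :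
    f x = x := by
  -- A value of smaller rank would itself be mapped to still smaller rank, contradicting the
  -- induction.
  have hle : ∀ n x, r x = n → r x ≤ r (f x) := by
    intro n
    induction n using Nat.strong_induction_on with
    | _ n ih =>
      intro x hx
      by_contra hcon
      rw [not_le] at hcon
      have h1 := ih (r (f x)) (hx ▸ hcon) (f x) rfl
      exact absurd (hf _ _ hcon) (not_lt.2 h1)
  have key : ∀ n x, r x = n → f x = x := by
    intro n
    induction n using Nat.strong_induction_on with
    | _ n ih =>
      intro x hx
      obtain ⟨y, hy⟩ := hs x
      -- A preimage of smaller rank would already be fixed, hence equal to `x`.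
      rcases (hle _ y rfl).lt_or_eq with h | h
      · rw [hy] at h
        have := ih (r y) (hx ▸ h) y rfl
        rw [hy] at this
        rw [this] at h
        exact absurd h (lt_irrefl _)
      · rw [hy] at h
        rwa [hr h] at hy
  exact key _ x rfl

end

/-! ### Properties of the coding and its uniqueness -/

section
variable {V : ℝ} {c : ℕ → ℕ}

theorem Setting.bandOf_mem_level (h : Setting V c) {k : ℕ} {γ : Fin (k + 1) → Letter}
    (hγ : γ ∈ codes c k) : bandOf V c k γ ∈ level (coK c k) V :=
  (mem_level_iff h.four_lt (h.valid k)).2 ⟨_, h.hasLetter hγ⟩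

theorem Setting.exists_code_of_mem_level (h : Setting V c) {k : ℕ} {K : Set ℝ}
    (hK : K ∈ level (coK c k) V) : ∃ γ ∈ codes c k, bandOf V c k γ = K := by
  obtain ⟨y, hy⟩ := (mem_level_iff h.four_lt (h.valid k)).1 hK
  exact h.exists_code hy

theorem Setting.bandOf_injective (h : Setting V c) {k : ℕ} {γ η : Fin (k + 1) → Letter}
    (hγ : γ ∈ codes c k) (hη : η ∈ codes c k) (heq : bandOf V c k γ = bandOf V c k η) :
    γ = η :=
  h.eq_trunc_of_inter le_rfl hγ hη (by rw [heq, inter_self]; exact (h.hasLetter hη).nonempty)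

theorem Setting.bijOn (h : Setting V c) (k : ℕ) :
    BijOn (fun γ : codes c k => bandOf V c k γ) univ (level (coK c k) V) := by
  refine ⟨fun γ _ => h.bandOf_mem_level γ.2, fun γ _ η _ heq => ?_, fun K hK => ?_⟩
  · exact Subtype.ext (h.bandOf_injective γ.2 η.2 heq)
  · obtain ⟨γ, hγ, rfl⟩ := h.exists_code_of_mem_level hK
    exact ⟨⟨γ, hγ⟩, mem_univ _, rfl⟩

theorem Setting.prefix_iff (h : Setting V c) {k : ℕ} {γ : Fin (k + 1) → Letter}
    {η : Fin (k + 2) → Letter} (hγ : γ ∈ codes c k) (hη : η ∈ codes c (k + 1)) :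
    ((∀ i : Fin (k + 1), γ i = η i.castSucc) ↔ bandOf V c (k + 1) η ⊆ bandOf V c k γ) ∧
      (bandOf V c (k + 1) η ⊆ bandOf V c k γ ↔
        (bandOf V c k γ ∩ bandOf V c (k + 1) η).Nonempty) := by
  have h1 : (∀ i : Fin (k + 1), γ i = η i.castSucc) →
      bandOf V c (k + 1) η ⊆ bandOf V c k γ := by
    intro heq
    have : γ = fun i => η i.castSucc := funext heq
    rw [this]
    exact h.bandOf_subset_init hη
  have h2 : bandOf V c (k + 1) η ⊆ bandOf V c k γ →
      (bandOf V c k γ ∩ bandOf V c (k + 1) η).Nonempty := by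
    intro hsub
    obtain ⟨E, hE⟩ := (h.hasLetter hη).nonempty
    exact ⟨E, hsub hE, hE⟩
  have h3 : (bandOf V c k γ ∩ bandOf V c (k + 1) η).Nonempty →
      ∀ i : Fin (k + 1), γ i = η i.castSucc :=
    fun hne => congr_fun (h.eq_trunc_of_inter (Nat.le_succ k) hγ hη hne)
  exact ⟨⟨h1, fun hs => h3 (h2 hs)⟩, ⟨h2, fun hne => h1 (h3 hne)⟩⟩

theorem codeBefore_of_last {k : ℕ} {γ η : Fin (k + 2) → Letter}
    (heq : ∀ i : Fin (k + 1), γ i.castSucc = η i.castSucc) :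
    codeBefore γ η ↔ (γ (Fin.last (k + 1))).before (η (Fin.last (k + 1))) := by
  constructor
  · rintro ⟨j, hj, _, _, hlt⟩
    rcases (Nat.lt_succ_iff.1 hj).lt_or_eq with h | rfl
    · have := heq ⟨j, h⟩
      change γ ⟨j, hj⟩ = η ⟨j, hj⟩ at this
      rw [this] at hlt
      exact absurd hlt (Letter.not_before_self _)
    · exact hlt
  · exact fun h => ⟨k + 1, by omega, by omega, fun i hi => heq ⟨i, hi⟩, h⟩

/-- The coding map is determined by bijectivity, inclusions, order and the types at level `0`. -/
theorem Setting.unique (h : Setting V c) (B : ∀ k, codes c k → Set ℝ)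
    (h1 : ∀ k, BijOn (B k) univ (level (coK c k) V))
    (h2 : ∀ k (γ : codes c k) (η : codes c (k + 1)),
      (∀ i : Fin (k + 1), γ.1 i = η.1 i.castSucc) → B (k + 1) η ⊆ B k γ)
    (h3 : ∀ k (γ η : codes c k), codeBefore γ.1 η.1 → StrictLeftOf (B k γ) (B k η))
    (h4 : ∀ γ : codes c 0, (∃ i, γ.1 (Fin.last 0) = .A i) ↔ TypeA (coK c 0) V (B 0 γ))
    (k : ℕ) (γ : codes c k) : B k γ = bandOf V c k γ := by
  -- Both maps reach the same levels, so `B` factors through `bandOf` by a self-map `f` of the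
  -- codes; it remains to show that `f` is the identity.
  have hf : ∀ k (γ : codes c k), ∃ η : codes c k, bandOf V c k η = B k γ := fun k γ => by
    obtain ⟨η, hη, hB⟩ := h.exists_code_of_mem_level ((h1 k).mapsTo (mem_univ γ))
    exact ⟨⟨η, hη⟩, hB⟩
  choose f hf using hf
  have hfs : ∀ k, Function.Surjective (f k) := by
    intro k η
    obtain ⟨γ, -, hγ⟩ := (h1 k).surjOn (h.bandOf_mem_level η.2)
    refine ⟨γ, Subtype.ext (h.bandOf_injective (f k γ).2 η.2 ?_)⟩
    rw [hf, hγ]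
  have hlt : ∀ k (γ η : codes c k), codeBefore γ.1 η.1 → codeBefore (f k γ).1 (f k η).1 := by
    intro k γ η hlt
    rw [h.codeBefore_iff (f k γ).2 (f k η).2, hf, hf]
    exact h3 k γ η hlt
  suffices hid : f k γ = γ by rw [← hf, hid]
  induction k with
  | zero =>
    have hA := h4 γ
    rw [← hf, ← (h.hasLetter (f 0 γ).2).typeA_iff h.four_lt (h.valid 0)] at hA
    apply Subtype.ext
    funext i
    obtain rfl : i = 0 := Fin.ext (by omega)
    rw [show Fin.last 0 = 0 from rfl] at hA
    rcases γ.2.1 with e1 | e1 <;> rcases (f 0 γ).2.1 with e2 | e2 <;> rw [e1, e2] at hA ⊢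
    · exact absurd (hA.1 ⟨1, rfl⟩) (by simp)
    · exact absurd (hA.2 ⟨1, rfl⟩) (by simp)
  | succ k ih =>
    -- Since `f k` is the identity, the inclusion property forces `f (k + 1)` to preserve prefixes.
    have htr : ∀ ξ : codes c (k + 1), ∀ i : Fin (k + 1),
        (f (k + 1) ξ).1 i.castSucc = ξ.1 i.castSucc := by
      intro ξ i
      let τ : codes c k := ⟨trunc (Nat.le_succ k) ξ.1, trunc_mem _ ξ.2⟩
      have hτ : B (k + 1) ξ ⊆ B k τ := h2 k τ ξ fun _ => rfl
      rw [← hf, ← hf k τ, ih τ] at hτ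
      exact (((h.prefix_iff τ.2 (f (k + 1) ξ).2).1.2 hτ) i).symm
    -- On the continuations of one prefix, ranked by their last letter, `f` is a strictly monotone
    -- surjection.
    let X := {ξ : codes c (k + 1) // ∀ i : Fin (k + 1), ξ.1 i.castSucc = γ.1 i.castSucc}
    let F : X → X := fun ξ => ⟨f (k + 1) ξ.1, fun i => (htr ξ.1 i).trans (ξ.2 i)⟩
    let r : X → ℕ := fun ξ => (ξ.1.1 (Fin.last (k + 1))).idx
    have hnext : ∀ ξ : X, ξ.1.1 (Fin.last (k + 1)) ∈
        Letter.next (c (k + 1)) (γ.1 (Fin.last k).castSucc) := by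
      intro ξ
      have := ξ.1.2.2 (Fin.last k)
      rw [ξ.2 (Fin.last k)] at this
      exact this
    have hr : ∀ ξ ζ : X, codeBefore ξ.1.1 ζ.1.1 ↔ r ξ < r ζ := by
      intro ξ ζ
      rw [codeBefore_of_last fun i => (ξ.2 i).trans (ζ.2 i).symm]
      exact Letter.before_iff_idx (hnext ξ) (hnext ζ)
    have hrinj : Function.Injective r := by
      intro ξ ζ hξζ
      apply Subtype.ext
      apply Subtype.ext
      funext i
      refine Fin.lastCases ?_ (fun i => ?_) i
      · exact Letter.idx_injective hξζ
      · rw [ξ.2 i, ζ.2 i]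
    have hFs : Function.Surjective F := by
      intro ζ
      obtain ⟨ξ, hξ⟩ := hfs (k + 1) ζ.1
      refine ⟨⟨ξ, fun i => ?_⟩, Subtype.ext hξ⟩
      rw [← htr ξ i, hξ, ζ.2 i]
    have := eq_self_of_strictMono_surjective r hrinj F
      (fun ξ ζ hlt' => (hr _ _).1 (hlt _ _ _ ((hr ξ ζ).2 hlt'))) hFs ⟨γ, fun _ => rfl⟩
    exact congr_arg Subtype.val this

end

end SturmianCoding

theorem mainTheorem4 (α : ℝ) (hα01 : α ∈ Set.Icc (0 : ℝ) 1) (hα : Irrational α)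
    (c : ℕ → ℕ) (hc : SturmianCoding.IsContFracExpansion α c) (V : ℝ) (hV : 4 < V) :
    ∃! b : (Σ k : ℕ, SturmianCoding.codes c k) →
        (⋃ k : ℕ, SturmianCoding.level (SturmianCoding.coK c k) V : Set (Set ℝ)),
      -- bijectivity on each length
      (∀ k : ℕ, Set.BijOn (fun γ : SturmianCoding.codes c k => (b ⟨k, γ⟩ : Set ℝ)) Set.univ
        (SturmianCoding.level (SturmianCoding.coK c k) V)) ∧
      -- prefixes and inclusions
      (∀ (k : ℕ) (γ : SturmianCoding.codes c k) (η : SturmianCoding.codes c (k + 1)),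
        ((∀ i : Fin (k + 1), γ.1 i = η.1 i.castSucc) ↔
          (b ⟨k + 1, η⟩ : Set ℝ) ⊆ (b ⟨k, γ⟩ : Set ℝ)) ∧
        ((b ⟨k + 1, η⟩ : Set ℝ) ⊆ (b ⟨k, γ⟩ : Set ℝ) ↔
          ((b ⟨k, γ⟩ : Set ℝ) ∩ (b ⟨k + 1, η⟩ : Set ℝ)).Nonempty)) ∧
      -- order
      (∀ γ η : (Σ k : ℕ, SturmianCoding.codes c k),
        SturmianCoding.codeBefore γ.2.1 η.2.1 ↔
          SturmianCoding.StrictLeftOf (b γ : Set ℝ) (b η : Set ℝ)) ∧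
      -- types
      (∀ (k : ℕ) (γ : SturmianCoding.codes c k),
        ((∃ i, γ.1 (Fin.last k) = SturmianCoding.Letter.A i) ↔
          SturmianCoding.TypeA (SturmianCoding.coK c k) V (b ⟨k, γ⟩)) ∧
        (γ.1 (Fin.last k) = SturmianCoding.Letter.B ↔
          SturmianCoding.TypeB (SturmianCoding.coK c k) V (b ⟨k, γ⟩)) ∧
        ((∃ i, γ.1 (Fin.last k) = SturmianCoding.Letter.G i) ↔
          SturmianCoding.TypeB (1 :: SturmianCoding.coK c k) V (b ⟨k, γ⟩) ∧
            (b ⟨k, γ⟩ : Set ℝ) ∩ SturmianCoding.spec (SturmianCoding.coK c k) V = ∅)) := by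
  have h := SturmianCoding.setting_of_isContFracExpansion hα01 hα hc hV
  refine ⟨fun γ => ⟨SturmianCoding.bandOf V c γ.1 γ.2.1,
    Set.mem_iUnion.2 ⟨γ.1, h.bandOf_mem_level γ.2.2⟩⟩, ⟨h.bijOn, ?_, ?_, ?_⟩, ?_⟩
  · exact fun k γ η => h.prefix_iff γ.2 η.2
  · exact fun γ η => h.codeBefore_iff γ.2.2 η.2.2
  · intro k γ
    have hL := h.hasLetter γ.2
    exact ⟨hL.typeA_iff hV (h.valid k), hL.typeB_iff hV (h.valid k), hL.typeG_iff hV (h.valid k)⟩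
  · rintro b ⟨h1, h2, h3, h4⟩
    funext ⟨k, γ⟩
    apply Subtype.ext
    -- Bijectivity, one direction each of the inclusion and order properties, and type `A` at length
    -- one already determine the map.
    exact h.unique (fun k γ => (b ⟨k, γ⟩ : Set ℝ)) h1 (fun k γ η => (h2 k γ η).1.1)
      (fun k γ η => (h3 ⟨k, γ⟩ ⟨k, η⟩).1) (fun γ => (h4 0 γ).1) k γ
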